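/- Let $\mathfrak{h}$ be the complex Lie algebra with basis $E,F,I,J$ and nonzero brackets $[E,F]=I$, $[J,E]=E$, $[J,F]=-F$ (modulo antisymmetry), with the invariant symmetric form $\kappa(E,F)=\kappa(I,J)=1$, all other entries $0$. Let $\widehat{\mathfrak{h}}=\mathfrak{h}\otimes\mathbb{C}[t,t^{-1}]\oplus\mathbb{C}K$ be its affinisation: with $A_n=A\otimes t^n$, one has $[A_m,B_n]=[A,B]_{m+n}+m\,\kappa(A,B)\,\delta_{m+n,0}K$ and $K$ is central. For an $\mathfrak{h}$-module $W$, let $\operatorname{Ind}W$ be the $\widehat{\mathfrak{h}}$-module induced from $W$, where $A_0$ acts on $W$ as $A$, the $A_n$ with $n>0$ act as $0$ and $K$ acts as $1$. Let $L_0$ be the zero mode of ${:}EF{:}+{:}IJ{:}-\tfrac12\partial I-\tfrac12{:}II{:}$. For $i,j\in\mathbb{C}$, let $\overline{V}^{+}_{i,j}$ (resp. $\overline{V}^{-}_{i,j}$) be the $\mathfrak{h}$-module induced from the one-dimensional module of $\operatorname{span}\{E,I,J\}$ (resp. $\operatorname{span}\{F,I,J\}$) on which $E$ (resp. $F$), $I$,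 $J$ act as $0,i,j$. Let $L^{\pm}_{i,j}$ be the quotient of $\operatorname{Ind}\overline{V}^{\pm}_{i,j}$ by the sum of its proper submodules. For $i,j,h\in\mathbb{C}$, put $Q=FE+IJ\in U(\mathfrak{h})$ and let $\overline{R}_{i,j;h}$ be the $\mathfrak{h}$-module induced from the one-dimensional $\mathbb{C}[I,J,Q]$-module on which $I,J,Q$ act as $i,j,h$. The ground states of $\operatorname{Ind}\overline{R}_{i,j;h}$ are its vectors of minimal conformal weight, that is, those on which $L_0$ acts as $h+\tfrac{i}{2}-\tfrac{i^2}{2}$. Let $E_{i,j;h}$ be the quotient of $\operatorname{Ind}\overline{R}_{i,j;h}$ by the sum of all submodules that have zero intersection with the space of ground states. For $i\neq0$, write $E^{+}_{i;h}$ for $E_{i,j;h}$ with $j\in h/i+\mathbb{Z}_{\geq1}$, and $E^{-}_{i;h}$ for $E_{i,j;h}$ with $j\in h/i-\mathbb{Z}_{\geq0}$ (up to isomorphism, these do not depend on the choice of such a $j$). **Theorem.** Let $i,h\in\mathbb{C}$ with $i\neq0$. For every choice of $j$ as above, there are nonsplit short exact sequences of $\widehat{\mathfrak{h}}$-modules $$0\to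 L^{+}_{i,h/i}\to E^{+}_{i;h}\to L^{-}_{i,h/i+1}\to0,\qquad 0\to L^{-}_{i,h/i+1}\to E^{-}_{i;h}\to L^{+}_{i,h/i}\to0.$$ Moreover, $L^{+}_{i,h/i}$ and $L^{-}_{i,h/i+1}$ are irreducible, and $E^{+}_{i;h}$ and $E^{-}_{i;h}$ are indecomposable of length two; each therefore has exactly the two composition factors $L^{+}_{i,h/i}$ and $L^{-}_{i,h/i+1}$. -/

import Mathlib

open scoped TensorProduct

noncomputable section

namespace NappiWitten

/-! ### The Lie algebra `H4` -/

/-- The four-dimensional complex Lie algebra with basis `E, F, I, J`; an element is written by its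
coordinates `x 0, x 1, x 2, x 3` with respect to `E, F, I, J`. -/
def H4 : Type := Fin 4 → ℂ

namespace H4

instance : AddCommGroup H4 := inferInstanceAs (AddCommGroup (Fin 4 → ℂ))
instance : Module ℂ H4 := inferInstanceAs (Module ℂ (Fin 4 → ℂ))

def E : H4 := ![1, 0, 0, 0]
def F : H4 := ![0, 1, 0, 0]
def I : H4 := ![0, 0, 1, 0]
def J : H4 := ![0, 0, 0, 1]

@[ext] theorem ext {x y : H4} (h0 : x 0 = y 0) (h1 : x 1 = y 1) (h2 : x 2 = y 2)
    (h3 : x 3 = y 3) : x = y := by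
  funext k; fin_cases k <;> assumption

@[simp] theorem add_apply (x y : H4) (k : Fin 4) : (x + y) k = x k + y k := rfl
@[simp] theorem neg_apply (x : H4) (k : Fin 4) : (-x) k = -x k := rfl
@[simp] theorem smul_apply (c : ℂ) (x : H4) (k : Fin 4) : (c • x) k = c * x k := rfl
@[simp] theorem zero_apply (k : Fin 4) : (0 : H4) k = 0 := rfl

/-- The bilinear bracket with `[E, F] = I`, `[J, E] = E`, `[J, F] = -F` and `I` central. -/
instance : Bracket H4 H4 where
  bracket x y :=
    ![x 3 * y 0 - x 0 * y 3, x 1 * y 3 - x 3 * y 1, x 0 * y 1 - x 1 * y 0, 0]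

@[simp] theorem lie_apply_zero (x y : H4) : ⁅x, y⁆ 0 = x 3 * y 0 - x 0 * y 3 := rfl
@[simp] theorem lie_apply_one (x y : H4) : ⁅x, y⁆ 1 = x 1 * y 3 - x 3 * y 1 := rfl
@[simp] theorem lie_apply_two (x y : H4) : ⁅x, y⁆ 2 = x 0 * y 1 - x 1 * y 0 := rfl
@[simp] theorem lie_apply_three (x y : H4) : ⁅x, y⁆ 3 = 0 := rfl

instance : LieRing H4 where
  add_lie x y z := by ext <;> simp <;> ring
  lie_add x y z := by ext <;> simp <;> ring
  lie_self x := by ext <;> simp <;> ring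
  leibniz_lie x y z := by ext <;> simp <;> ring

instance : LieAlgebra ℂ H4 where
  lie_smul c x y := by ext <;> simp <;> ring

theorem lie_E_F : ⁅E, F⁆ = I := by ext <;> simp <;> simp [E, F, I]
theorem lie_J_E : ⁅J, E⁆ = E := by ext <;> simp <;> simp [J, E]
theorem lie_J_F : ⁅J, F⁆ = -F := by ext <;> simp <;> simp [J, F]
theorem lie_I (x : H4) : ⁅I, x⁆ = 0 := by ext <;> simp <;> simp [I]

/-- The invariant symmetric bilinear form with `κ(E, F) = κ(I, J) = 1`, all other entries `0`. -/
def form : LinearMap.BilinForm ℂ H4 :=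
  LinearMap.mk₂ ℂ (fun x y => x 0 * y 1 + x 1 * y 0 + x 2 * y 3 + x 3 * y 2)
    (fun x y z => by simp only [add_apply]; ring)
    (fun c x y => by simp only [smul_apply, smul_eq_mul]; ring)
    (fun x y z => by simp only [add_apply]; ring)
    (fun c x y => by simp only [smul_apply, smul_eq_mul]; ring)

theorem form_apply (x y : H4) :
    form x y = x 0 * y 1 + x 1 * y 0 + x 2 * y 3 + x 3 * y 2 := rfl

theorem neg_form_invariant : (-form).lieInvariant H4 := by
  intro x y z
  simp [form_apply]
  ring

theorem neg_form_isSymm : (-form).IsSymm := by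
  refine ⟨fun x y => ?_⟩
  simp [form_apply]
  ring

end H4

/-! ### The affine Lie algebra -/

/-- The 2-cocycle `(A ⊗ t^m, B ⊗ t^n) ↦ m κ(A, B) δ_{m+n,0}` on the loop algebra of `H4`.  (The
cocycle that Mathlib attaches to a form `Φ` is `n Φ(A, B) δ_{m+n,0}`, whence the sign.) -/
def affineCocycle :=
  LieAlgebra.LoopAlgebra.twoCocycleOfBilinear ℂ ℤ H4 (-H4.form)
    H4.neg_form_invariant H4.neg_form_isSymm

/-- The affine Lie algebra `H4 ⊗ ℂ[t, t⁻¹] ⊕ ℂ K`. -/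
def AffineH4 : Type := LieAlgebra.ofTwoCocycle affineCocycle

namespace AffineH4

instance : LieRing AffineH4 := inferInstanceAs (LieRing (LieAlgebra.ofTwoCocycle affineCocycle))
instance : LieAlgebra ℂ AffineH4 :=
  inferInstanceAs (LieAlgebra ℂ (LieAlgebra.ofTwoCocycle affineCocycle))

/-- The mode `A_n = A ⊗ t^n`. -/
def mode (A : H4) (n : ℤ) : AffineH4 :=
  LieAlgebra.ofProd affineCocycle (AddMonoidAlgebra.single n 1 ⊗ₜ[ℂ] A, 0)

/-- The central element `K`. -/
def K : AffineH4 :=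
  LieAlgebra.ofProd affineCocycle
    (0, (TrivialLieModule.equiv ℂ (LieAlgebra.loopAlgebra ℂ ℤ H4) ℂ).symm 1)

/-- The affine bracket is `[A_m, B_n] = [A, B]_{m+n} + m κ(A, B) δ_{m+n,0} K`. -/
theorem lie_mode_mode (A B : H4) (m n : ℤ) :
    ⁅mode A m, mode B n⁆ =
      mode ⁅A, B⁆ (m + n) + (if m + n = 0 then (m : ℂ) * H4.form A B else 0) • K := by
  have h1 : (affineCocycle : LieAlgebra.loopAlgebra ℂ ℤ H4 →ₗ[ℂ] LieAlgebra.loopAlgebra ℂ ℤ H4 →ₗ[ℂ]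
        TrivialLieModule ℂ (LieAlgebra.loopAlgebra ℂ ℤ H4) ℂ)
      (AddMonoidAlgebra.single m 1 ⊗ₜ[ℂ] A) (AddMonoidAlgebra.single n 1 ⊗ₜ[ℂ] B) =
      (TrivialLieModule.equiv ℂ (LieAlgebra.loopAlgebra ℂ ℤ H4) ℂ).symm
        (if m + n = 0 then (m : ℂ) * H4.form A B else 0) := by
    change (TrivialLieModule.equiv ℂ (LieAlgebra.loopAlgebra ℂ ℤ H4) ℂ).symm
      (LieAlgebra.LoopAlgebra.residuePairing ℂ ℤ H4 (-H4.form) _ _) = _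
    congr 1
    rw [LieAlgebra.LoopAlgebra.residuePairing_apply_apply,
      LieAlgebra.LoopAlgebra.toFinsupp_single_tmul, LieAlgebra.LoopAlgebra.toFinsupp_single_tmul,
      Finsupp.sum_single_index (by simp), Finsupp.single_apply]
    by_cases hmn : m + n = 0
    · obtain rfl : m = -n := by omega
      simp
    · rw [if_neg (by omega), if_neg hmn]
      simp
  change LieAlgebra.ofProd affineCocycle
      (⁅(AddMonoidAlgebra.single m (1 : ℂ) ⊗ₜ[ℂ] A : LieAlgebra.loopAlgebra ℂ ℤ H4),
          (AddMonoidAlgebra.single n 1 ⊗ₜ[ℂ] B : LieAlgebra.loopAlgebra ℂ ℤ H4)⁆,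
        (affineCocycle : LieAlgebra.loopAlgebra ℂ ℤ H4 →ₗ[ℂ] LieAlgebra.loopAlgebra ℂ ℤ H4 →ₗ[ℂ]
        TrivialLieModule ℂ (LieAlgebra.loopAlgebra ℂ ℤ H4) ℂ)
          (AddMonoidAlgebra.single m 1 ⊗ₜ[ℂ] A) (AddMonoidAlgebra.single n 1 ⊗ₜ[ℂ] B) +
          ⁅_, (0 : TrivialLieModule ℂ (LieAlgebra.loopAlgebra ℂ ℤ H4) ℂ)⁆ -
          ⁅_, (0 : TrivialLieModule ℂ (LieAlgebra.loopAlgebra ℂ ℤ H4) ℂ)⁆) =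
    LieAlgebra.ofProd affineCocycle
      ((AddMonoidAlgebra.single (m + n) (1 : ℂ) ⊗ₜ[ℂ] ⁅A, B⁆ : LieAlgebra.loopAlgebra ℂ ℤ H4) +
          (if m + n = 0 then (m : ℂ) * H4.form A B else 0) • 0,
        0 + (if m + n = 0 then (m : ℂ) * H4.form A B else 0) •
          (TrivialLieModule.equiv ℂ (LieAlgebra.loopAlgebra ℂ ℤ H4) ℂ).symm 1)
  rw [h1, lie_zero, lie_zero, add_zero, sub_zero, smul_zero, add_zero, zero_add, ← map_smul,
    LieAlgebra.ExtendScalars.bracket_tmul, AddMonoidAlgebra.single_mul_single, mul_one,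
    smul_eq_mul, mul_one]

/-- `K` is central. -/
theorem lie_mode_K (A : H4) (m : ℤ) : ⁅mode A m, K⁆ = 0 := by
  have hh (x : LieAlgebra.loopAlgebra ℂ ℤ H4) : ⁅x, (0 : LieAlgebra.loopAlgebra ℂ ℤ H4)⁆ = 0 :=
    lie_zero x
  change LieAlgebra.ofProd affineCocycle
      (⁅(AddMonoidAlgebra.single m (1 : ℂ) ⊗ₜ[ℂ] A : LieAlgebra.loopAlgebra ℂ ℤ H4),
          (0 : LieAlgebra.loopAlgebra ℂ ℤ H4)⁆,
        (affineCocycle : LieAlgebra.loopAlgebra ℂ ℤ H4 →ₗ[ℂ] LieAlgebra.loopAlgebra ℂ ℤ H4 →ₗ[ℂ]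
        TrivialLieModule ℂ (LieAlgebra.loopAlgebra ℂ ℤ H4) ℂ)
          (AddMonoidAlgebra.single m 1 ⊗ₜ[ℂ] A) 0 +
          ⁅(AddMonoidAlgebra.single m (1 : ℂ) ⊗ₜ[ℂ] A : LieAlgebra.loopAlgebra ℂ ℤ H4),
            (TrivialLieModule.equiv ℂ (LieAlgebra.loopAlgebra ℂ ℤ H4) ℂ).symm 1⁆ -
          ⁅(0 : LieAlgebra.loopAlgebra ℂ ℤ H4), (0 : TrivialLieModule ℂ (LieAlgebra.loopAlgebra ℂ ℤ H4) ℂ)⁆) =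
    LieAlgebra.ofProd affineCocycle (0, 0)
  rw [hh, map_zero, trivial_lie_zero (LieAlgebra.loopAlgebra ℂ ℤ H4)
    (TrivialLieModule ℂ (LieAlgebra.loopAlgebra ℂ ℤ H4) ℂ), lie_zero, add_zero, sub_zero]

end AffineH4

/-! ### Modules over `H4` and induction to the affine algebra

Modules over a Lie algebra are modules over its universal enveloping algebra. -/

/-- The universal enveloping algebra of `H4`. -/
abbrev U4 : Type := UniversalEnvelopingAlgebra ℂ H4

/-- The universal enveloping algebra of the affine Lie algebra. -/
abbrev UA : Type := UniversalEnvelopingAlgebra ℂ AffineH4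

/-- `x ∈ H4` as an element of the enveloping algebra. -/
def u4 (x : H4) : U4 := UniversalEnvelopingAlgebra.ι ℂ x

/-- The mode `A_n` as an element of the enveloping algebra. -/
def ua (A : H4) (n : ℤ) : UA := UniversalEnvelopingAlgebra.ι ℂ (AffineH4.mode A n)

/-- The central element `K` as an element of the enveloping algebra. -/
def uK : UA := UniversalEnvelopingAlgebra.ι ℂ AffineH4.K

/-- The quadratic Casimir element `Q = F E + I J`. -/
def casimir : U4 := u4 H4.F * u4 H4.E + u4 H4.I * u4 H4.J

/-- The cyclic `H4`-module with one generator, subject to the relations that the elements of `S`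
annihilate the generator.  If a subalgebra acts on a line through a character `χ` and `S` generates
the kernel of `χ`, this is the module induced from that line. -/
def CyclicModule (S : Set U4) : Type := U4 ⧸ Submodule.span U4 S

namespace CyclicModule

variable (S : Set U4)

instance : AddCommGroup (CyclicModule S) :=
  inferInstanceAs (AddCommGroup (U4 ⧸ Submodule.span U4 S))
instance : Module U4 (CyclicModule S) := inferInstanceAs (Module U4 (U4 ⧸ Submodule.span U4 S))
instance : Module ℂ (CyclicModule S) := inferInstanceAs (Module ℂ (U4 ⧸ Submodule.span U4 S))
instance : IsScalarTower ℂ U4 (CyclicModule S) :=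
  inferInstanceAs (IsScalarTower ℂ U4 (U4 ⧸ Submodule.span U4 S))

end CyclicModule

/-- The highest-weight Verma module of `H4`, induced from the one-dimensional module of
`span {E, I, J}` on which `E, I, J` act as `0, i, j`. -/
abbrev FinVermaPlus (i j : ℂ) : Type :=
  CyclicModule
    {u4 H4.E, u4 H4.I - algebraMap ℂ U4 i, u4 H4.J - algebraMap ℂ U4 j}

/-- The lowest-weight Verma module of `H4`, induced from the one-dimensional module of
`span {F, I, J}` on which `F, I, J` act as `0, i, j`. -/
abbrev FinVermaMinus (i j : ℂ) : Type :=
  CyclicModule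
    {u4 H4.F, u4 H4.I - algebraMap ℂ U4 i, u4 H4.J - algebraMap ℂ U4 j}

/-- The dense module of `H4`, induced from the one-dimensional module of the subalgebra
`ℂ[I, J, Q]` of the enveloping algebra on which `I, J, Q` act as `i, j, h`. -/
abbrev FinDense (i j h : ℂ) : Type :=
  CyclicModule
    {u4 H4.I - algebraMap ℂ U4 i, u4 H4.J - algebraMap ℂ U4 j, casimir - algebraMap ℂ U4 h}

section Induction

variable (W : Type) [AddCommGroup W] [Module ℂ W] [Module U4 W]

/-- The relations that make `U ⊗_ℂ W` into the tensor product over the enveloping algebra of the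
subalgebra spanned by `K` and the `A_n` with `n ≥ 0`, where `A_0` acts on `W` as `A`, the `A_n` with
`n > 0` act as `0`, and `K` acts as the identity. -/
def inducedRelations : Submodule UA (UA ⊗[ℂ] W) :=
  Submodule.span UA
    ({x | ∃ (A : H4) (w : W), x = ua A 0 ⊗ₜ[ℂ] w - 1 ⊗ₜ[ℂ] (u4 A • w)} ∪
      {x | ∃ (A : H4) (n : ℤ) (w : W), 0 < n ∧ x = ua A n ⊗ₜ[ℂ] w} ∪
      {x | ∃ w : W, x = uK ⊗ₜ[ℂ] w - 1 ⊗ₜ[ℂ] w})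

/-- The level-one module of the affine algebra induced from the `H4`-module `W`. -/
def Induced : Type := (UA ⊗[ℂ] W) ⧸ inducedRelations W

instance : AddCommGroup (Induced W) :=
  inferInstanceAs (AddCommGroup ((UA ⊗[ℂ] W) ⧸ inducedRelations W))
instance : Module UA (Induced W) := inferInstanceAs (Module UA ((UA ⊗[ℂ] W) ⧸ inducedRelations W))
instance : Module ℂ (Induced W) := inferInstanceAs (Module ℂ ((UA ⊗[ℂ] W) ⧸ inducedRelations W))
instance : IsScalarTower ℂ UA (Induced W) :=
  inferInstanceAs (IsScalarTower ℂ UA ((UA ⊗[ℂ] W) ⧸ inducedRelations W))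

end Induction

/-- The Verma modules of the affine algebra. -/
abbrev VermaPlus (i j : ℂ) : Type := Induced (FinVermaPlus i j)
abbrev VermaMinus (i j : ℂ) : Type := Induced (FinVermaMinus i j)

/-- The relaxed module induced from a dense `H4`-module. -/
abbrev Relaxed (i j h : ℂ) : Type := Induced (FinDense i j h)

/-- The sum of all proper submodules. -/
def maxSubmodule (M : Type) [AddCommGroup M] [Module UA M] : Submodule UA M :=
  sSup {N | N ≠ ⊤}

/-- The irreducible quotients of the Verma modules of the affine algebra. -/
abbrev IrrPlus (i j : ℂ) : Type := VermaPlus i j ⧸ maxSubmodule (VermaPlus i j)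
abbrev IrrMinus (i j : ℂ) : Type := VermaMinus i j ⧸ maxSubmodule (VermaMinus i j)

/-! ### Ground states -/

/-- The Virasoro zero mode at level `1`, that is, the zero mode of
`:E F: + :I J: - (∂ I) / 2 - (:I I:) / 2`.  The sum is finite on every vector that is annihilated
by `A_n` for all `A` and all sufficiently large `n`; this holds for all vectors of an induced
module. -/
def virasoroL0 {M : Type} [AddCommGroup M] [Module UA M] (v : M) : M :=
  (ua H4.F 0 * ua H4.E 0 + ua H4.I 0 * ua H4.J 0 +
      algebraMap ℂ UA (1 / 2) * (ua H4.I 0 - ua H4.I 0 * ua H4.I 0)) • v +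
    ∑ᶠ n : {n : ℤ // 0 < n},
      (ua H4.E (-n) * ua H4.F n + ua H4.F (-n) * ua H4.E n +
        ua H4.I (-n) * ua H4.J n + ua H4.J (-n) * ua H4.I n - ua H4.I (-n) * ua H4.I n) • v

/-- The minimal conformal weight of `Relaxed i j h`. -/
def minConfWeight (i h : ℂ) : ℂ := h + i * (1 / 2 - i / 2)

/-- The ground states of `Relaxed i j h` are the vectors of minimal conformal weight. -/
def IsGroundState {i j h : ℂ} (v : Relaxed i j h) : Prop :=
  virasoroL0 v = algebraMap ℂ UA (minConfWeight i h) • v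

/-- The sum of all submodules of `Relaxed i j h` that have zero intersection with the space of
ground states. -/
def groundFree (i j h : ℂ) : Submodule UA (Relaxed i j h) :=
  sSup {N | ∀ v ∈ N, IsGroundState v → v = 0}

/-- The quotient of `Relaxed i j h` by the sum of all submodules that have zero intersection with
the space of ground states. -/
abbrev RelaxedQuo (i j h : ℂ) : Type := Relaxed i j h ⧸ groundFree i j h

/-- For `i ≠ 0`, the dense `H4`-modules `FinDense i j h` with `j ∈ h / i + {1, 2, 3, …}` are all
isomorphic and are the reducible ones with a highest-weight vector; `n` selects one of them. -/
abbrev RelaxedQuoPlus (i h : ℂ) (n : ℕ) : Type := RelaxedQuo i (h / i + 1 + n) h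

/-- For `i ≠ 0`, the dense `H4`-modules `FinDense i j h` with `j ∈ h / i - {0, 1, 2, …}` are all
isomorphic and are the reducible ones with a lowest-weight vector; `n` selects one of them. -/
abbrev RelaxedQuoMinus (i h : ℂ) (n : ℕ) : Type := RelaxedQuo i (h / i - n) h

/-! ### Exact sequences and indecomposability -/

/-- `0 → A → B → C → 0` is a nonsplit short exact sequence of modules. -/
structure IsNonsplitShortExact {A B C : Type} [AddCommGroup A] [Module UA A] [AddCommGroup B]
    [Module UA B] [AddCommGroup C] [Module UA C] (f : A →ₗ[UA] B) (g : B →ₗ[UA] C) : Prop where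
  injective : Function.Injective f
  exact : Function.Exact f g
  surjective : Function.Surjective g
  nonsplit : ¬ ∃ s : C →ₗ[UA] B, g ∘ₗ s = LinearMap.id

/-- A nonzero module that is not the direct sum of two nonzero submodules. -/
def IsIndecomposable (M : Type) [AddCommGroup M] [Module UA M] : Prop :=
  Nontrivial M ∧ ∀ N N' : Submodule UA M, IsCompl N N' → N = ⊥ ∨ N' = ⊥

end NappiWitten

end

/-!
# Relaxed modules of the affine Nappi–Witten algebra at their reducible points

A relaxed module is generated by a ladder of ground states `w p`, indexed by an integer `p` that
records the eigenvalue of `J_0`.  The zero modes of `E` and `F` move along the ladder, and the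
Casimir element shows that, for `i ≠ 0` and `j` in the stated cosets, precisely one step is
obstructed: `w 1` is annihilated by the operator `down_0` that lowers `p`.  (Here `down` is `F` or
`E`, depending on the coset; `IsOriented` treats both cases at once.)  After division by the
submodules without ground states every nonzero submodule contains some `w p`, and hence `w 1`
(`IsReducedLadder.w_one_mem`).  So the submodule `A` generated by `w 1` is simple and essential,
which gives indecomposability and nonsplitness.

The quotient by `A` is simple as well (`IsReducedLadder.isSimpleModule_quotient`).  Let `X` be a
submodule that contains no `w p` with `p ≤ 0`.  Vectors of `X` of relative conformal weight `d` and
index `p` with `d + p ≤ 0` can only be sent to such `w p` by positive modes, so they generate a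
submodule without ground states and vanish.  Modulo `A`, vectors with `p > d` vanish too, because
the ladder of the quotient consists of the `w p` with `p ≤ 0`.  Hence `up_0` and `down_0` are
locally nilpotent on the image of `X` modulo `A`.  Since `[up_0, down_0] = ± i` is a nonzero scalar,
this image is zero (`IsReducedLadder.le_span_of_w_notMem`).

The decomposition into joint eigenspaces of `L_0` and `J_0` on which this rests follows from
`[L_0, A_m] = -m A_m` (`virasoroL0_smul_ua`).  That the ground states of the relaxed module do not
vanish is seen in a free field realisation (`exists_rungs`), in which all rungs are nonzero; it
takes the place of a basis theorem for the universal enveloping algebra.  The vector `w 1` and the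
image of `w 0` modulo `A` satisfy the relations of the generators of Verma modules, and this
identifies `A` and the quotient by it with the irreducible quotients of these
(`nonempty_irr_equiv`).
-/

noncomputable section

namespace NappiWitten

/-! ### Modes in the enveloping algebra -/

section Modes

attribute [local instance] LieRing.ofAssociativeRing


theorem H4.eq_sum (A : H4) : A = A 0 • H4.E + A 1 • H4.F + A 2 • H4.I + A 3 • H4.J := by
  ext <;> simp only [H4.add_apply, H4.smul_apply] <;> simp [H4.E, H4.F, H4.I, H4.J]

namespace AffineH4

/-- The loop algebra as a subspace of the affine algebra. -/
def ofLoop : LieAlgebra.loopAlgebra ℂ ℤ H4 →ₗ[ℂ] AffineH4 where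
  toFun x := LieAlgebra.ofProd affineCocycle (x, 0)
  map_add' x y := by
    rw [show ((x + y, 0) : _ × TrivialLieModule ℂ (LieAlgebra.loopAlgebra ℂ ℤ H4) ℂ) =
      (x, 0) + (y, 0) by simp]
    rfl
  map_smul' c x := by
    rw [show ((c • x, 0) : _ × TrivialLieModule ℂ (LieAlgebra.loopAlgebra ℂ ℤ H4) ℂ) =
      c • (x, 0) by simp]
    rfl

/-- The projection of the affine algebra onto the loop algebra along `K`. -/
def loopPart : AffineH4 →ₗ[ℂ] LieAlgebra.loopAlgebra ℂ ℤ H4 where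
  toFun x := ((LieAlgebra.ofProd affineCocycle).symm x).1
  map_add' _ _ := rfl
  map_smul' _ _ := rfl

/-- The coefficient of `K`. -/
def centralPart : AffineH4 →ₗ[ℂ] ℂ where
  toFun x := TrivialLieModule.equiv ℂ (LieAlgebra.loopAlgebra ℂ ℤ H4) ℂ
    ((LieAlgebra.ofProd affineCocycle).symm x).2
  map_add' _ _ := rfl
  map_smul' _ _ := rfl

theorem loopPart_mode (A : H4) (n : ℤ) :
    loopPart (mode A n) = AddMonoidAlgebra.single n 1 ⊗ₜ[ℂ] A := rfl
theorem centralPart_mode (A : H4) (n : ℤ) : centralPart (mode A n) = 0 := rfl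
theorem loopPart_K : loopPart K = 0 := rfl
theorem centralPart_K : centralPart K = 1 := rfl

theorem eq_ofLoop_add (x : AffineH4) : x = ofLoop (loopPart x) + centralPart x • K := by
  have h : ∀ a : LieAlgebra.loopAlgebra ℂ ℤ H4 ×
        TrivialLieModule ℂ (LieAlgebra.loopAlgebra ℂ ℤ H4) ℂ,
      a = (a.1, 0) + (TrivialLieModule.equiv ℂ (LieAlgebra.loopAlgebra ℂ ℤ H4) ℂ a.2) •
        (0, (TrivialLieModule.equiv ℂ (LieAlgebra.loopAlgebra ℂ ℤ H4) ℂ).symm 1) := by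
    rintro ⟨a, b⟩
    refine Prod.ext (by simp) ?_
    apply (TrivialLieModule.equiv ℂ (LieAlgebra.loopAlgebra ℂ ℤ H4) ℂ).injective
    simp
  exact congrArg (LieAlgebra.ofProd affineCocycle) (h ((LieAlgebra.ofProd affineCocycle).symm x))

theorem mode_eq (A : H4) (n : ℤ) : mode A n = ofLoop (AddMonoidAlgebra.single n 1 ⊗ₜ[ℂ] A) := rfl

theorem mode_add (A B : H4) (n : ℤ) : mode (A + B) n = mode A n + mode B n := by
  simp only [mode_eq, TensorProduct.tmul_add, map_add]

theorem mode_smul (c : ℂ) (A : H4) (n : ℤ) : mode (c • A) n = c • mode A n := by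
  simp only [mode_eq, TensorProduct.tmul_smul, map_smul]

/-- The affine algebra is spanned by the modes and `K`. -/
theorem span_induction {p : AffineH4 → Prop} (hm : ∀ A n, p (mode A n)) (hK : p K)
    (hadd : ∀ x y, p x → p y → p (x + y)) (hsmul : ∀ (c : ℂ) x, p x → p (c • x)) (x : AffineH4) :
    p x := by
  rw [eq_ofLoop_add x]
  refine hadd _ _ ?_ (hsmul _ _ hK)
  have h0 : p 0 := by simpa using hsmul 0 _ hK
  induction loopPart x using TensorProduct.induction_on with
  | zero => simpa using h0
  | add a b ha hb => simpa using hadd _ _ ha hb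
  | tmul f A =>
    induction f using AddMonoidAlgebra.induction_linear with
    | zero => simpa using h0
    | add f g hf hg => rw [TensorProduct.add_tmul, map_add]; exact hadd _ _ hf hg
    | single n c =>
      have : (AddMonoidAlgebra.single n c : AddMonoidAlgebra ℂ ℤ) =
          c • AddMonoidAlgebra.single n 1 := by
        rw [AddMonoidAlgebra.smul_single, smul_eq_mul, mul_one]
      rw [this, ← TensorProduct.smul_tmul', map_smul]
      exact hsmul _ _ (hm A n)

end AffineH4

theorem ua_add (A B : H4) (n : ℤ) : ua (A + B) n = ua A n + ua B n := by
  rw [ua, AffineH4.mode_add, map_add]; rfl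

theorem ua_smul (c : ℂ) (A : H4) (n : ℤ) : ua (c • A) n = c • ua A n := by
  rw [ua, AffineH4.mode_smul, map_smul]; rfl

theorem u4_mul (A B : H4) : u4 A * u4 B = u4 B * u4 A + u4 ⁅A, B⁆ := by
  rw [u4, u4, u4, LieHom.map_lie, Ring.lie_def]; abel

theorem ua_mul (A B : H4) (m n : ℤ) :
    ua A m * ua B n = ua B n * ua A m + ua ⁅A, B⁆ (m + n) +
      (if m + n = 0 then (m : ℂ) * H4.form A B else 0) • uK := by
  have h := LieHom.map_lie (UniversalEnvelopingAlgebra.ι ℂ) (AffineH4.mode A m) (AffineH4.mode B n)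
  rw [AffineH4.lie_mode_mode, map_add, map_smul, Ring.lie_def] at h
  change ua ⁅A, B⁆ (m + n) + _ • uK = ua A m * ua B n - ua B n * ua A m at h
  rw [add_assoc, h]; abel

theorem uK_mul (A : H4) (n : ℤ) : uK * ua A n = ua A n * uK := by
  have h := LieHom.map_lie (UniversalEnvelopingAlgebra.ι ℂ) (AffineH4.mode A n) AffineH4.K
  rw [AffineH4.lie_mode_K, map_zero, Ring.lie_def] at h
  exact (sub_eq_zero.mp h.symm).symm

/-- The enveloping algebra is generated, as an algebra, by the modes and `K`. -/
theorem UA.induction {p : UA → Prop} (hm : ∀ A n, p (ua A n)) (hK : p uK)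
    (halg : ∀ c : ℂ, p (algebraMap ℂ UA c)) (hadd : ∀ x y, p x → p y → p (x + y))
    (hmul : ∀ x y, p x → p y → p (x * y)) (x : UA) : p x := by
  let S : Subalgebra ℂ UA :=
    { carrier := {x | p x}
      mul_mem' := fun {a b} ha hb => hmul a b ha hb
      add_mem' := fun {a b} ha hb => hadd a b ha hb
      algebraMap_mem' := halg }
  have hS : ∀ y : AffineH4, UniversalEnvelopingAlgebra.ι ℂ y ∈ S := by
    refine AffineH4.span_induction hm hK (fun x y hx hy => ?_) (fun c x hx => ?_)
    · rw [map_add]; exact S.add_mem hx hy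
    · rw [map_smul]; exact S.smul_mem hx c
  let f : AffineH4 →ₗ⁅ℂ⁆ S :=
    { toFun := fun y => ⟨UniversalEnvelopingAlgebra.ι ℂ y, hS y⟩
      map_add' := fun x y => Subtype.ext (map_add _ x y)
      map_smul' := fun c x => Subtype.ext (map_smul _ c x)
      map_lie' := fun {x y} => Subtype.ext (LieHom.map_lie _ x y) }
  have hid : S.val.comp (UniversalEnvelopingAlgebra.lift ℂ f) = AlgHom.id ℂ UA := by
    apply UniversalEnvelopingAlgebra.hom_ext
    ext y
    simp [f]
  have := congrArg (fun g => g x) hid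
  simp only [AlgHom.comp_apply, AlgHom.id_apply] at this
  rw [← this]
  exact (UniversalEnvelopingAlgebra.lift ℂ f x).2

theorem U4.induction {p : U4 → Prop} (hm : ∀ A, p (u4 A))
    (halg : ∀ c : ℂ, p (algebraMap ℂ U4 c)) (hadd : ∀ x y, p x → p y → p (x + y))
    (hmul : ∀ x y, p x → p y → p (x * y)) (x : U4) : p x := by
  let S : Subalgebra ℂ U4 :=
    { carrier := {x | p x}
      mul_mem' := fun {a b} ha hb => hmul a b ha hb
      add_mem' := fun {a b} ha hb => hadd a b ha hb
      algebraMap_mem' := halg }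
  let f : H4 →ₗ⁅ℂ⁆ S :=
    { toFun := fun y => ⟨UniversalEnvelopingAlgebra.ι ℂ y, hm y⟩
      map_add' := fun x y => Subtype.ext (map_add _ x y)
      map_smul' := fun c x => Subtype.ext (map_smul _ c x)
      map_lie' := fun {x y} => Subtype.ext (LieHom.map_lie _ x y) }
  have hid : S.val.comp (UniversalEnvelopingAlgebra.lift ℂ f) = AlgHom.id ℂ U4 := by
    apply UniversalEnvelopingAlgebra.hom_ext
    ext y
    simp [f]
  have := congrArg (fun g => g x) hid
  simp only [AlgHom.comp_apply, AlgHom.id_apply] at this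
  rw [← this]
  exact (UniversalEnvelopingAlgebra.lift ℂ f x).2

end Modes

/-! ### Level-one modules -/

section LevelOne

/-- `K` acts as the identity. -/
def IsLevelOne (M : Type) [AddCommGroup M] [Module UA M] : Prop := ∀ v : M, uK • v = v

theorem ua_add_smul {M : Type} [AddCommGroup M] [Module UA M] (A B : H4) (n : ℤ) (v : M) :
    ua (A + B) n • v = ua A n • v + ua B n • v := by
  rw [ua_add, add_smul]

variable {M : Type} [AddCommGroup M] [Module ℂ M] [Module UA M] [IsScalarTower ℂ UA M]

theorem ua_smul_smul (c : ℂ) (A : H4) (n : ℤ) (v : M) : ua (c • A) n • v = c • ua A n • v := by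
  rw [ua_smul, smul_assoc]

theorem ua_zero_smul (n : ℤ) (v : M) : ua 0 n • v = 0 := by
  have := ua_smul_smul 0 0 n v
  rwa [zero_smul, zero_smul] at this

theorem ua_neg_smul (A : H4) (n : ℤ) (v : M) : ua (-A) n • v = -(ua A n • v) := by
  have := ua_smul_smul (-1) A n v
  rwa [neg_one_smul, neg_one_smul] at this

theorem ua_smul_comm (hM : IsLevelOne M) (A B : H4) (m n : ℤ) (v : M) :
    ua A m • ua B n • v = ua B n • ua A m • v + ua ⁅A, B⁆ (m + n) • v +
      (if m + n = 0 then (m : ℂ) * H4.form A B else 0) • v := by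
  rw [← mul_smul, ua_mul, add_smul, add_smul, mul_smul, smul_assoc, hM v]

theorem ua_mem_of_basis {T : Submodule ℂ M} {n : ℤ} {v : M} (hE : ua H4.E n • v ∈ T)
    (hF : ua H4.F n • v ∈ T) (hI : ua H4.I n • v ∈ T) (hJ : ua H4.J n • v ∈ T) (A : H4) :
    ua A n • v ∈ T := by
  rw [H4.eq_sum A]
  simp only [ua_add_smul, ua_smul_smul]
  exact T.add_mem (T.add_mem (T.add_mem (T.smul_mem _ hE) (T.smul_mem _ hF)) (T.smul_mem _ hI))
    (T.smul_mem _ hJ)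

/-- On a level-one module, a subspace that is stable under all modes is a submodule. -/
theorem smul_mem_of_stable (hM : IsLevelOne M) {T : Submodule ℂ M}
    (hT : ∀ A n, ∀ v ∈ T, ua A n • v ∈ T) (u : UA) : ∀ v ∈ T, u • v ∈ T := by
  induction u using UA.induction with
  | hm A n => exact hT A n
  | hK => intro v hv; rwa [hM v]
  | halg c => intro v hv; rw [algebraMap_smul]; exact T.smul_mem c hv
  | hadd x y hx hy => intro v hv; rw [add_smul]; exact T.add_mem (hx v hv) (hy v hv)
  | hmul x y hx hy => intro v hv; rw [mul_smul]; exact hx _ (hy v hv)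

theorem span_le_of_stable (hM : IsLevelOne M) {T : Submodule ℂ M}
    (hT : ∀ A n, ∀ v ∈ T, ua A n • v ∈ T) {G : Set M} (hG : G ⊆ T) {v : M}
    (hv : v ∈ Submodule.span UA G) : v ∈ T := by
  let T' : Submodule UA M :=
    { carrier := T
      add_mem' := fun ha hb => T.add_mem ha hb
      zero_mem' := T.zero_mem
      smul_mem' := fun u v hv => smul_mem_of_stable hM hT u v hv }
  exact (Submodule.span_le (p := T')).2 hG hv

/-- Triangular decomposition: if `G` is stable under the modes `A_n` with `n ≥ c`, then the
submodule generated by `G` is obtained from `G` by applying the modes `A_n` with `n < c` only. -/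
theorem span_le_of_triangular (hM : IsLevelOne M) (c : ℤ) {G T : Submodule ℂ M} (hGT : G ≤ T)
    (hG : ∀ A n, c ≤ n → ∀ v ∈ G, ua A n • v ∈ G) (hT : ∀ A n, n < c → ∀ v ∈ T, ua A n • v ∈ T)
    {v : M} (hv : v ∈ Submodule.span UA (G : Set M)) : v ∈ T := by
  let P : Submodule ℂ M → Prop := fun S => G ≤ S ∧ ∀ A n, n < c → ∀ v ∈ S, ua A n • v ∈ S
  let T₀ : Submodule ℂ M := sInf {S | P S}
  have hT₀ : P T₀ := by
    refine ⟨le_sInf fun S hS => hS.1, fun A n hn v hv => ?_⟩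
    rw [Submodule.mem_sInf] at hv ⊢
    exact fun S hS => hS.2 A n hn v (hv S hS)
  -- the vectors of `T₀` that every mode sends into `T₀`
  let T₁ : Submodule ℂ M :=
    { carrier := {v | v ∈ T₀ ∧ ∀ A n, ua A n • v ∈ T₀}
      add_mem' := fun ha hb => ⟨T₀.add_mem ha.1 hb.1, fun A n => by
        rw [smul_add]; exact T₀.add_mem (ha.2 A n) (hb.2 A n)⟩
      zero_mem' := ⟨T₀.zero_mem, fun A n => by rw [smul_zero]; exact T₀.zero_mem⟩
      smul_mem' := fun r v hv => ⟨T₀.smul_mem r hv.1, fun A n => by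
        rw [smul_comm]; exact T₀.smul_mem r (hv.2 A n)⟩ }
  have h1 : T₀ ≤ T₁ := by
    refine sInf_le ⟨fun v hv => ⟨hT₀.1 hv, fun A n => ?_⟩, fun B m hm v hv =>
      ⟨hT₀.2 B m hm v hv.1, fun A n => ?_⟩⟩
    · rcases lt_or_ge n c with hn | hn
      · exact hT₀.2 A n hn v (hT₀.1 hv)
      · exact hT₀.1 (hG A n hn v hv)
    · rw [ua_smul_comm hM]
      exact T₀.add_mem (T₀.add_mem (hT₀.2 B m hm _ (hv.2 A n)) (hv.2 _ _)) (T₀.smul_mem _ hv.1)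
  have h2 : v ∈ T₀ := span_le_of_stable hM (fun A n v hv => (h1 hv).2 A n) hT₀.1 hv
  exact sInf_le (a := T) (show P T from ⟨hGT, hT⟩) h2

end LevelOne

/-! ### Decompositions into eigenspaces -/

section Eigen

variable {V : Type*} [AddCommGroup V] [Module ℂ V] {ι : Type*} {f : Module.End ℂ V}
  {C : ι → Submodule ℂ V} {μ : ι → ℂ}

theorem iSupIndep_of_le_eigenspace (hμ : Function.Injective μ)
    (hC : ∀ k, C k ≤ f.eigenspace (μ k)) : iSupIndep C :=
  (f.eigenspaces_iSupIndep.comp hμ).mono hC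

theorem eigenspace_eq_of_iSup_eq_top (hμ : Function.Injective μ)
    (hC : ∀ k, C k ≤ f.eigenspace (μ k)) (htop : ⨆ k, C k = ⊤) (k : ι) :
    f.eigenspace (μ k) = C k := by
  classical
  refine le_antisymm (fun v hv => ?_) (hC k)
  have hind := (f.eigenspaces_iSupIndep.comp hμ) k
  have hv' : v ∈ C k ⊔ ⨆ j ≠ k, C j := by
    have : v ∈ ⨆ k, C k := htop ▸ Submodule.mem_top
    refine (iSup_le fun j => ?_ : ⨆ k, C k ≤ _) this
    by_cases hj : j = k
    · subst hj; exact le_sup_left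
    · exact le_sup_of_le_right (le_iSup₂_of_le j hj le_rfl)
  obtain ⟨a, ha, b, hb, rfl⟩ := Submodule.mem_sup.1 hv'
  have hb1 : b ∈ f.eigenspace (μ k) := by
    have := Submodule.sub_mem _ hv (hC k ha)
    simpa using this
  have hb2 : b ∈ ⨆ j ≠ k, (f.eigenspace ∘ μ) j :=
    (iSup₂_mono fun j _ => hC j : ⨆ j ≠ k, C j ≤ _) hb
  have : b = 0 := by
    have := (Submodule.disjoint_def.1 hind) b hb1 hb2
    exact this
  rw [this, add_zero]; exact ha

/-- Components with respect to distinct eigenvalues remain in an invariant subspace. -/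
theorem mem_of_sum_mem_of_eigen (hμ : Function.Injective μ) {X : Submodule ℂ V}
    (hX : ∀ v ∈ X, f v ∈ X) (s : Finset ι) : ∀ v : ι → V, (∀ k ∈ s, f (v k) = μ k • v k) →
    ∑ k ∈ s, v k ∈ X → ∀ k ∈ s, v k ∈ X := by
  classical
  induction s using Finset.induction_on with
  | empty => simp
  | insert a s ha ih =>
    intro v hv hsum
    have h1 : ∀ k ∈ s, (μ k - μ a) • v k ∈ X := by
      refine ih (fun k => (μ k - μ a) • v k) (fun k hk => ?_) ?_
      · rw [map_smul, hv k (Finset.mem_insert_of_mem hk), smul_comm]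
      · have h2 := X.sub_mem (hX _ hsum) (X.smul_mem (μ a) hsum)
        rw [map_sum, Finset.smul_sum, ← Finset.sum_sub_distrib, Finset.sum_insert ha,
          hv a (Finset.mem_insert_self a s), sub_self, zero_add] at h2
        convert h2 using 1
        refine Finset.sum_congr rfl fun k hk => ?_
        rw [hv k (Finset.mem_insert_of_mem hk), sub_smul]
    have h3 : ∀ k ∈ s, v k ∈ X := fun k hk => by
      have hne : μ k - μ a ≠ 0 := sub_ne_zero.2 fun h => ha (hμ h ▸ hk)
      have := X.smul_mem (μ k - μ a)⁻¹ (h1 k hk)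
      rwa [smul_smul, inv_mul_cancel₀ hne, one_smul] at this
    intro k hk
    rcases Finset.mem_insert.1 hk with rfl | hk
    · rw [Finset.sum_insert ha] at hsum
      have := X.sub_mem hsum (X.sum_mem h3)
      simpa using this
    · exact h3 k hk

/-- An invariant subspace is the sum of its intersections with the members of an eigenspace
decomposition. -/
theorem mem_iSup_inf_of_eigen (hμ : Function.Injective μ) (hC : ∀ k, C k ≤ f.eigenspace (μ k))
    (htop : ⨆ k, C k = ⊤) {X : Submodule ℂ V} (hX : ∀ v ∈ X, f v ∈ X) {v : V} (hv : v ∈ X) :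
    ∃ s : Finset ι, ∃ a : ι → V, (∀ k ∈ s, a k ∈ X ∧ a k ∈ C k) ∧ v = ∑ k ∈ s, a k := by
  obtain ⟨a, ha, hsum⟩ :=
    (Submodule.mem_iSup_iff_exists_finsupp _ _).1 (htop ▸ Submodule.mem_top : v ∈ ⨆ k, C k)
  refine ⟨a.support, a, fun k hk => ⟨?_, ha k⟩, hsum.symm⟩
  refine mem_of_sum_mem_of_eigen hμ hX a.support a
    (fun k _ => Module.End.mem_eigenspace_iff.1 (hC k (ha k))) ?_ k hk
  rw [Finsupp.sum] at hsum
  rwa [hsum]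

end Eigen

/-! ### Structure constants -/

namespace H4

theorem lie_E_E : ⁅E, E⁆ = 0 := lie_self E
theorem lie_E_I : ⁅E, I⁆ = 0 := by rw [← lie_skew, lie_I, neg_zero]
theorem lie_E_J : ⁅E, J⁆ = -E := by rw [← lie_skew, lie_J_E]
theorem lie_F_E : ⁅F, E⁆ = -I := by rw [← lie_skew, lie_E_F]
theorem lie_F_F : ⁅F, F⁆ = 0 := lie_self F
theorem lie_F_I : ⁅F, I⁆ = 0 := by rw [← lie_skew, lie_I, neg_zero]
theorem lie_F_J : ⁅F, J⁆ = F := by rw [← lie_skew, lie_J_F, neg_neg]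
theorem lie_J_I : ⁅J, I⁆ = 0 := by rw [← lie_skew, lie_I, neg_zero]
theorem lie_J_J : ⁅J, J⁆ = 0 := lie_self J

theorem form_E_E : form E E = 0 := by simp [form_apply]; simp [E]
theorem form_E_F : form E F = 1 := by simp [form_apply]; simp [E, F]
theorem form_E_I : form E I = 0 := by simp [form_apply]; simp [E, I]
theorem form_E_J : form E J = 0 := by simp [form_apply]; simp [E, J]
theorem form_F_E : form F E = 1 := by simp [form_apply]; simp [E, F]
theorem form_F_F : form F F = 0 := by simp [form_apply]; simp [F]
theorem form_F_I : form F I = 0 := by simp [form_apply]; simp [F, I]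
theorem form_F_J : form F J = 0 := by simp [form_apply]; simp [F, J]
theorem form_I_E : form I E = 0 := by simp [form_apply]; simp [E, I]
theorem form_I_F : form I F = 0 := by simp [form_apply]; simp [F, I]
theorem form_I_I : form I I = 0 := by simp [form_apply]; simp [I]
theorem form_I_J : form I J = 1 := by simp [form_apply]; simp [I, J]
theorem form_J_E : form J E = 0 := by simp [form_apply]; simp [E, J]
theorem form_J_F : form J F = 0 := by simp [form_apply]; simp [F, J]
theorem form_J_I : form J I = 1 := by simp [form_apply]; simp [I, J]
theorem form_J_J : form J J = 0 := by simp [form_apply]; simp [J]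

end H4

/-! ### The Virasoro zero mode -/

section Sum

theorem sum_range_add_neg {V : Type*} [AddCommGroup V] (P : ℤ → V) (N : ℕ) :
    ∑ k ∈ Finset.range N, (P (-(k + 1)) + P (k + 1)) + P 0 = ∑ p ∈ Finset.Icc (-N : ℤ) N, P p := by
  induction N with
  | zero => simp
  | succ N ih =>
    have h : Finset.Icc (-((N + 1 : ℕ) : ℤ)) ((N + 1 : ℕ) : ℤ) =
        insert (-(N + 1 : ℤ)) (insert (N + 1 : ℤ) (Finset.Icc (-(N : ℤ)) N)) := by
      ext x; simp only [Finset.mem_Icc, Finset.mem_insert]; push_cast; omega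
    rw [h, Finset.sum_insert (by simp only [Finset.mem_Icc, Finset.mem_insert]; omega),
      Finset.sum_insert (by simp only [Finset.mem_Icc]; omega), ← ih, Finset.sum_range_succ]
    abel

theorem sum_range_add_neg_eq_finsum {V : Type*} [AddCommGroup V] {P : ℤ → V} {N : ℕ}
    (hP : ∀ p, (N : ℤ) < |p| → P p = 0) :
    ∑ k ∈ Finset.range N, (P (-(k + 1)) + P (k + 1)) = (∑ᶠ p, P p) - P 0 := by
  rw [eq_sub_iff_add_eq, sum_range_add_neg, finsum_eq_sum_of_support_subset]
  intro p hp
  by_contra h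
  refine hp (hP p ?_)
  simp only [Finset.coe_Icc, Set.mem_Icc, not_and_or] at h
  rw [lt_abs]; omega

/-- A doubly infinite sum and its shift by `m` differ only in the terms at `0` and `m` that the
symmetric summation omits. -/
theorem sum_range_shift {V : Type*} [AddCommGroup V] {P : ℤ → V} {N : ℕ} (m : ℤ)
    (hP : ∀ p, (N : ℤ) < |p| + |m| → P p = 0) :
    ∑ k ∈ Finset.range N, (P (-(k + 1)) + P (k + 1) - P (m + (k + 1)) - P (m - (k + 1))) =
      P m - P 0 := by
  have h1 := sum_range_add_neg_eq_finsum (P := P) (N := N)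
    (fun p hp => hP p (by have := abs_nonneg m; omega))
  have h2 := sum_range_add_neg_eq_finsum (P := fun p => P (m + p)) (N := N)
    (fun p hp => hP _ (by have := abs_sub (m + p) m; rw [add_sub_cancel_left] at this; omega))
  have h3 : (∑ᶠ p, P (m + p)) = ∑ᶠ p, P p := finsum_comp_equiv (Equiv.addLeft m) (f := P)
  rw [h3] at h2
  calc _ = ∑ k ∈ Finset.range N, (P (-(k + 1)) + P (k + 1)) -
        ∑ k ∈ Finset.range N, (P (m + -(k + 1)) + P (m + (k + 1))) := by
        rw [← Finset.sum_sub_distrib]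
        refine Finset.sum_congr rfl fun k _ => ?_
        rw [sub_eq_add_neg m]; abel
    _ = _ := by rw [h1, h2, add_zero]; abel

/-- At most one of the two conditions holds for some `k`, and then `k + 1 = |m|`. -/
theorem sum_range_delta {N : ℕ} (m : ℤ) (hN : |m| ≤ N) :
    ∑ k ∈ Finset.range N, ((if ((k : ℤ) + 1) + m = 0 then ((k : ℂ) + 1) else 0) -
      (if -((k : ℤ) + 1) + m = 0 then ((k : ℂ) + 1) else 0)) = -m := by
  have h := sum_range_add_neg_eq_finsum (P := fun p : ℤ => if p = m then -(p : ℂ) else 0) (N := N)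
    (fun p hp => if_neg (by rintro rfl; omega))
  rw [finsum_eq_single _ m (fun p hp => if_neg hp)] at h
  simp only [if_true] at h
  have h0 : (if (0 : ℤ) = m then -((0 : ℤ) : ℂ) else 0) = 0 := by split_ifs <;> simp
  rw [h0, sub_zero] at h
  rw [← h]
  refine Finset.sum_congr rfl fun k _ => ?_
  have e1 : ((k : ℤ) + 1) + m = 0 ↔ -((k : ℤ) + 1) = m := by omega
  have e2 : -((k : ℤ) + 1) + m = 0 ↔ (k : ℤ) + 1 = m := by omega
  simp only [e1, e2]
  split_ifs <;> push_cast <;> ring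

end Sum

section Virasoro

/-- Every vector is annihilated by the `n`-th modes for large `n`. -/
def IsSmooth (M : Type) [AddCommGroup M] [Module UA M] : Prop :=
  ∀ v : M, ∃ N : ℕ, ∀ A n, (N : ℤ) ≤ n → ua A n • v = 0

/-- The constant summand of the Virasoro zero mode. -/
def sugawaraZero : UA :=
  ua H4.F 0 * ua H4.E 0 + ua H4.I 0 * ua H4.J 0 +
      algebraMap ℂ UA (1 / 2) * (ua H4.I 0 - ua H4.I 0 * ua H4.I 0)

/-- The `n`-th summand of the Virasoro zero mode. -/
def sugawaraTerm (n : ℤ) : UA :=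
  ua H4.E (-n) * ua H4.F n + ua H4.F (-n) * ua H4.E n +
    ua H4.I (-n) * ua H4.J n + ua H4.J (-n) * ua H4.I n - ua H4.I (-n) * ua H4.I n

theorem sugawaraTerm_smul_eq_zero {M : Type} [AddCommGroup M] [Module UA M] {n : ℤ} {v : M}
    (h : ∀ A, ua A n • v = 0) : sugawaraTerm n • v = 0 := by
  simp only [sugawaraTerm, add_smul, sub_smul, mul_smul, h, smul_zero, add_zero, sub_zero]

theorem virasoroL0_eq_sum {M : Type} [AddCommGroup M] [Module UA M] {v : M} {N : ℕ}
    (h : ∀ A n, (N : ℤ) < n → ua A n • v = 0) :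
    virasoroL0 v = sugawaraZero • v + ∑ k ∈ Finset.range N, sugawaraTerm (k + 1) • v := by
  unfold virasoroL0
  congr 1
  change (∑ᶠ n : {n : ℤ // 0 < n}, sugawaraTerm n • v) = _
  have hinj : Function.Injective
      (fun k : ℕ => (⟨(k : ℤ) + 1, by omega⟩ : {n : ℤ // 0 < n})) := by
    intro a b hab
    have := congrArg Subtype.val hab
    simp only at this
    omega
  rw [finsum_eq_sum_of_support_subset (s := (Finset.range N).map ⟨_, hinj⟩), Finset.sum_map]
  · rfl
  · rintro ⟨n, hn⟩ hs
    by_contra hc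
    refine hs (sugawaraTerm_smul_eq_zero fun A => h A n ?_)
    by_contra hnN
    refine hc ?_
    simp only [Finset.coe_map, Function.Embedding.coeFn_mk, Finset.coe_range, Set.mem_image,
      Set.mem_Iio]
    exact ⟨(n - 1).toNat, by omega, Subtype.ext (by simp only; omega)⟩

section

variable {M : Type} [AddCommGroup M] [Module UA M]

theorem virasoroL0_add (hs : IsSmooth M) (v w : M) :
    virasoroL0 (v + w) = virasoroL0 v + virasoroL0 w := by
  obtain ⟨N, hN⟩ := hs v
  obtain ⟨N', hN'⟩ := hs w
  rw [virasoroL0_eq_sum (N := N + N') fun A n hn => hN A n (by omega),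
    virasoroL0_eq_sum (N := N + N') fun A n hn => hN' A n (by omega),
    virasoroL0_eq_sum (N := N + N') fun A n hn => by
      rw [smul_add, hN A n (by omega), hN' A n (by omega), add_zero]]
  simp only [smul_add, Finset.sum_add_distrib]
  abel

theorem virasoroL0_map {M' : Type} [AddCommGroup M'] [Module UA M'] (hs : IsSmooth M)
    (g : M →ₗ[UA] M') (v : M) : virasoroL0 (g v) = g (virasoroL0 v) := by
  obtain ⟨N, hN⟩ := hs v
  rw [virasoroL0_eq_sum (N := N) fun A n hn => hN A n (by omega),
    virasoroL0_eq_sum (N := N) fun A n hn => by rw [← map_smul, hN A n (by omega), map_zero]]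
  simp only [map_add, map_sum, map_smul]

theorem virasoroL0_mem (hs : IsSmooth M) (X : Submodule UA M) {v : M} (hv : v ∈ X) :
    virasoroL0 v ∈ X := by
  obtain ⟨N, hN⟩ := hs v
  rw [virasoroL0_eq_sum (N := N) fun A n hn => hN A n (by omega)]
  exact X.add_mem (X.smul_mem _ hv) (X.sum_mem fun k _ => X.smul_mem _ hv)

end

variable {M : Type} [AddCommGroup M] [Module ℂ M] [Module UA M] [IsScalarTower ℂ UA M]

theorem virasoroL0_smul (hs : IsSmooth M) (c : ℂ) (v : M) :
    virasoroL0 (c • v) = c • virasoroL0 v := by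
  obtain ⟨N, hN⟩ := hs v
  rw [virasoroL0_eq_sum (N := N) fun A n hn => hN A n (by omega),
    virasoroL0_eq_sum (N := N) fun A n hn => by
      rw [smul_comm, hN A n (by omega), smul_zero]]
  simp only [smul_add, Finset.smul_sum]
  simp only [smul_comm c]

/-- The Virasoro zero mode of a smooth module as a linear map. -/
def L0 (hs : IsSmooth M) : Module.End ℂ M where
  toFun := virasoroL0
  map_add' := virasoroL0_add hs
  map_smul' := virasoroL0_smul hs

/-- The commutator `[X_a Y_b, Z_m]`, applied to `v`. -/
def quadComm (X Y Z : H4) (a b m : ℤ) (v : M) : M :=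
  ua ⁅X, Z⁆ (a + m) • ua Y b • v + ua X a • ua ⁅Y, Z⁆ (b + m) • v +
    (if a + m = 0 then (a : ℂ) * H4.form X Z else 0) • ua Y b • v +
    (if b + m = 0 then (b : ℂ) * H4.form Y Z else 0) • ua X a • v

theorem quadratic_smul_comm (hM : IsLevelOne M) (X Y Z : H4) (a b m : ℤ) (v : M) :
    ua X a • ua Y b • ua Z m • v = ua Z m • ua X a • ua Y b • v + quadComm X Y Z a b m v := by
  rw [quadComm, ua_smul_comm hM Y Z, smul_add, smul_add, smul_comm (ua X a) (_ : ℂ),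
    ua_smul_comm hM X Z]
  abel

theorem sugawaraTerm_smul_ua (hM : IsLevelOne M) (Z : H4) (n m : ℤ) (v : M) :
    sugawaraTerm n • ua Z m • v = ua Z m • sugawaraTerm n • v +
      (quadComm H4.E H4.F Z (-n) n m v + quadComm H4.F H4.E Z (-n) n m v +
        quadComm H4.I H4.J Z (-n) n m v + quadComm H4.J H4.I Z (-n) n m v -
        quadComm H4.I H4.I Z (-n) n m v) := by
  simp only [sugawaraTerm, add_smul, mul_smul, sub_smul, smul_add, smul_sub]
  rw [quadratic_smul_comm hM H4.E H4.F, quadratic_smul_comm hM H4.F H4.E,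
    quadratic_smul_comm hM H4.I H4.J, quadratic_smul_comm hM H4.J H4.I,
    quadratic_smul_comm hM H4.I H4.I]
  abel

theorem sugawaraZero_smul_ua (hM : IsLevelOne M) (Z : H4) (m : ℤ) (v : M) :
    sugawaraZero • ua Z m • v = ua Z m • sugawaraZero • v +
      (quadComm H4.F H4.E Z 0 0 m v + quadComm H4.I H4.J Z 0 0 m v) := by
  have hI : ∀ v : M, ua H4.I 0 • ua Z m • v = ua Z m • ua H4.I 0 • v := fun v => by
    rw [ua_smul_comm hM, H4.lie_I, ua_zero_smul]
    simp
  simp only [sugawaraZero, add_smul, mul_smul, sub_smul, smul_add, smul_sub, algebraMap_smul]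
  rw [quadratic_smul_comm hM H4.F H4.E, quadratic_smul_comm hM H4.I H4.J]
  simp only [hI, smul_comm (ua Z m) (_ : ℂ)]
  abel

end Virasoro

/-! ### Commutators of the Virasoro zero mode -/

section VirasoroComm

section

variable {M : Type} [AddCommGroup M] [Module UA M]

/-- The commutator of the Virasoro zero mode with a mode, reduced to the commutators of its
summands. -/
theorem virasoroL0_smul_of_terms (hs : IsSmooth M) (A : H4) (m : ℤ) (v z w : M) (R : ℤ → M)
    (h0 : sugawaraZero • ua A m • v = ua A m • sugawaraZero • v + z)
    (h1 : ∀ n, 0 < n → sugawaraTerm n • ua A m • v = ua A m • sugawaraTerm n • v + R n)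
    (h2 : ∀ N₀ : ℕ, (∀ A n, (N₀ : ℤ) ≤ n → ua A n • v = 0) → ∃ N₁ : ℕ, ∀ N : ℕ, N₁ ≤ N →
      z + ∑ k ∈ Finset.range N, R (k + 1) = w) :
    virasoroL0 (ua A m • v) = ua A m • virasoroL0 v + w := by
  obtain ⟨N₀, hN₀⟩ := hs v
  obtain ⟨N₂, hN₂⟩ := hs (ua A m • v)
  obtain ⟨N₁, hN₁⟩ := h2 N₀ hN₀
  rw [virasoroL0_eq_sum (N := N₀ + N₁ + N₂) fun A n hn => hN₀ A n (by omega),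
    virasoroL0_eq_sum (N := N₀ + N₁ + N₂) fun A n hn => hN₂ A n (by omega), h0]
  rw [Finset.sum_congr rfl fun (k : ℕ) _ => h1 ((k : ℤ) + 1) (by omega)]
  simp only [Finset.sum_add_distrib, smul_add, Finset.smul_sum]
  rw [← hN₁ (N₀ + N₁ + N₂) (by omega)]
  abel

end

variable {M : Type} [AddCommGroup M] [Module ℂ M] [Module UA M] [IsScalarTower ℂ UA M]

theorem I_smul_comm (hM : IsLevelOne M) {A : H4} (hA : H4.form H4.I A = 0) (m n : ℤ) (v : M) :
    ua H4.I m • ua A n • v = ua A n • ua H4.I m • v := by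
  rw [ua_smul_comm hM, H4.lie_I, ua_zero_smul, hA]
  simp

omit [IsScalarTower ℂ UA M] in
/-- Up to multiples of `A_m` that come from the central terms, the commutators of the summands of
the Virasoro zero mode with `A_m` are differences between a finitely supported family `P` of vectors
and its shift by `m`, so that their sum collapses. -/
theorem virasoroL0_smul_of_telescoping (hs : IsSmooth M) (A : H4) (m : ℤ) (v : M) (P : ℤ → M)
    (hP : ∀ N : ℕ, (∀ A n, (N : ℤ) ≤ n → ua A n • v = 0) →
      ∀ p : ℤ, (N : ℤ) ≤ p ∨ (N : ℤ) ≤ m - p → P p = 0)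
    (h0 : sugawaraZero • ua A m • v = ua A m • sugawaraZero • v + -(P m - P 0))
    (h1 : ∀ n, sugawaraTerm n • ua A m • v = ua A m • sugawaraTerm n • v +
      (P (-n) + P n - P (m + n) - P (m - n) +
        ((if n + m = 0 then (n : ℂ) else 0) - (if -n + m = 0 then (n : ℂ) else 0)) • ua A m • v)) :
    virasoroL0 (ua A m • v) = ua A m • virasoroL0 v + (-m : ℂ) • ua A m • v := by
  refine virasoroL0_smul_of_terms hs A m v _ _ _ h0 (fun n _ => h1 n) fun N₀ hN₀ => ?_
  have h2 : |m| = m.natAbs := Int.abs_eq_natAbs m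
  refine ⟨N₀ + 2 * m.natAbs, fun N hN => ?_⟩
  have h3 := sum_range_delta (N := N) m (by omega)
  rw [Finset.sum_add_distrib, sum_range_shift m, ← Finset.sum_smul, ← h3]
  · push_cast
    abel
  · intro p hp
    refine hP N₀ hN₀ p ?_
    rcases abs_cases p with h | h <;> omega

omit [IsScalarTower ℂ UA M] in
theorem ite_smul_mode {n m : ℤ} (c : ℂ) (A : H4) (v : M) :
    (if n + m = 0 then c else 0) • ua A (-n) • v = (if n + m = 0 then c else 0) • ua A m • v := by
  split_ifs with h
  · rw [show m = -n by omega]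
  · simp

omit [IsScalarTower ℂ UA M] in
theorem ite_smul_mode_neg {n m : ℤ} (c : ℂ) (A : H4) (v : M) :
    (if -n + m = 0 then c else 0) • ua A n • v = (if -n + m = 0 then c else 0) • ua A m • v := by
  simpa using ite_smul_mode (n := -n) (m := m) c A v

theorem virasoroL0_smul_E (hM : IsLevelOne M) (hs : IsSmooth M) (m : ℤ) (v : M) :
    virasoroL0 (ua H4.E m • v) = ua H4.E m • virasoroL0 v + (-m : ℂ) • ua H4.E m • v := by
  refine virasoroL0_smul_of_telescoping hs H4.E m v (fun p => -(ua H4.E p • ua H4.I (m - p) • v))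
    (fun N hN p hp => ?_) ?_ fun n => ?_
  · rcases hp with hp | hp
    · rw [← I_smul_comm hM H4.form_I_E, hN _ p hp, smul_zero, neg_zero]
    · rw [hN _ _ hp, smul_zero, neg_zero]
  · rw [sugawaraZero_smul_ua hM]
    congr 1
    simp only [quadComm, H4.lie_E_E, H4.lie_F_E, H4.lie_J_E, H4.lie_I, ua_zero_smul, ua_neg_smul,
      I_smul_comm hM H4.form_I_E, smul_zero, Int.cast_zero, zero_mul, ite_self, zero_smul,
      sub_self, sub_zero, zero_add]
    abel
  · rw [sugawaraTerm_smul_ua hM]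
    congr 1
    simp only [quadComm, ite_smul_mode, ite_smul_mode_neg]
    simp only [H4.lie_E_E, H4.lie_F_E, H4.lie_J_E, H4.lie_I, ua_zero_smul, ua_neg_smul,
      H4.form_E_E, H4.form_F_E, H4.form_I_E, H4.form_J_E, mul_zero, mul_one,
      I_smul_comm hM H4.form_I_E, smul_neg, smul_zero, sub_neg_eq_add, sub_add_cancel_left,
      sub_sub_cancel, ite_self, zero_smul, sub_zero, zero_add, add_zero, add_comm _ m, Int.cast_neg,
      ← sub_eq_add_neg]
    simp only [sub_smul, ite_smul, zero_smul, neg_smul]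
    split_ifs <;> abel

theorem virasoroL0_smul_F (hM : IsLevelOne M) (hs : IsSmooth M) (m : ℤ) (v : M) :
    virasoroL0 (ua H4.F m • v) = ua H4.F m • virasoroL0 v + (-m : ℂ) • ua H4.F m • v := by
  refine virasoroL0_smul_of_telescoping hs H4.F m v (fun p => ua H4.F p • ua H4.I (m - p) • v)
    (fun N hN p hp => ?_) ?_ fun n => ?_
  · rcases hp with hp | hp
    · rw [← I_smul_comm hM H4.form_I_F, hN _ p hp, smul_zero]
    · rw [hN _ _ hp, smul_zero]
  · rw [sugawaraZero_smul_ua hM]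
    congr 1
    simp only [quadComm, H4.lie_F_F, H4.lie_E_F, H4.lie_J_F, H4.lie_I, ua_zero_smul, ua_neg_smul,
      I_smul_comm hM H4.form_I_F, smul_neg, Int.cast_zero, zero_mul, ite_self, zero_smul,
      sub_self, sub_zero, zero_add]
    abel
  · rw [sugawaraTerm_smul_ua hM]
    congr 1
    simp only [quadComm, ite_smul_mode, ite_smul_mode_neg]
    simp only [H4.lie_F_F, H4.lie_E_F, H4.lie_J_F, H4.lie_I, ua_zero_smul, ua_neg_smul,
      H4.form_F_F, H4.form_E_F, H4.form_I_F, H4.form_J_F, mul_zero, mul_one,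
      I_smul_comm hM H4.form_I_F, smul_neg, smul_zero, sub_neg_eq_add, sub_add_cancel_left,
      sub_sub_cancel, ite_self, zero_smul, sub_zero, zero_add, add_zero, add_comm _ m, Int.cast_neg,
      ← sub_eq_add_neg]
    simp only [sub_smul, ite_smul, zero_smul, neg_smul]
    split_ifs <;> abel

theorem virasoroL0_smul_I (hM : IsLevelOne M) (hs : IsSmooth M) (m : ℤ) (v : M) :
    virasoroL0 (ua H4.I m • v) = ua H4.I m • virasoroL0 v + (-m : ℂ) • ua H4.I m • v := by
  refine virasoroL0_smul_of_telescoping hs H4.I m v (fun p => 0)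
    (fun N hN p hp => rfl) ?_ fun n => ?_
  · rw [sugawaraZero_smul_ua hM]
    congr 1
    simp only [quadComm, H4.lie_F_I, H4.lie_E_I, H4.lie_J_I, H4.lie_I, ua_zero_smul, smul_zero,
      Int.cast_zero, zero_mul, ite_self, zero_smul, sub_self, zero_add]
    abel
  · rw [sugawaraTerm_smul_ua hM]
    congr 1
    simp only [quadComm, ite_smul_mode, ite_smul_mode_neg]
    simp only [H4.lie_F_I, H4.lie_E_I, H4.lie_J_I, H4.lie_I, ua_zero_smul,
      H4.form_F_I, H4.form_E_I, H4.form_I_I, H4.form_J_I, mul_zero, mul_one,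
      smul_zero, ite_self, zero_smul, sub_zero, zero_add, add_zero, Int.cast_neg]
    simp only [sub_smul, ite_smul, zero_smul, neg_smul]
    split_ifs <;> abel

theorem sum_range_ite_lt (a N : ℕ) (h : a ≤ N) :
    ∑ k ∈ Finset.range N, (if k < a then (1 : ℂ) else 0) = a := by
  rw [Finset.sum_boole, show Finset.filter (fun k => k < a) (Finset.range N) = Finset.range a by
    ext k; simp only [Finset.mem_filter, Finset.mem_range]; omega, Finset.card_range]

/-- The number, with signs, of the normally ordered products whose two orderings are exchanged by a
shift by `m`. -/
theorem sum_range_count (m : ℤ) (N : ℕ) (h : m.natAbs ≤ N) :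
    (if m < 0 then (1 : ℂ) else 0) + ∑ k ∈ Finset.range N,
      ((if (k : ℤ) + 1 + m < 0 then (1 : ℂ) else 0) - (if 0 ≤ m - ((k : ℤ) + 1) then 1 else 0)) =
      -m := by
  rw [Finset.sum_sub_distrib]
  have h1 : ∀ k : ℕ, ((k : ℤ) + 1 + m < 0 ↔ k < (-m - 1).toNat) := fun k => by omega
  have h2 : ∀ k : ℕ, (0 ≤ m - ((k : ℤ) + 1) ↔ k < m.toNat) := fun k => by omega
  simp only [h1, h2]
  rw [sum_range_ite_lt _ _ (by omega), sum_range_ite_lt _ _ (by omega)]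
  have : ((if m < 0 then (1 : ℤ) else 0) + (((-m - 1).toNat : ℤ) - (m.toNat : ℤ))) = -m := by
    split_ifs <;> omega
  exact_mod_cast this

/-- In contrast to the other modes, the quadratic terms `E_p F_{m - p}` that appear here have to be
normally ordered before they become finitely supported in `p`; the reordering contributes multiples
of `I_m`, which the summand `-:II:/2` cancels. -/
theorem virasoroL0_smul_J (hM : IsLevelOne M) (hs : IsSmooth M) (m : ℤ) (v : M) :
    virasoroL0 (ua H4.J m • v) = ua H4.J m • virasoroL0 v + (-m : ℂ) • ua H4.J m • v := by
  have hEF : ∀ a b, a + b = m → (m = 0 → a = 0) → ua H4.E a • ua H4.F b • v =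
      ua H4.F b • ua H4.E a • v + ua H4.I m • v := fun a b hab h0 => by
    rw [ua_smul_comm hM, H4.lie_E_F, hab]
    by_cases hm : m = 0
    · simp [h0 hm]
    · simp [hm]
  -- the normally ordered product of `E_p` and `F_{m - p}`
  let P : ℤ → M := fun p =>
    if p < 0 then ua H4.E p • ua H4.F (m - p) • v else ua H4.F (m - p) • ua H4.E p • v
  have hP : ∀ p, P p = if p < 0 then ua H4.E p • ua H4.F (m - p) • v else
    ua H4.F (m - p) • ua H4.E p • v := fun p => rfl
  refine virasoroL0_smul_of_terms hs H4.J m v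
    (-(P m - P 0) + (if m < 0 then (1 : ℂ) else 0) • ua H4.I m • v) _
    (fun n => P (-n) + P n - P (m + n) - P (m - n) +
      (((if n + m < 0 then (1 : ℂ) else 0) - (if 0 ≤ m - n then 1 else 0)) • ua H4.I m • v +
      ((if n + m = 0 then (n : ℂ) else 0) - (if -n + m = 0 then (n : ℂ) else 0)) •
        (ua H4.J m • v - ua H4.I m • v))) ?_ (fun n hn => ?_) fun N₀ hN₀ => ?_
  · rw [sugawaraZero_smul_ua hM]
    congr 1
    simp only [quadComm, H4.lie_F_J, H4.lie_E_J, H4.lie_J_J, H4.lie_I, ua_zero_smul, ua_neg_smul,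
      smul_neg, smul_zero, Int.cast_zero, zero_mul, ite_self, zero_smul, add_zero, zero_add, hP,
      lt_self_iff_false, if_false, sub_self, sub_zero]
    split_ifs with h
    · rw [hEF m 0 (by omega) (by omega), one_smul]
      abel
    · rw [zero_smul]
      abel
  · rw [sugawaraTerm_smul_ua hM]
    congr 1
    simp only [quadComm, ite_smul_mode, ite_smul_mode_neg]
    simp only [H4.lie_F_J, H4.lie_E_J, H4.lie_J_J, H4.lie_I, ua_zero_smul, ua_neg_smul,
      H4.form_F_J, H4.form_E_J, H4.form_I_J, H4.form_J_J, mul_zero, mul_one,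
      smul_neg, smul_zero, ite_self, zero_smul, zero_add, add_zero, Int.cast_neg]
    have e1 : P (-n) = ua H4.E (-n) • ua H4.F (n + m) • v := by
      rw [hP, if_pos (by omega), sub_neg_eq_add, add_comm n]
    have e2 : P n = ua H4.F (-n + m) • ua H4.E n • v := by
      rw [hP, if_neg (by omega), neg_add_eq_sub]
    have e3 : ua H4.F (-n) • ua H4.E (n + m) • v =
        P (m + n) - (if n + m < 0 then (1 : ℂ) else 0) • ua H4.I m • v := by
      rw [hP, add_comm m n, show m - (n + m) = -n by omega]
      split_ifs with h
      · rw [hEF (n + m) (-n) (by omega) (by omega), one_smul, add_sub_cancel_right]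
      · rw [zero_smul, sub_zero]
    have e4 : ua H4.E (-n + m) • ua H4.F n • v =
        P (m - n) + (if 0 ≤ m - n then (1 : ℂ) else 0) • ua H4.I m • v := by
      rw [hP, neg_add_eq_sub, show m - (m - n) = n by omega]
      rcases lt_or_ge (m - n) 0 with h | h
      · rw [if_pos h, if_neg (by omega), zero_smul, add_zero]
      · rw [if_neg (by omega), if_pos h, one_smul, hEF (m - n) n (by omega) (by omega)]
    rw [e1, e2, e3, e4]
    simp only [sub_smul, ite_smul, zero_smul, neg_smul, smul_sub]
    split_ifs <;> abel
  · refine ⟨N₀ + 2 * m.natAbs, fun N hN => ?_⟩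
    have habs : |m| = m.natAbs := Int.abs_eq_natAbs m
    have d1 := sum_range_delta (N := N) m (by omega)
    have d2 := sum_range_count m N (by omega)
    rw [Finset.sum_add_distrib, sum_range_shift m, Finset.sum_add_distrib, ← Finset.sum_smul,
      ← Finset.sum_smul]
    · push_cast
      rw [d1, add_comm (-(P m - P 0)), add_assoc, neg_add_cancel_left, ← add_assoc, ← add_smul, d2,
        smul_sub]
      abel
    · intro p hp
      have hp' : (N₀ : ℤ) ≤ p ∨ (p < 0 ∧ (N₀ : ℤ) ≤ m - p) := by
        rcases abs_cases p with h | h <;> omega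
      rcases hp' with h | ⟨h, h'⟩
      · rw [hP, if_neg (by omega), hN₀ _ _ h, smul_zero]
      · rw [hP, if_pos h, hN₀ _ _ h', smul_zero]

/-- The Virasoro zero mode counts the mode number with the opposite sign. -/
theorem virasoroL0_smul_ua (hM : IsLevelOne M) (hs : IsSmooth M) (A : H4) (m : ℤ) (v : M) :
    virasoroL0 (ua A m • v) = ua A m • virasoroL0 v + (-m : ℂ) • ua A m • v := by
  rw [H4.eq_sum A]
  simp only [ua_add_smul, ua_smul_smul, virasoroL0_add hs, virasoroL0_smul hs,
    virasoroL0_smul_E hM hs, virasoroL0_smul_F hM hs, virasoroL0_smul_I hM hs,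
    virasoroL0_smul_J hM hs, smul_add, smul_comm (-m : ℂ)]
  abel

end VirasoroComm

/-! ### Modules generated by a ladder of ground states -/

theorem uK_comm (u : UA) : uK * u = u * uK := by
  induction u using UA.induction with
  | hm A n => exact uK_mul A n
  | hK => rfl
  | halg c => exact (Algebra.commutes c uK).symm
  | hadd x y hx hy => rw [mul_add, add_mul, hx, hy]
  | hmul x y hx hy => rw [← mul_assoc, hx, mul_assoc, hy, mul_assoc]

theorem isLevelOne_of_span_eq_top {M : Type} [AddCommGroup M] [Module UA M] {G : Set M}
    (hG : ∀ x ∈ G, uK • x = x) (hspan : Submodule.span UA G = ⊤) : IsLevelOne M := by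
  intro v
  have hv : v ∈ Submodule.span UA G := hspan ▸ Submodule.mem_top
  induction hv using Submodule.span_induction with
  | mem x hx => exact hG x hx
  | zero => exact smul_zero _
  | add x y _ _ hx hy => rw [smul_add, hx, hy]
  | smul u x _ hx => rw [← mul_smul, uK_comm, mul_smul, hx]

theorem mem_of_mem_sSup {M : Type} [AddCommGroup M] [Module ℂ M] [Module UA M]
    {S : Set (Submodule UA M)} {T : Submodule ℂ M} (h : ∀ N ∈ S, ∀ v ∈ N, v ∈ T) {v : M}
    (hv : v ∈ sSup S) : v ∈ T := by
  rw [sSup_eq_iSup'] at hv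
  induction hv using Submodule.iSup_induction' with
  | mem N v hv => exact h N N.2 v hv
  | zero => exact T.zero_mem
  | add x y _ _ hx hy => exact T.add_mem hx hy

/-- The lowest conformal weight of a module whose ground states have `I_0 = i` and Casimir `c`. -/
def groundWeight (i c : ℂ) : ℂ := c + i * (1 / 2 - i / 2)

/-- A module over the affine algebra that is generated by a ladder `w` of ground states: `w p` is
annihilated by the positive modes, `K` and `I_0` and the Casimir element act as `1`, `i` and `c`,
the weight of `w p` for `J_0` is `j + s p` with a sign `s`, and the span of the `w p` is stable
under the zero modes.  The `w p` are allowed to vanish. -/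
structure IsLadder (s : ℤ) (i j c : ℂ) {M : Type} [AddCommGroup M] [Module ℂ M] [Module UA M]
    (w : ℤ → M) : Prop where
  sign_sq : s * s = 1
  K_smul : ∀ p, uK • w p = w p
  pos : ∀ A n p, 0 < n → ua A n • w p = 0
  I_smul : ∀ p, ua H4.I 0 • w p = i • w p
  J_smul : ∀ p, ua H4.J 0 • w p = (j + s * p) • w p
  E_smul : ∀ p, ua H4.E 0 • w p ∈ Submodule.span ℂ (Set.range w)
  F_smul : ∀ p, ua H4.F 0 • w p ∈ Submodule.span ℂ (Set.range w)
  casimir : ∀ p, ua H4.F 0 • ua H4.E 0 • w p + ua H4.I 0 • ua H4.J 0 • w p = c • w p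
  span_eq_top : Submodule.span UA (Set.range w) = ⊤

namespace IsLadder

variable {M : Type} [AddCommGroup M] [Module ℂ M] [Module UA M] [IsScalarTower ℂ UA M]
  {s : ℤ} {i j c : ℂ} {w : ℤ → M} (hw : IsLadder s i j c w)

include hw

omit [IsScalarTower ℂ UA M] in
theorem isLevelOne : IsLevelOne M :=
  isLevelOne_of_span_eq_top (Set.forall_mem_range.2 hw.K_smul) hw.span_eq_top

/-- Every subspace that contains the ladder and is stable under the modes is everything. -/
theorem mem_of_stable {T : Submodule ℂ M} (hwT : ∀ p, w p ∈ T)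
    (hT : ∀ A n, ∀ v ∈ T, ua A n • v ∈ T) (v : M) : v ∈ T :=
  span_le_of_stable hw.isLevelOne hT (Set.range_subset_iff.2 hwT)
    (hw.span_eq_top ▸ Submodule.mem_top : v ∈ Submodule.span UA (Set.range w))

theorem isSmooth : IsSmooth M := by
  let T : Submodule ℂ M :=
    { carrier := {v | ∃ N : ℕ, ∀ A n, (N : ℤ) ≤ n → ua A n • v = 0}
      add_mem' := by
        rintro a b ⟨N, hN⟩ ⟨N', hN'⟩
        exact ⟨N + N', fun A n hn => by
          rw [smul_add, hN A n (by omega), hN' A n (by omega), add_zero]⟩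
      zero_mem' := ⟨0, fun A n _ => smul_zero _⟩
      smul_mem' := by
        rintro r a ⟨N, hN⟩
        exact ⟨N, fun A n hn => by rw [smul_comm, hN A n hn, smul_zero]⟩ }
  refine hw.mem_of_stable (T := T) (fun p => ⟨1, fun A n hn => hw.pos A n p (by omega)⟩) ?_
  rintro B m v ⟨N, hN⟩
  refine ⟨N + m.natAbs + 1, fun A n hn => ?_⟩
  rw [ua_smul_comm hw.isLevelOne, hN A n (by omega), hN _ (n + m) (by omega), if_neg (by omega)]
  simp

theorem I_smul' (v : M) : ua H4.I 0 • v = i • v := by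
  let T : Submodule ℂ M :=
    { carrier := {v | ua H4.I 0 • v = i • v}
      add_mem' := fun {a b} ha hb => by
        rw [Set.mem_ofPred_eq] at *; rw [smul_add, smul_add, ha, hb]
      zero_mem' := by simp
      smul_mem' := fun r a ha => by
        rw [Set.mem_ofPred_eq] at *; rw [smul_comm, ha, smul_comm] }
  refine hw.mem_of_stable (T := T) hw.I_smul (fun A n v hv => ?_) v
  change _ = _
  rw [ua_smul_comm hw.isLevelOne, H4.lie_I, ua_zero_smul, (show _ = _ from hv)]
  simp only [Int.cast_zero, zero_mul, ite_self, zero_smul, add_zero]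
  exact smul_comm _ _ _

omit hw in
theorem map {M' : Type} [AddCommGroup M'] [Module ℂ M'] [Module UA M'] [IsScalarTower ℂ UA M']
    (hw : IsLadder s i j c w) {g : M →ₗ[UA] M'} (hg : Function.Surjective g) :
    IsLadder s i j c (fun p => g (w p)) where
  sign_sq := hw.sign_sq
  K_smul p := by rw [← map_smul, hw.K_smul]
  pos A n p hn := by rw [← map_smul, hw.pos A n p hn, map_zero]
  I_smul p := by
    rw [← map_smul, hw.I_smul]; exact (g.restrictScalars ℂ).map_smul _ _
  J_smul p := by
    rw [← map_smul, hw.J_smul]; exact (g.restrictScalars ℂ).map_smul _ _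
  E_smul p := by
    have := Submodule.mem_map_of_mem (f := g.restrictScalars ℂ) (hw.E_smul p)
    rw [Submodule.map_span, ← Set.range_comp] at this
    rw [← map_smul]; exact this
  F_smul p := by
    have := Submodule.mem_map_of_mem (f := g.restrictScalars ℂ) (hw.F_smul p)
    rw [Submodule.map_span, ← Set.range_comp] at this
    rw [← map_smul]; exact this
  casimir p := by
    simp only [← map_smul, ← map_add, hw.casimir]; exact (g.restrictScalars ℂ).map_smul _ _
  span_eq_top := by
    have := Submodule.map_span g (Set.range w)
    rw [hw.span_eq_top, Submodule.map_top, LinearMap.range_eq_top.2 hg, ← Set.range_comp] at this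
    exact this.symm

/-- The vectors of conformal weight `d` above the ground states, and of weight `j + s p`, where
`x = (d, p)`. -/
def cell (x : ℤ × ℤ) : Submodule ℂ M :=
  (L0 hw.isSmooth).eigenspace (groundWeight i c + x.1) ⊓
    (Algebra.lsmul ℂ ℂ M (ua H4.J 0)).eigenspace (j + s * x.2)

/-- The sum of the cells with labels in `S`. -/
def cells (S : Set (ℤ × ℤ)) : Submodule ℂ M := ⨆ x ∈ S, hw.cell x

theorem mem_cell {x : ℤ × ℤ} {v : M} : v ∈ hw.cell x ↔
    virasoroL0 v = (groundWeight i c + x.1) • v ∧ ua H4.J 0 • v = (j + s * x.2) • v := by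
  rw [cell, Submodule.mem_inf, Module.End.mem_eigenspace_iff, Module.End.mem_eigenspace_iff]
  rfl

theorem cell_le_cells {S : Set (ℤ × ℤ)} {x : ℤ × ℤ} (hx : x ∈ S) : hw.cell x ≤ hw.cells S :=
  le_iSup₂_of_le x hx le_rfl

theorem cells_mono {S S' : Set (ℤ × ℤ)} (h : S ⊆ S') : hw.cells S ≤ hw.cells S' :=
  iSup₂_le fun _ hx => hw.cell_le_cells (h hx)

theorem w_mem_cell (p : ℤ) : w p ∈ hw.cell (0, p) := by
  rw [mem_cell]
  refine ⟨?_, hw.J_smul p⟩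
  rw [virasoroL0_eq_sum (N := 0) fun A n hn => hw.pos A n p (by simpa using hn)]
  have hz : sugawaraZero • w p = ua H4.F 0 • ua H4.E 0 • w p + ua H4.I 0 • ua H4.J 0 • w p +
      (1 / 2 : ℂ) • (ua H4.I 0 • w p - ua H4.I 0 • ua H4.I 0 • w p) := by
    simp only [sugawaraZero, add_smul, sub_smul, mul_smul, algebraMap_smul]
  rw [hz, hw.casimir, hw.I_smul', hw.I_smul', Finset.range_zero, Finset.sum_empty, groundWeight]
  push_cast
  module

theorem smul_mem_cell {A : H4} {k : ℤ} (hA : ⁅H4.J, A⁆ = (k : ℂ) • A) (n : ℤ) {d p : ℤ} {v : M}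
    (hv : v ∈ hw.cell (d, p)) : ua A n • v ∈ hw.cell (d - n, p + s * k) := by
  rw [mem_cell] at hv ⊢
  refine ⟨?_, ?_⟩
  · rw [virasoroL0_smul_ua hw.isLevelOne hw.isSmooth, hv.1, smul_comm, ← add_smul]
    push_cast
    congr 1; ring
  · rw [ua_smul_comm hw.isLevelOne, hv.2, hA, ua_smul_smul, zero_add, smul_comm, ← add_smul]
    simp only [Int.cast_zero, zero_mul, ite_self, zero_smul, add_zero]
    congr 1
    have : (s : ℂ) * s = 1 := by exact_mod_cast hw.sign_sq
    push_cast
    linear_combination (-(k : ℂ)) * this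

theorem smul_mem_cells {S S' : Set (ℤ × ℤ)} {n : ℤ}
    (hS : ∀ d p k : ℤ, (d, p) ∈ S → |k| ≤ 1 → (d - n, p + k) ∈ S') (A : H4) {v : M}
    (hv : v ∈ hw.cells S) : ua A n • v ∈ hw.cells S' := by
  have hs : |s| = 1 := by
    have := hw.sign_sq
    have h : |s| * |s| = 1 := by rw [← abs_mul, this, abs_one]
    nlinarith [abs_nonneg s]
  have key : ∀ A : H4, ∀ k : ℤ, |k| ≤ 1 → ⁅H4.J, A⁆ = (k : ℂ) • A →
      ∀ v ∈ hw.cells S, ua A n • v ∈ hw.cells S' := by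
    intro A k hk hA v hv
    have : hw.cells S ≤ (hw.cells S').comap (Algebra.lsmul ℂ ℂ M (ua A n)) := by
      refine iSup₂_le fun x hx v hv => ?_
      refine hw.cell_le_cells (hS x.1 x.2 (s * k) hx ?_) (hw.smul_mem_cell hA n hv)
      rw [abs_mul, hs, one_mul]; exact hk
    exact this hv
  refine ua_mem_of_basis (key _ 1 (by simp) ?_ v hv) (key _ (-1) (by simp) ?_ v hv)
    (key _ 0 (by simp) ?_ v hv) (key _ 0 (by simp) ?_ v hv) A
  · simp [H4.lie_J_E]
  · rw [H4.lie_J_F]; push_cast; rw [neg_one_smul]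
  · simp [H4.lie_J_I]
  · simp

theorem iSup_cell : ⨆ x, hw.cell x = ⊤ := by
  have h : hw.cells Set.univ = ⨆ x, hw.cell x := by simp [cells]
  rw [← h]
  refine eq_top_iff.2 fun v _ => hw.mem_of_stable
    (fun p => hw.cell_le_cells (Set.mem_univ _) (hw.w_mem_cell p))
    (fun A n v hv => hw.smul_mem_cells (fun _ _ _ _ _ => Set.mem_univ _) A hv) v

/-- The operator `L_0 + √-1 s J_0`, which separates the cells. -/
def cellOp : Module.End ℂ M :=
  L0 hw.isSmooth + (Complex.I * s) • Algebra.lsmul ℂ ℂ M (ua H4.J 0)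

omit hw in
/-- The eigenvalue of `L_0 + √-1 s J_0` on a cell. -/
def cellValue (s : ℤ) (i j c : ℂ) (x : ℤ × ℤ) : ℂ :=
  groundWeight i c + x.1 + Complex.I * s * (j + s * x.2)

omit [IsScalarTower ℂ UA M] in
theorem cellValue_injective : Function.Injective (cellValue s i j c) := by
  rintro ⟨d, p⟩ ⟨d', p'⟩ h
  have hs : (s : ℂ) * s = 1 := by exact_mod_cast hw.sign_sq
  have h2 : (d : ℂ) + Complex.I * p = d' + Complex.I * p' := by
    simp only [cellValue] at h
    linear_combination h + Complex.I * (p' - p) * hs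
  have h3 := congrArg Complex.re h2
  have h4 := congrArg Complex.im h2
  simp at h3 h4
  rw [h3, h4]

theorem cell_le_eigenspace (x : ℤ × ℤ) :
    hw.cell x ≤ hw.cellOp.eigenspace (cellValue s i j c x) := by
  intro v hv
  rw [mem_cell] at hv
  rw [Module.End.mem_eigenspace_iff]
  change virasoroL0 v + (Complex.I * s) • ua H4.J 0 • v = _
  rw [hv.1, hv.2, smul_smul, ← add_smul]
  rfl

theorem iSupIndep_cell : iSupIndep hw.cell :=
  iSupIndep_of_le_eigenspace hw.cellValue_injective hw.cell_le_eigenspace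

theorem eq_zero_of_mem_cells {S : Set (ℤ × ℤ)} {x : ℤ × ℤ} (hx : x ∉ S) {v : M}
    (hv : v ∈ hw.cell x) (hv' : v ∈ hw.cells S) : v = 0 := by
  refine Submodule.disjoint_def.1 (hw.iSupIndep_cell x) v hv ?_
  refine (iSup₂_le fun y hy => le_iSup₂_of_le y ?_ le_rfl : hw.cells S ≤ _) hv'
  rintro rfl
  exact hx hy

theorem exists_components (X : Submodule UA M) {v : M} (hv : v ∈ X) :
    ∃ t : Finset (ℤ × ℤ), ∃ a : ℤ × ℤ → M, (∀ x ∈ t, a x ∈ X ∧ a x ∈ hw.cell x) ∧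
      v = ∑ x ∈ t, a x := by
  refine mem_iSup_inf_of_eigen (X := X.restrictScalars ℂ) hw.cellValue_injective
    hw.cell_le_eigenspace hw.iSup_cell (fun v hv => ?_) hv
  exact X.add_mem (virasoroL0_mem hw.isSmooth X hv)
    ((X.restrictScalars ℂ).smul_mem _ (X.smul_mem (ua H4.J 0) hv))

theorem mem_cells_of_submodule (X : Submodule UA M) (S : Set (ℤ × ℤ))
    (h : ∀ x ∉ S, ∀ v ∈ X, v ∈ hw.cell x → v = 0) {v : M} (hv : v ∈ X) : v ∈ hw.cells S := by
  obtain ⟨t, a, ha, rfl⟩ := hw.exists_components X hv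
  refine Submodule.sum_mem _ fun x hx => ?_
  by_cases hxS : x ∈ S
  · exact hw.cell_le_cells hxS (ha x hx).2
  · rw [h x hxS _ (ha x hx).1 (ha x hx).2]
    exact Submodule.zero_mem _

theorem zero_mode_mem (A : H4) {v : M} (hv : v ∈ Submodule.span ℂ (Set.range w)) :
    ua A 0 • v ∈ Submodule.span ℂ (Set.range w) := by
  have : Submodule.span ℂ (Set.range w) ≤
      (Submodule.span ℂ (Set.range w)).comap (Algebra.lsmul ℂ ℂ M (ua A 0)) := by
    rw [Submodule.span_le]
    rintro _ ⟨p, rfl⟩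
    refine ua_mem_of_basis (hw.E_smul p) (hw.F_smul p) ?_ ?_ A
    · rw [hw.I_smul]; exact Submodule.smul_mem _ _ (Submodule.subset_span ⟨p, rfl⟩)
    · rw [hw.J_smul]; exact Submodule.smul_mem _ _ (Submodule.subset_span ⟨p, rfl⟩)
  exact this hv

theorem pos_mode_eq_zero (A : H4) {n : ℤ} (hn : 0 < n) {v : M}
    (hv : v ∈ Submodule.span ℂ (Set.range w)) : ua A n • v = 0 := by
  have : Submodule.span ℂ (Set.range w) ≤ LinearMap.ker (Algebra.lsmul ℂ ℂ M (ua A n)) := by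
    rw [Submodule.span_le]
    rintro _ ⟨p, rfl⟩
    exact hw.pos A n p hn
  exact this hv

/-- A subspace that contains the ladder and is stable under the negative modes is everything. -/
theorem mem_of_negative_stable {T : Submodule ℂ M} (hwT : ∀ p, w p ∈ T)
    (hT : ∀ A n, n < 0 → ∀ v ∈ T, ua A n • v ∈ T) (v : M) : v ∈ T := by
  refine span_le_of_triangular hw.isLevelOne 0 (G := Submodule.span ℂ (Set.range w))
    (Submodule.span_le.2 (Set.range_subset_iff.2 hwT)) (fun A n hn v hv => ?_) hT ?_
  · rcases hn.eq_or_lt with rfl | hn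
    · exact hw.zero_mode_mem A hv
    · rw [hw.pos_mode_eq_zero A hn hv]; exact Submodule.zero_mem _
  · have : (⊤ : Submodule UA M) ≤ Submodule.span UA (Submodule.span ℂ (Set.range w) : Set M) := by
      rw [← hw.span_eq_top]
      exact Submodule.span_mono Submodule.subset_span
    exact this Submodule.mem_top

/-- If a set of labels contains those of the nonvanishing `w p` and is stable under the shifts by
which negative modes act, then the module is the sum of the cells with labels in this set. -/
theorem mem_cells_of_negative_stable {S : Set (ℤ × ℤ)} (h0 : ∀ p, w p ≠ 0 → (0, p) ∈ S)
    (hS : ∀ d p n k : ℤ, (d, p) ∈ S → 0 < n → |k| ≤ 1 → (d + n, p + k) ∈ S) (v : M) :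
    v ∈ hw.cells S := by
  refine hw.mem_of_negative_stable (fun p => ?_) (fun A n hn v hv => ?_) v
  · by_cases hp : w p = 0
    · rw [hp]; exact Submodule.zero_mem _
    · exact hw.cell_le_cells (h0 p hp) (hw.w_mem_cell p)
  · refine hw.smul_mem_cells (fun d p k hx hk => ?_) A hv
    have := hS d p (-n) k hx (by omega) hk
    rwa [← sub_eq_add_neg] at this

theorem cell_eq_bot {x : ℤ × ℤ} {S : Set (ℤ × ℤ)} (h0 : ∀ p, w p ≠ 0 → (0, p) ∈ S)
    (hS : ∀ d p n k : ℤ, (d, p) ∈ S → 0 < n → |k| ≤ 1 → (d + n, p + k) ∈ S) (hx : x ∉ S) {v : M}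
    (hv : v ∈ hw.cell x) : v = 0 :=
  hw.eq_zero_of_mem_cells hx hv (hw.mem_cells_of_negative_stable h0 hS v)

theorem eq_zero_of_neg {d p : ℤ} (hd : d < 0) {v : M} (hv : v ∈ hw.cell (d, p)) : v = 0 :=
  hw.cell_eq_bot (S := {x | 0 ≤ x.1}) (fun _ _ => le_refl (0 : ℤ))
    (fun d _ n _ hx hn _ => by simp only [Set.mem_ofPred_eq] at *; omega)
    (by simp only [Set.mem_ofPred_eq]; omega) hv

/-- The cells of relative conformal weight zero are spanned by the ladder, since negative modes
raise the weight. -/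
theorem mem_span_of_mem_cell {p : ℤ} {v : M} (hv : v ∈ hw.cell (0, p)) : ∃ a : ℂ, v = a • w p := by
  have hT := hw.mem_of_negative_stable
    (T := Submodule.span ℂ (Set.range w) ⊔ hw.cells {x | 1 ≤ x.1})
    (fun p => Submodule.mem_sup_left (Submodule.subset_span ⟨p, rfl⟩)) (fun A n hn v hv => by
      refine Submodule.mem_sup_right ?_
      have h1 : Submodule.span ℂ (Set.range w) ⊔ hw.cells {x | 1 ≤ x.1} ≤
          hw.cells {x | 0 ≤ x.1} := by
        refine sup_le (Submodule.span_le.2 ?_) (hw.cells_mono fun x hx => ?_)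
        · rintro _ ⟨p, rfl⟩
          exact hw.cell_le_cells (le_refl (0 : ℤ)) (hw.w_mem_cell p)
        · simp only [Set.mem_ofPred_eq] at *; omega
      refine hw.smul_mem_cells (fun d p k hx _ => ?_) A (h1 hv)
      simp only [Set.mem_ofPred_eq] at *; omega) v
  have h2 : Submodule.span ℂ (Set.range w) ⊔ hw.cells {x | 1 ≤ x.1} ≤
      Submodule.span ℂ {w p} ⊔ hw.cells {x | x ≠ (0, p)} := by
    refine sup_le (Submodule.span_le.2 ?_) (le_sup_of_le_right (hw.cells_mono fun x hx => ?_))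
    · rintro _ ⟨q, rfl⟩
      by_cases hq : q = p
      · subst hq; exact Submodule.mem_sup_left (Submodule.mem_span_singleton_self _)
      · exact Submodule.mem_sup_right (hw.cell_le_cells (by simp [hq]) (hw.w_mem_cell q))
    · rintro rfl; simp at hx
  obtain ⟨a, ha, b, hb, rfl⟩ := Submodule.mem_sup.1 (h2 hT)
  obtain ⟨r, rfl⟩ := Submodule.mem_span_singleton.1 ha
  have hb' : b ∈ hw.cell (0, p) := by
    have := Submodule.sub_mem _ hv (Submodule.smul_mem _ r (hw.w_mem_cell p))
    simpa using this
  rw [hw.eq_zero_of_mem_cells (by simp) hb' hb]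
  exact ⟨r, by simp⟩

/-- The ground states lie in the cells of relative conformal weight zero. -/
theorem mem_cells_of_ground {v : M} (hv : virasoroL0 v = groundWeight i c • v) :
    v ∈ hw.cells {x | x.1 = 0} := by
  let D : ℤ → Submodule ℂ M := fun d => hw.cells {x | x.1 = d}
  have hD : ∀ d, D d ≤ (L0 hw.isSmooth).eigenspace (groundWeight i c + d) := fun d =>
    iSup₂_le fun x hx v hv => by
      rw [Module.End.mem_eigenspace_iff]
      have := (hw.mem_cell.1 hv).1
      rw [Set.mem_ofPred_eq] at hx
      rw [hx] at this
      exact this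
  have htop : ⨆ d, D d = ⊤ := by
    rw [eq_top_iff, ← hw.iSup_cell]
    exact iSup_le fun x => le_iSup_of_le x.1 (hw.cell_le_cells rfl)
  have h := eigenspace_eq_of_iSup_eq_top (μ := fun d : ℤ => groundWeight i c + d)
    (fun a b hab => by simpa using hab) hD htop 0
  change v ∈ D 0
  rw [← h, Module.End.mem_eigenspace_iff]
  rw [Int.cast_zero, add_zero]
  exact hv

/-- If the positive modes preserve a subspace without ground states, then the submodule that it
generates has no ground states either. -/
theorem span_le_of_positive_stable {G : Submodule ℂ M} (hG : G ≤ hw.cells {x | 1 ≤ x.1})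
    (hpos : ∀ A n, 0 < n → ∀ v ∈ G, ua A n • v ∈ G) {v : M}
    (hv : v ∈ Submodule.span UA (G : Set M)) : v ∈ hw.cells {x | 1 ≤ x.1} := by
  refine span_le_of_triangular hw.isLevelOne 1 hG (fun A n hn => hpos A n (by omega))
    (fun A n hn v hv => hw.smul_mem_cells (fun d p k hx _ => ?_) A hv) hv
  simp only [Set.mem_ofPred_eq] at *
  omega

/-- If `w q` generates, then a proper submodule does not contain it, and hence has no component in
the cell that it spans. -/
theorem maxSubmodule_ne_top {q : ℤ} (hq : w q ≠ 0) (hgen : Submodule.span UA {w q} = ⊤) :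
    maxSubmodule M ≠ ⊤ := by
  intro htop
  refine hq (hw.eq_zero_of_mem_cells (S := {x | x ≠ (0, q)}) (by simp) (hw.w_mem_cell q) ?_)
  refine mem_of_mem_sSup (S := {N | N ≠ ⊤}) (fun N hN v hv => ?_)
    (show w q ∈ maxSubmodule M from htop ▸ Submodule.mem_top)
  refine hw.mem_cells_of_submodule N _ (fun x hx v hv hvx => ?_) hv
  obtain rfl : x = (0, q) := by simpa using hx
  obtain ⟨a, rfl⟩ := hw.mem_span_of_mem_cell hvx
  by_contra ha
  have ha0 : a ≠ 0 := fun h => ha (by rw [h, zero_smul])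
  refine hN (eq_top_iff.2 (hgen ▸ Submodule.span_le.2 (Set.singleton_subset_iff.2 ?_)))
  have := (N.restrictScalars ℂ).smul_mem a⁻¹ hv
  rwa [smul_smul, inv_mul_cancel₀ ha0, one_smul] at this

end IsLadder

/-! ### Submodules of a reduced ladder module -/

/-- `up` and `down` are the root vectors that raise and lower the index of a ladder with sign `s`.
-/
def IsOriented (s : ℤ) (up down : H4) : Prop :=
  (s = 1 ∧ up = H4.E ∧ down = H4.F) ∨ (s = -1 ∧ up = H4.F ∧ down = H4.E)

namespace IsOriented

variable {s : ℤ} {up down : H4} (ho : IsOriented s up down)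

include ho

theorem sign_sq : s * s = 1 := by
  rcases ho with ⟨rfl, -, -⟩ | ⟨rfl, -, -⟩ <;> norm_num

theorem lie_J_up : ⁅H4.J, up⁆ = (s : ℂ) • up := by
  rcases ho with ⟨rfl, rfl, rfl⟩ | ⟨rfl, rfl, rfl⟩
  · simp [H4.lie_J_E]
  · rw [H4.lie_J_F]; push_cast; rw [neg_one_smul]

theorem lie_J_down : ⁅H4.J, down⁆ = ((-s : ℤ) : ℂ) • down := by
  rcases ho with ⟨rfl, rfl, rfl⟩ | ⟨rfl, rfl, rfl⟩
  · rw [H4.lie_J_F]; push_cast; rw [neg_one_smul]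
  · simp [H4.lie_J_E]

theorem lie_up_down : ⁅up, down⁆ = (s : ℂ) • H4.I := by
  rcases ho with ⟨rfl, rfl, rfl⟩ | ⟨rfl, rfl, rfl⟩
  · simp [H4.lie_E_F]
  · rw [H4.lie_F_E]; push_cast; rw [neg_one_smul]

theorem ua_mem {M : Type} [AddCommGroup M] [Module ℂ M] [Module UA M] [IsScalarTower ℂ UA M]
    {T : Submodule ℂ M} {n : ℤ} {v : M} (hU : ua up n • v ∈ T) (hD : ua down n • v ∈ T)
    (hI : ua H4.I n • v ∈ T) (hJ : ua H4.J n • v ∈ T) (A : H4) : ua A n • v ∈ T := by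
  rcases ho with ⟨rfl, rfl, rfl⟩ | ⟨rfl, rfl, rfl⟩
  · exact ua_mem_of_basis hU hD hI hJ A
  · exact ua_mem_of_basis hD hU hI hJ A

end IsOriented

namespace IsLadder

variable {M : Type} [AddCommGroup M] [Module ℂ M] [Module UA M] [IsScalarTower ℂ UA M]
  {s : ℤ} {i j c : ℂ} {w : ℤ → M} {up down : H4}

theorem disjoint_cells (hw : IsLadder s i j c w) {S S' : Set (ℤ × ℤ)} (h : Disjoint S S') :
    Disjoint (hw.cells S) (hw.cells S') :=
  hw.iSupIndep_cell.disjoint_biSup_biSup h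

theorem up_smul_mem_cell (hw : IsLadder s i j c w) (ho : IsOriented s up down) (n : ℤ) {d p : ℤ}
    {v : M} (hv : v ∈ hw.cell (d, p)) : ua up n • v ∈ hw.cell (d - n, p + 1) := by
  have := hw.smul_mem_cell ho.lie_J_up n hv
  rwa [ho.sign_sq] at this

theorem down_smul_mem_cell (hw : IsLadder s i j c w) (ho : IsOriented s up down) (n : ℤ) {d p : ℤ}
    {v : M} (hv : v ∈ hw.cell (d, p)) : ua down n • v ∈ hw.cell (d - n, p - 1) := by
  have := hw.smul_mem_cell ho.lie_J_down n hv
  rwa [mul_neg, ho.sign_sq] at this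

theorem up_smul_down_smul (hw : IsLadder s i j c w) (ho : IsOriented s up down) (v : M) :
    ua up 0 • ua down 0 • v = ua down 0 • ua up 0 • v + (s * i) • v := by
  rw [ua_smul_comm hw.isLevelOne, ho.lie_up_down, ua_smul_smul, add_zero, hw.I_smul', ← smul_smul]
  simp

/-- As `[up_0, down_0]` acts as a nonzero scalar, a vector cannot be annihilated by `up_0` and by a
power of `down_0`. -/
theorem eq_zero_of_up_of_down (hw : IsLadder s i j c w) (ho : IsOriented s up down) (hi : i ≠ 0)
    {u : M} (hu : ua up 0 • u = 0) {m : ℕ} (hm : ua down 0 ^ m • u = 0) : u = 0 := by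
  have hs : (s : ℂ) ≠ 0 := by
    intro h
    have := ho.sign_sq
    rw [Int.cast_eq_zero.1 h] at this
    simp at this
  have key : ∀ m : ℕ, ua up 0 • ua down 0 ^ (m + 1) • u =
      ((m + 1 : ℂ) * (s * i)) • ua down 0 ^ m • u := by
    intro m
    induction m with
    | zero => rw [zero_add, pow_one, hw.up_smul_down_smul ho, hu]; simp
    | succ m ih =>
      rw [pow_succ' _ (m + 1), mul_smul, hw.up_smul_down_smul ho, ih, smul_comm (ua down 0) (_ : ℂ),
        ← mul_smul (ua down 0), ← pow_succ', ← add_smul]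
      congr 1
      push_cast
      ring
  induction m with
  | zero => simpa using hm
  | succ m ih =>
    have h := key m
    rw [hm, smul_zero] at h
    refine ih ((smul_eq_zero.1 h.symm).resolve_left ?_)
    exact mul_ne_zero (by exact_mod_cast Nat.succ_ne_zero m) (mul_ne_zero hs hi)

theorem mem_cells_of_mem_sSup (hw : IsLadder s i j c w) {v : M}
    (hv : v ∈ sSup {N : Submodule UA M | ∀ v ∈ N, virasoroL0 v = groundWeight i c • v → v = 0}) :
    v ∈ hw.cells {x | 1 ≤ x.1} := by
  refine mem_of_mem_sSup (fun N hN v hv => ?_) hv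
  refine hw.mem_cells_of_submodule N _ (fun x hx v hv hvx => ?_) hv
  obtain ⟨d, p⟩ := x
  simp only [Set.mem_ofPred_eq, not_le] at hx
  rcases (show d < 0 ∨ d = 0 by omega) with h | rfl
  · exact hw.eq_zero_of_neg h hvx
  · refine hN v hv ?_
    simpa using (hw.mem_cell.1 hvx).1

/-- A submodule without nonzero `w p` has components of positive relative conformal weight only. -/
theorem mem_cells_of_ground_notMem (hw : IsLadder s i j c w) {X : Submodule UA M}
    (hX : ∀ p, w p ∈ X → w p = 0) {v : M} (hv : v ∈ X) : v ∈ hw.cells {x | 1 ≤ x.1} := by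
  refine hw.mem_cells_of_submodule X _ (fun x hx v hv hvx => ?_) hv
  obtain ⟨d, p⟩ := x
  simp only [Set.mem_ofPred_eq, not_le] at hx
  rcases (show d < 0 ∨ d = 0 by omega) with h | rfl
  · exact hw.eq_zero_of_neg h hvx
  · obtain ⟨a, rfl⟩ := hw.mem_span_of_mem_cell hvx
    by_cases ha : a = 0
    · rw [ha, zero_smul]
    · have := (X.restrictScalars ℂ).smul_mem a⁻¹ hv
      rw [smul_smul, inv_mul_cancel₀ ha, one_smul] at this
      rw [hX p this, smul_zero]

end IsLadder

/-- A ladder module is reduced if each of its nonzero submodules contains a nonzero ground state;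
all the `w p` are nonzero, and `up_0`, `down_0` connect neighbouring `w p` in both directions,
except that `w 1` is annihilated by `down_0`. -/
structure IsReducedLadder (s : ℤ) (up down : H4) (i j c : ℂ) {M : Type} [AddCommGroup M]
    [Module ℂ M] [Module UA M] (w : ℤ → M) : Prop extends IsLadder s i j c w where
  oriented : IsOriented s up down
  ne_zero : ∀ p, w p ≠ 0
  up_smul : ∀ p, ∃ a : ℂ, a ≠ 0 ∧ ua up 0 • w p = a • w (p + 1)
  down_smul : ∀ p, p ≠ 0 → ∃ b : ℂ, b ≠ 0 ∧ ua down 0 • w (p + 1) = b • w p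
  down_smul_one : ua down 0 • w 1 = 0
  exists_mem : ∀ X : Submodule UA M, X ≠ ⊥ → ∃ p, w p ∈ X

namespace IsReducedLadder

variable {M : Type} [AddCommGroup M] [Module ℂ M] [Module UA M] [IsScalarTower ℂ UA M]
  {s : ℤ} {i j c : ℂ} {w : ℤ → M} {up down : H4}

theorem mem_of_smul_mem {X : Submodule UA M} {a : ℂ} (ha : a ≠ 0) {v : M} (h : a • v ∈ X) :
    v ∈ X := by
  have := (X.restrictScalars ℂ).smul_mem a⁻¹ h
  rwa [smul_smul, inv_mul_cancel₀ ha, one_smul] at this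

variable (hw : IsReducedLadder s up down i j c w)

include hw

theorem up_mem {X : Submodule UA M} {p : ℤ} (h : w p ∈ X) : w (p + 1) ∈ X := by
  obtain ⟨a, ha, he⟩ := hw.up_smul p
  exact mem_of_smul_mem ha (he ▸ X.smul_mem _ h)

theorem down_mem {X : Submodule UA M} {p : ℤ} (hp : p ≠ 0) (h : w (p + 1) ∈ X) : w p ∈ X := by
  obtain ⟨a, ha, he⟩ := hw.down_smul p hp
  exact mem_of_smul_mem ha (he ▸ X.smul_mem _ h)

theorem up_mem_of_le {X : Submodule UA M} {p q : ℤ} (hpq : p ≤ q) (h : w p ∈ X) : w q ∈ X := by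
  induction q, hpq using Int.leInduction with
  | base => exact h
  | succ q _ ih => exact hw.up_mem ih

theorem down_mem_of_le {X : Submodule UA M} {p q : ℤ} (hpq : p ≤ q) (hp : 0 < p ∨ q ≤ 0)
    (h : w q ∈ X) : w p ∈ X := by
  induction p, hpq using Int.leInductionDown with
  | base => exact h
  | pred p _ ih =>
    refine hw.down_mem (by omega) ?_
    rw [sub_add_cancel]
    exact ih (by omega)

/-- Every nonzero submodule contains `w 1`. -/
theorem w_one_mem {X : Submodule UA M} (hX : X ≠ ⊥) : w 1 ∈ X := by
  obtain ⟨p, hp⟩ := hw.exists_mem X hX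
  rcases le_or_gt p 1 with h | h
  · exact hw.up_mem_of_le h hp
  · exact hw.down_mem_of_le h.le (Or.inl one_pos) hp

theorem isSimpleModule_span : IsSimpleModule UA (Submodule.span UA {w 1}) := by
  rw [isSimpleModule_iff_isAtom]
  refine ⟨fun h => hw.ne_zero 1 (Submodule.span_singleton_eq_bot.1 h), fun X hX => ?_⟩
  by_contra hne
  exact hX.not_ge (Submodule.span_le.2 (Set.singleton_subset_iff.2 (hw.w_one_mem hne)))

theorem isIndecomposable : IsIndecomposable M := by
  refine ⟨⟨w 1, 0, hw.ne_zero 1⟩, fun N N' h => ?_⟩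
  by_contra! hne
  exact hw.ne_zero 1 (Submodule.disjoint_def.1 h.disjoint _ (hw.w_one_mem hne.1)
    (hw.w_one_mem hne.2))

/-- The submodule generated by `w 1` is obtained from the `w p` with `p ≥ 1` by negative modes, so
it has no further ground states. -/
theorem w_notMem_span {p : ℤ} (hp : p ≤ 0) : w p ∉ Submodule.span UA {w 1} := by
  intro h
  let S : Set (ℤ × ℤ) := {x | 1 ≤ x.1 ∨ x.1 = 0 ∧ 1 ≤ x.2}
  let G : Submodule ℂ M := Submodule.span ℂ (w '' Set.Ici 1)
  have hwG : ∀ q, 1 ≤ q → w q ∈ G := fun q hq => Submodule.subset_span ⟨q, hq, rfl⟩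
  have hGS : G ≤ hw.cells S := by
    refine Submodule.span_le.2 ?_
    rintro _ ⟨q, hq, rfl⟩
    exact hw.cell_le_cells (Or.inr ⟨rfl, hq⟩) (hw.w_mem_cell q)
  have hG : ∀ A n, 0 ≤ n → ∀ v ∈ G, ua A n • v ∈ G := by
    intro A n hn
    have : G ≤ G.comap (Algebra.lsmul ℂ ℂ M (ua A n)) := by
      refine Submodule.span_le.2 ?_
      rintro _ ⟨q, hq, rfl⟩
      change ua A n • w q ∈ G
      rw [Set.mem_Ici] at hq
      rcases hn.eq_or_lt with rfl | hn
      · refine hw.oriented.ua_mem ?_ ?_ ?_ ?_ A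
        · obtain ⟨a, -, he⟩ := hw.up_smul q
          rw [he]; exact G.smul_mem _ (hwG _ (by omega))
        · rcases hq.eq_or_lt with rfl | hq
          · rw [hw.down_smul_one]; exact G.zero_mem
          · obtain ⟨a, -, he⟩ := hw.down_smul (q - 1) (by omega)
            rw [sub_add_cancel] at he
            rw [he]; exact G.smul_mem _ (hwG _ (by omega))
        · rw [hw.I_smul]; exact G.smul_mem _ (hwG _ hq)
        · rw [hw.J_smul]; exact G.smul_mem _ (hwG _ hq)
      · rw [hw.pos A n q hn]; exact G.zero_mem
    exact fun v hv => this hv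
  have h1 : w p ∈ Submodule.span UA (G : Set M) :=
    Submodule.span_mono (Set.singleton_subset_iff.2 (hwG 1 le_rfl)) h
  have h2 : w p ∈ hw.cells S := by
    refine span_le_of_triangular hw.isLevelOne 0 hGS hG
      (fun A n hn v hv => hw.smul_mem_cells (fun d p k hx _ => ?_) A hv) h1
    simp only [S, Set.mem_ofPred_eq] at *
    omega
  refine hw.ne_zero p (hw.eq_zero_of_mem_cells ?_ (hw.w_mem_cell p) h2)
  simp only [S, Set.mem_ofPred_eq]
  omega

/-- A submodule without the ground states `w p`, `p ≤ 0`, has no vectors in the cells `(d, p)` with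
`d + p ≤ 0`: the positive modes send such a vector to no other ground state than these. -/
theorem eq_zero_of_mem_low_cell {X : Submodule UA M} (hX : ∀ p ≤ 0, w p ∉ X) {d p : ℤ}
    (hdp : d + p ≤ 0) {v : M} (hvX : v ∈ X) (hv : v ∈ hw.cell (d, p)) : v = 0 := by
  let g : Set M := {v | v ∈ X ∧ ∃ d p, d + p ≤ 0 ∧ v ∈ hw.cell (d, p)}
  let G : Submodule ℂ M := Submodule.span ℂ g
  have hGH : G ≤ hw.cells {x | 1 ≤ x.1} := by
    refine Submodule.span_le.2 ?_
    rintro v ⟨hvX, d, p, hdp, hv⟩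
    rcases lt_trichotomy d 0 with h | rfl | h
    · rw [hw.eq_zero_of_neg h hv]; exact Submodule.zero_mem _
    · obtain ⟨a, rfl⟩ := hw.mem_span_of_mem_cell hv
      by_cases ha : a = 0
      · rw [ha, zero_smul]; exact Submodule.zero_mem _
      · exact absurd (mem_of_smul_mem ha hvX) (hX p (by omega))
    · exact hw.cell_le_cells (Set.mem_ofPred_eq ▸ h : (d, p) ∈ {x : ℤ × ℤ | 1 ≤ x.1}) hv
  have hG : ∀ A n, 0 < n → ∀ v ∈ G, ua A n • v ∈ G := by
    intro A n hn
    have : G ≤ G.comap (Algebra.lsmul ℂ ℂ M (ua A n)) := by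
      refine Submodule.span_le.2 ?_
      rintro v ⟨hvX, d, p, hdp, hv⟩
      change ua A n • v ∈ G
      have hmem : ∀ A d' p', d' + p' ≤ 0 → ua A n • v ∈ hw.cell (d', p') → ua A n • v ∈ G :=
        fun A d' p' h h' => Submodule.subset_span ⟨X.smul_mem _ hvX, d', p', h, h'⟩
      exact hw.oriented.ua_mem (hmem _ _ _ (by omega) (hw.up_smul_mem_cell hw.oriented n hv))
        (hmem _ _ _ (by omega) (hw.down_smul_mem_cell hw.oriented n hv))
        (hmem _ _ (p + s * 0) (by omega) (hw.smul_mem_cell (by simp [H4.lie_J_I]) n hv))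
        (hmem _ _ (p + s * 0) (by omega) (hw.smul_mem_cell (by simp) n hv)) A
    exact fun v hv => this hv
  have hbot : Submodule.span UA (G : Set M) = ⊥ := by
    by_contra hne
    obtain ⟨q, hq⟩ := hw.exists_mem _ hne
    refine hw.ne_zero q (hw.eq_zero_of_mem_cells ?_ (hw.w_mem_cell q)
      (hw.span_le_of_positive_stable hGH hG hq))
    simp
  have : v ∈ Submodule.span UA (G : Set M) :=
    Submodule.subset_span (Submodule.subset_span ⟨hvX, d, p, hdp, hv⟩)
  rw [hbot] at this
  exact (Submodule.mem_bot UA).1 this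

/-- Modulo `w 1`, the ladder consists of the `w p` with `p ≤ 0`, and a mode of degree `-n` changes
the index `p` by at most `1 ≤ n`. -/
theorem quotient_cell {d p : ℤ} (hC : IsLadder s i j c
      (fun p => (Submodule.span UA {w 1}).mkQ (w p))) {v : M ⧸ Submodule.span UA {w 1}}
    (hp : d < p) (hv : v ∈ hC.cell (d, p)) : v = 0 := by
  refine hC.cell_eq_bot (S := {x | x.2 ≤ x.1}) (fun p hp => ?_) (fun d p n k hx hn hk => ?_)
    (by simp only [Set.mem_ofPred_eq]; omega) hv
  · by_contra h
    refine hp ?_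
    simp only [Set.mem_ofPred_eq, not_le] at h
    rw [Submodule.mkQ_apply, Submodule.Quotient.mk_eq_zero]
    exact hw.up_mem_of_le (p := 1) (by omega) (Submodule.mem_span_singleton_self _)
  · have := abs_le.1 hk
    simp only [Set.mem_ofPred_eq] at *
    omega

/-- In each conformal weight, a submodule without the ground states `w p`, `p ≤ 0`, meets only
finitely many cells modulo `span UA {w 1}`, so that `up_0` and `down_0` are locally nilpotent there;
as their commutator is a nonzero scalar, there is nothing. -/
theorem le_span_of_w_notMem (hi : i ≠ 0) {X : Submodule UA M} (hX : ∀ p ≤ 0, w p ∉ X) :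
    X ≤ Submodule.span UA {w 1} := by
  have hC : IsLadder s i j c (fun p => (Submodule.span UA {w 1}).mkQ (w p)) :=
    hw.toIsLadder.map (Submodule.mkQ_surjective _)
  have hcell : ∀ (d p : ℤ) (v : M), v ∈ hw.cell (d, p) →
      (Submodule.span UA {w 1}).mkQ v ∈ hC.cell (d, p) := by
    intro d p v hv
    rw [IsLadder.mem_cell] at hv ⊢
    refine ⟨?_, ?_⟩
    · rw [virasoroL0_map hw.isSmooth, hv.1]
      exact ((Submodule.span UA {w 1}).mkQ.restrictScalars ℂ).map_smul _ _
    · rw [← map_smul, hv.2]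
      exact ((Submodule.span UA {w 1}).mkQ.restrictScalars ℂ).map_smul _ _
  have hup : ∀ (k : ℕ) (d p : ℤ) (v : M), v ∈ hw.cell (d, p) →
      ua up 0 ^ k • v ∈ hw.cell (d, p + k) := by
    intro k
    induction k with
    | zero => intro d p v hv; simpa using hv
    | succ k ih =>
      intro d p v hv
      rw [pow_succ', mul_smul]
      have := hw.up_smul_mem_cell hw.oriented 0 (ih d p v hv)
      rw [sub_zero, add_assoc] at this
      exact_mod_cast this
  have hdown : ∀ (k : ℕ) (d p : ℤ) (v : M), v ∈ hw.cell (d, p) →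
      ua down 0 ^ k • v ∈ hw.cell (d, p - k) := by
    intro k
    induction k with
    | zero => intro d p v hv; simpa using hv
    | succ k ih =>
      intro d p v hv
      rw [pow_succ', mul_smul]
      have := hw.down_smul_mem_cell hw.oriented 0 (ih d p v hv)
      rw [sub_zero, sub_sub] at this
      exact_mod_cast this
  have key : ∀ (d p : ℤ) (v : M), v ∈ X → v ∈ hw.cell (d, p) →
      (Submodule.span UA {w 1}).mkQ v = 0 := by
    intro d p v hvX hv
    by_contra hne
    have hex : ∃ k : ℕ, ua up 0 ^ k • (Submodule.span UA {w 1}).mkQ v = 0 := by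
      refine ⟨(d - p).toNat + 1, ?_⟩
      rw [← map_smul]
      exact hw.quotient_cell hC (d := d) (by push_cast; omega) (hcell _ _ _ (hup _ d p v hv))
    classical
    obtain ⟨k, hk⟩ : ∃ k, Nat.find hex = k + 1 := by
      refine Nat.exists_eq_succ_of_ne_zero fun h => hne ?_
      have := Nat.find_spec hex
      rwa [h, pow_zero, one_smul] at this
    have h1 := Nat.find_spec hex
    rw [hk, pow_succ', mul_smul] at h1
    refine Nat.find_min hex (m := k) (by omega) ?_
    refine hC.eq_zero_of_up_of_down hw.oriented hi h1 (m := (d + p + k).toNat) ?_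
    rw [← map_smul, ← map_smul, hw.eq_zero_of_mem_low_cell hX (d := d)
      (p := p + k - (d + p + k).toNat) (by omega)
      (X.smul_mem _ (X.smul_mem _ hvX)) (hdown _ _ _ _ (hup _ d p v hv)), map_zero]
  intro v hv
  obtain ⟨t, a, ha, rfl⟩ := hw.exists_components X hv
  refine Submodule.sum_mem _ fun x hx => ?_
  have := key x.1 x.2 (a x) (ha x hx).1 (ha x hx).2
  rwa [Submodule.mkQ_apply, Submodule.Quotient.mk_eq_zero] at this

theorem isSimpleModule_quotient (hi : i ≠ 0) :
    IsSimpleModule UA (M ⧸ Submodule.span UA {w 1}) := by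
  rw [isSimpleModule_iff_isCoatom]
  refine ⟨fun h => hw.w_notMem_span le_rfl (h ▸ Submodule.mem_top : w 0 ∈ _), fun X hX => ?_⟩
  have hex : ∃ p ≤ 0, w p ∈ X := by
    by_contra! h
    exact hX.not_ge (hw.le_span_of_w_notMem hi h)
  obtain ⟨p, hp, hpX⟩ := hex
  have h0 : w 0 ∈ X := hw.up_mem_of_le hp hpX
  rw [eq_top_iff, ← hw.span_eq_top, Submodule.span_le]
  rintro _ ⟨q, rfl⟩
  rcases le_or_gt q 0 with hq | hq
  · exact hw.down_mem_of_le hq (Or.inr le_rfl) h0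
  · exact hw.up_mem_of_le hq.le h0

end IsReducedLadder

/-- Dividing a ladder module by its largest submodule without ground states makes it reduced. -/
theorem IsLadder.isReducedLadder_quotient {M : Type} [AddCommGroup M] [Module ℂ M] [Module UA M]
    [IsScalarTower ℂ UA M] {s : ℤ} {i j c : ℂ} {w : ℤ → M} {up down : H4}
    (hw : IsLadder s i j c w) (ho : IsOriented s up down) (hne : ∀ p, w p ≠ 0)
    (hup : ∀ p, ∃ a : ℂ, a ≠ 0 ∧ ua up 0 • w p = a • w (p + 1))
    (hdown : ∀ p, p ≠ 0 → ∃ b : ℂ, b ≠ 0 ∧ ua down 0 • w (p + 1) = b • w p)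
    (hdown1 : ua down 0 • w 1 = 0) {N : Submodule UA M}
    (hN : N = sSup {N : Submodule UA M |
      ∀ v ∈ N, virasoroL0 v = groundWeight i c • v → v = 0}) :
    IsReducedLadder s up down i j c (fun p => N.mkQ (w p)) where
  toIsLadder := hw.map (Submodule.mkQ_surjective _)
  oriented := ho
  ne_zero p h := by
    rw [Submodule.mkQ_apply, Submodule.Quotient.mk_eq_zero, hN] at h
    exact hne p (hw.eq_zero_of_mem_cells (by simp) (hw.w_mem_cell p) (hw.mem_cells_of_mem_sSup h))
  up_smul p := by
    obtain ⟨a, ha, he⟩ := hup p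
    refine ⟨a, ha, ?_⟩
    rw [← map_smul, he]
    exact (N.mkQ.restrictScalars ℂ).map_smul _ _
  down_smul p hp := by
    obtain ⟨a, ha, he⟩ := hdown p hp
    refine ⟨a, ha, ?_⟩
    rw [← map_smul, he]
    exact (N.mkQ.restrictScalars ℂ).map_smul _ _
  down_smul_one := by rw [← map_smul, hdown1, map_zero]
  exists_mem X hX := by
    by_contra! h
    refine hX ?_
    have hle : X.comap N.mkQ ≤ N := by
      refine (le_sSup ?_).trans hN.ge
      intro v hv hg
      have h1 : v ∈ hw.cells {x | 1 ≤ x.1} :=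
        hw.mem_cells_of_ground_notMem (X := X.comap N.mkQ) (fun p hp => absurd hp (h p)) hv
      refine Submodule.disjoint_def.1 (hw.disjoint_cells ?_) v (hw.mem_cells_of_ground hg) h1
      rw [Set.disjoint_left]
      intro x hx hx'
      simp only [Set.mem_ofPred_eq] at hx hx'
      omega
    rw [← Submodule.map_comap_eq_of_surjective (Submodule.mkQ_surjective N) X, eq_bot_iff,
      Submodule.map_le_iff_le_comap]
    refine hle.trans ?_
    rw [← LinearMap.ker, Submodule.ker_mkQ]

/-! ### Modules generated by one ground state -/

section Rung

variable {M : Type} [AddCommGroup M] [Module ℂ M] [Module UA M] [IsScalarTower ℂ UA M]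
  {s : ℤ} {i j c : ℂ} {up down : H4}

/-- A ground state with eigenvalues `i` of `I_0`, `j + s p` of `J_0` and `c` of the Casimir
element. -/
structure IsRung (s : ℤ) (i j c : ℂ) (p : ℤ) (x : M) : Prop where
  pos : ∀ A n, 0 < n → ua A n • x = 0
  I_smul : ua H4.I 0 • x = i • x
  J_smul : ua H4.J 0 • x = (j + s * p) • x
  casimir : ua H4.F 0 • ua H4.E 0 • x + ua H4.I 0 • ua H4.J 0 • x = c • x

theorem pos_zero_mode (hM : IsLevelOne M) {x : M} (hx : ∀ A n, 0 < n → ua A n • x = 0) (B A : H4)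
    (n : ℤ) (hn : 0 < n) : ua A n • ua B 0 • x = 0 := by
  rw [ua_smul_comm hM, hx A n hn, hx _ _ (by omega), if_neg (by omega)]
  simp

theorem casimir_smul_comm (hM : IsLevelOne M) (ho : IsOriented s up down) (x : M) :
    (ua H4.F 0 • ua H4.E 0 • ua up 0 • x + ua H4.I 0 • ua H4.J 0 • ua up 0 • x =
      ua up 0 • (ua H4.F 0 • ua H4.E 0 • x + ua H4.I 0 • ua H4.J 0 • x)) ∧
    (ua H4.F 0 • ua H4.E 0 • ua down 0 • x + ua H4.I 0 • ua H4.J 0 • ua down 0 • x =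
      ua down 0 • (ua H4.F 0 • ua H4.E 0 • x + ua H4.I 0 • ua H4.J 0 • x)) := by
  have hE : ua H4.F 0 • ua H4.E 0 • ua H4.E 0 • x + ua H4.I 0 • ua H4.J 0 • ua H4.E 0 • x =
      ua H4.E 0 • (ua H4.F 0 • ua H4.E 0 • x + ua H4.I 0 • ua H4.J 0 • x) := by
    rw [quadratic_smul_comm hM H4.F, quadratic_smul_comm hM H4.I]
    simp only [quadComm, H4.lie_F_E, H4.lie_E_E, H4.lie_I, H4.lie_J_E, ua_neg_smul, ua_zero_smul,
      smul_zero, Int.cast_zero, zero_mul, ite_self, zero_smul, add_zero, zero_add, smul_add]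
    abel
  have hF : ua H4.F 0 • ua H4.E 0 • ua H4.F 0 • x + ua H4.I 0 • ua H4.J 0 • ua H4.F 0 • x =
      ua H4.F 0 • (ua H4.F 0 • ua H4.E 0 • x + ua H4.I 0 • ua H4.J 0 • x) := by
    rw [quadratic_smul_comm hM H4.F, quadratic_smul_comm hM H4.I]
    simp only [quadComm, H4.lie_F_F, H4.lie_E_F, H4.lie_I, H4.lie_J_F, ua_neg_smul, ua_zero_smul,
      Int.cast_zero, zero_mul, ite_self, zero_smul, add_zero, zero_add, smul_add, smul_neg]
    rw [I_smul_comm hM H4.form_I_F]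
    abel
  rcases ho with ⟨-, rfl, rfl⟩ | ⟨-, rfl, rfl⟩
  · exact ⟨hE, hF⟩
  · exact ⟨hF, hE⟩

/-- The eigenvalue of `down_0 up_0` on a ground state of index `p`. -/
def rungValue (s : ℤ) (i j c : ℂ) (p : ℤ) : ℂ := c - i * (j + s * p) + (1 - s) / 2 * i

namespace IsRung

variable {p : ℤ} {x : M}

theorem I_smul_zero_mode (hM : IsLevelOne M) (hx : IsRung s i j c p x) (A : H4) :
    ua H4.I 0 • ua A 0 • x = i • ua A 0 • x := by
  rw [ua_smul_comm hM, H4.lie_I, ua_zero_smul, hx.I_smul, smul_comm]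
  simp

theorem isRung_up (hM : IsLevelOne M) (ho : IsOriented s up down) (hx : IsRung s i j c p x) :
    IsRung s i j c (p + 1) (ua up 0 • x) where
  pos := pos_zero_mode hM hx.pos up
  I_smul := hx.I_smul_zero_mode hM up
  J_smul := by
    rw [ua_smul_comm hM, ho.lie_J_up, ua_smul_smul, hx.J_smul, smul_comm, add_zero]
    simp only [Int.cast_zero, zero_mul, ite_self, zero_smul, add_zero, ← add_smul]
    congr 1; push_cast; ring
  casimir := by
    rw [(casimir_smul_comm hM ho x).1, hx.casimir, smul_comm]

theorem isRung_down (hM : IsLevelOne M) (ho : IsOriented s up down) (hx : IsRung s i j c p x) :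
    IsRung s i j c (p - 1) (ua down 0 • x) where
  pos := pos_zero_mode hM hx.pos down
  I_smul := hx.I_smul_zero_mode hM down
  J_smul := by
    rw [ua_smul_comm hM, ho.lie_J_down, ua_smul_smul, hx.J_smul, smul_comm, add_zero]
    simp only [Int.cast_zero, zero_mul, ite_self, zero_smul, add_zero, ← add_smul]
    congr 1; push_cast; ring
  casimir := by
    rw [(casimir_smul_comm hM ho x).2, hx.casimir, smul_comm]

theorem down_up (hM : IsLevelOne M) (ho : IsOriented s up down) (hx : IsRung s i j c p x) :
    ua down 0 • ua up 0 • x = rungValue s i j c p • x := by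
  have h1 : ua H4.F 0 • ua H4.E 0 • x = (c - i * (j + s * p)) • x := by
    have := hx.casimir
    rw [hx.J_smul, smul_comm (ua H4.I 0) (_ : ℂ), hx.I_smul] at this
    rw [eq_sub_of_add_eq this]
    module
  rcases ho with ⟨rfl, rfl, rfl⟩ | ⟨rfl, rfl, rfl⟩
  · rw [h1, rungValue]; congr 1; push_cast; ring
  · rw [ua_smul_comm hM, h1, H4.lie_E_F, add_zero, hx.I_smul, rungValue]
    simp only [Int.cast_zero, zero_mul, ite_self, zero_smul, add_zero, ← add_smul]
    congr 1; push_cast; ring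

theorem up_down (hM : IsLevelOne M) (ho : IsOriented s up down) (hx : IsRung s i j c p x) :
    ua up 0 • ua down 0 • x = rungValue s i j c (p - 1) • x := by
  rw [ua_smul_comm hM, hx.down_up hM ho, ho.lie_up_down, ua_smul_smul, add_zero, hx.I_smul,
    smul_smul]
  simp only [Int.cast_zero, zero_mul, ite_self, zero_smul, add_zero, ← add_smul, rungValue]
  congr 1; push_cast; ring

end IsRung

/-- The ladder through the vector `v`, which has index `q`: powers of `up_0` and of `down_0` applied
to `v`. -/
def rungs (up down : H4) (q : ℤ) (v : M) (p : ℤ) : M :=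
  if q ≤ p then ua up 0 ^ (p - q).toNat • v else ua down 0 ^ (q - p).toNat • v

variable {q : ℤ} {v : M}

omit [Module ℂ M] [IsScalarTower ℂ UA M] in
theorem rungs_self (up down : H4) : rungs up down q v q = v := by
  simp [rungs]

omit [Module ℂ M] [IsScalarTower ℂ UA M] in
theorem rungs_up {p : ℤ} (h : q ≤ p) :
    rungs up down q v (p + 1) = ua up 0 • rungs up down q v p := by
  rw [rungs, rungs, if_pos h, if_pos (by omega),
    show (p + 1 - q).toNat = (p - q).toNat + 1 by omega, pow_succ', mul_smul]

omit [Module ℂ M] [IsScalarTower ℂ UA M] in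
theorem rungs_down {p : ℤ} (h : p < q) :
    rungs up down q v p = ua down 0 • rungs up down q v (p + 1) := by
  rcases (show p + 1 < q ∨ p + 1 = q by omega) with h' | h'
  · rw [rungs, rungs, if_neg (by omega), if_neg (by omega),
      show (q - p).toNat = (q - (p + 1)).toNat + 1 by omega, pow_succ', mul_smul]
  · rw [h', rungs_self, rungs, if_neg (by omega), show (q - p).toNat = 1 by omega, pow_one]

theorem isRung_rungs (hM : IsLevelOne M) (ho : IsOriented s up down) (hv : IsRung s i j c q v)
    (p : ℤ) : IsRung s i j c p (rungs up down q v p) := by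
  induction p using Int.inductionOn' (b := q) with
  | zero => rw [rungs_self]; exact hv
  | succ p hp ih => rw [rungs_up hp]; exact ih.isRung_up hM ho
  | pred p hp ih =>
    rw [rungs_down (by omega), sub_add_cancel]
    exact ih.isRung_down hM ho

theorem up_smul_rungs (hM : IsLevelOne M) (ho : IsOriented s up down) (hv : IsRung s i j c q v)
    (p : ℤ) : ua up 0 • rungs up down q v p =
      (if q ≤ p then 1 else rungValue s i j c p) • rungs up down q v (p + 1) := by
  split_ifs with h
  · rw [rungs_up h, one_smul]
  · rw [rungs_down (by omega), (isRung_rungs hM ho hv (p + 1)).up_down hM ho, add_sub_cancel_right]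

theorem down_smul_rungs (hM : IsLevelOne M) (ho : IsOriented s up down) (hv : IsRung s i j c q v)
    (p : ℤ) : ua down 0 • rungs up down q v (p + 1) =
      (if q ≤ p then rungValue s i j c p else 1) • rungs up down q v p := by
  split_ifs with h
  · rw [rungs_up h, (isRung_rungs hM ho hv p).down_up hM ho]
  · rw [rungs_down (p := p) (by omega), one_smul]

theorem isLadder_rungs (hM : IsLevelOne M) (ho : IsOriented s up down) (hv : IsRung s i j c q v)
    (hgen : Submodule.span UA {v} = ⊤) : IsLadder s i j c (rungs up down q v) where
  sign_sq := ho.sign_sq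
  K_smul p := hM _
  pos A n p hn := (isRung_rungs hM ho hv p).pos A n hn
  I_smul p := (isRung_rungs hM ho hv p).I_smul
  J_smul p := (isRung_rungs hM ho hv p).J_smul
  casimir p := (isRung_rungs hM ho hv p).casimir
  span_eq_top := by
    rw [eq_top_iff, ← hgen, Submodule.span_le, Set.singleton_subset_iff]
    exact Submodule.subset_span ⟨q, rungs_self up down⟩
  E_smul p := by
    have hu : ∀ p, ua up 0 • rungs up down q v p ∈
        Submodule.span ℂ (Set.range (rungs up down q v)) := fun p => by
      rw [up_smul_rungs hM ho hv]; exact Submodule.smul_mem _ _ (Submodule.subset_span ⟨_, rfl⟩)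
    have hd : ua down 0 • rungs up down q v p ∈
        Submodule.span ℂ (Set.range (rungs up down q v)) := by
      rw [← sub_add_cancel p 1, down_smul_rungs hM ho hv]
      exact Submodule.smul_mem _ _ (Submodule.subset_span ⟨_, rfl⟩)
    rcases ho with ⟨-, rfl, rfl⟩ | ⟨-, rfl, rfl⟩
    exacts [hu p, hd]
  F_smul p := by
    have hu : ∀ p, ua up 0 • rungs up down q v p ∈
        Submodule.span ℂ (Set.range (rungs up down q v)) := fun p => by
      rw [up_smul_rungs hM ho hv]; exact Submodule.smul_mem _ _ (Submodule.subset_span ⟨_, rfl⟩)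
    have hd : ua down 0 • rungs up down q v p ∈
        Submodule.span ℂ (Set.range (rungs up down q v)) := by
      rw [← sub_add_cancel p 1, down_smul_rungs hM ho hv]
      exact Submodule.smul_mem _ _ (Submodule.subset_span ⟨_, rfl⟩)
    rcases ho with ⟨-, rfl, rfl⟩ | ⟨-, rfl, rfl⟩
    exacts [hd, hu p]

end Rung

/-! ### Induced modules -/

section ZeroModes

attribute [local instance] LieRing.ofAssociativeRing

/-- The zero modes as a copy of the enveloping algebra of `H4`. -/
def zeroModes : U4 →ₐ[ℂ] UA :=
  UniversalEnvelopingAlgebra.lift ℂ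
    { toFun := fun A => ua A 0
      map_add' := fun A B => ua_add A B 0
      map_smul' := fun c A => ua_smul c A 0
      map_lie' := fun {A B} => by
        rw [Ring.lie_def, ua_mul]
        simp }

theorem zeroModes_u4 (A : H4) : zeroModes (u4 A) = ua A 0 :=
  UniversalEnvelopingAlgebra.lift_ι_apply' ℂ _ A

end ZeroModes

/-- The inclusion of `W` into the induced module. -/
def Induced.ofGround (W : Type) [AddCommGroup W] [Module ℂ W] [Module U4 W] :
    W →ₗ[ℂ] Induced W :=
  ((inducedRelations W).mkQ.restrictScalars ℂ).comp (TensorProduct.mk ℂ UA W 1)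

section

variable {W : Type} [AddCommGroup W] [Module ℂ W] [Module U4 W]

theorem Induced.mk_tmul (u : UA) (x : W) :
    (inducedRelations W).mkQ (u ⊗ₜ[ℂ] x) = u • Induced.ofGround W x := by
  change _ = u • (inducedRelations W).mkQ (1 ⊗ₜ[ℂ] x)
  rw [← map_smul, TensorProduct.smul_tmul', smul_eq_mul, mul_one]

theorem Induced.uK_smul (x : W) : uK • Induced.ofGround W x = Induced.ofGround W x := by
  rw [← Induced.mk_tmul]
  refine (Submodule.Quotient.eq _).2 (Submodule.subset_span (Or.inr ⟨x, rfl⟩))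

theorem Induced.pos_smul {A : H4} {n : ℤ} (hn : 0 < n) (x : W) :
    ua A n • Induced.ofGround W x = 0 := by
  rw [← Induced.mk_tmul]
  exact (Submodule.Quotient.mk_eq_zero _).2
    (Submodule.subset_span (Or.inl (Or.inr ⟨A, n, x, hn, rfl⟩)))

theorem Induced.zero_smul (A : H4) (x : W) :
    ua A 0 • Induced.ofGround W x = Induced.ofGround W (u4 A • x) := by
  rw [← Induced.mk_tmul]
  exact (Submodule.Quotient.eq _).2 (Submodule.subset_span (Or.inl (Or.inl ⟨A, x, rfl⟩)))

theorem Induced.zeroModes_smul [IsScalarTower ℂ U4 W] (u : U4) : ∀ x : W,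
    zeroModes u • Induced.ofGround W x = Induced.ofGround W (u • x) := by
  induction u using U4.induction with
  | hm A => intro x; rw [zeroModes_u4, Induced.zero_smul]
  | halg c => intro x; rw [AlgHom.commutes, algebraMap_smul, algebraMap_smul, map_smul]
  | hadd a b ha hb => intro x; rw [map_add, add_smul, add_smul, map_add, ha, hb]
  | hmul a b ha hb => intro x; rw [map_mul, mul_smul, mul_smul, hb, ha]

theorem Induced.span_range : Submodule.span UA (Set.range (Induced.ofGround W)) = ⊤ := by
  rw [eq_top_iff]
  rintro y -
  obtain ⟨y, rfl⟩ := Submodule.mkQ_surjective (inducedRelations W) y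
  induction y using TensorProduct.induction_on with
  | zero => rw [map_zero]; exact Submodule.zero_mem _
  | add a b ha hb => rw [map_add]; exact Submodule.add_mem _ ha hb
  | tmul u x =>
    rw [Induced.mk_tmul]
    exact Submodule.smul_mem _ _ (Submodule.subset_span ⟨x, rfl⟩)

theorem Induced.isLevelOne : IsLevelOne (Induced W) :=
  isLevelOne_of_span_eq_top (Set.forall_mem_range.2 Induced.uK_smul) Induced.span_range

end

section Cyclic

variable (S : Set U4)

/-- The class of an element of the enveloping algebra in a cyclic module. -/
def CyclicModule.mk : U4 →ₗ[U4] CyclicModule S := (Submodule.span U4 S).mkQ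

theorem CyclicModule.mk_surjective : Function.Surjective (CyclicModule.mk S) :=
  Submodule.mkQ_surjective _

theorem CyclicModule.mk_eq_zero {x : U4} (hx : x ∈ S) : CyclicModule.mk S x = 0 :=
  (Submodule.Quotient.mk_eq_zero _).2 (Submodule.subset_span hx)

/-- The generator of the module induced from a cyclic `H4`-module. -/
def gen : Induced (CyclicModule S) :=
  Induced.ofGround (CyclicModule S) (CyclicModule.mk S 1)

theorem zeroModes_smul_gen (u : U4) :
    zeroModes u • gen S = Induced.ofGround (CyclicModule S) (CyclicModule.mk S u) := by
  rw [gen, Induced.zeroModes_smul, ← map_smul, smul_eq_mul, mul_one]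

theorem zeroModes_smul_gen_eq_zero {x : U4} (hx : x ∈ S) : zeroModes x • gen S = 0 := by
  rw [zeroModes_smul_gen, CyclicModule.mk_eq_zero S hx, map_zero]

theorem pos_smul_gen (A : H4) (n : ℤ) (hn : 0 < n) : ua A n • gen S = 0 := Induced.pos_smul hn _

theorem span_gen : Submodule.span UA {gen S} = ⊤ := by
  rw [eq_top_iff, ← Induced.span_range, Submodule.span_le]
  rintro _ ⟨x, rfl⟩
  obtain ⟨u, rfl⟩ := CyclicModule.mk_surjective S x
  have := zeroModes_smul_gen S u
  exact this ▸ Submodule.smul_mem _ _ (Submodule.mem_span_singleton_self _)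

/-- The universal property of the induced cyclic module. -/
theorem exists_lift {M : Type} [AddCommGroup M] [Module ℂ M] [Module UA M] [IsScalarTower ℂ UA M]
    (hM : IsLevelOne M) {m : M} (hpos : ∀ A n, 0 < n → ua A n • m = 0)
    (hS : ∀ x ∈ S, zeroModes x • m = 0) :
    ∃ φ : Induced (CyclicModule S) →ₗ[UA] M, φ (gen S) = m := by
  let f₀ : U4 →ₛₗ[(zeroModes : U4 →+* UA)] M :=
    { toFun := fun u => zeroModes u • m
      map_add' := fun a b => by rw [map_add, add_smul]
      map_smul' := fun a b => by rw [smul_eq_mul, map_mul, mul_smul]; rfl }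
  let f₁ : CyclicModule S →ₛₗ[(zeroModes : U4 →+* UA)] M :=
    (Submodule.span U4 S).liftQ f₀ (Submodule.span_le.2 hS)
  have hf₁ : ∀ u, f₁ (CyclicModule.mk S u) = zeroModes u • m := fun u =>
    Submodule.liftQ_apply _ _ _
  let f : CyclicModule S →ₗ[ℂ] M :=
    { toFun := f₁
      map_add' := map_add f₁
      map_smul' := fun c x => by
        rw [← algebraMap_smul U4 c x]
        refine (f₁.map_smulₛₗ _ _).trans ?_
        simp }
  have hf : ∀ u, f (CyclicModule.mk S u) = zeroModes u • m := hf₁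
  let g : UA ⊗[ℂ] CyclicModule S →ₗ[UA] M :=
    TensorProduct.AlgebraTensorModule.lift (LinearMap.toSpanSingleton UA _ f)
  have hg : ∀ u x, g (u ⊗ₜ[ℂ] x) = u • f x := fun u x => rfl
  have hker : inducedRelations (CyclicModule S) ≤ LinearMap.ker g := by
    refine Submodule.span_le.2 ?_
    rintro _ ((⟨A, x, rfl⟩ | ⟨A, n, x, hn, rfl⟩) | ⟨x, rfl⟩) <;>
      obtain ⟨u, rfl⟩ := CyclicModule.mk_surjective S x <;>
      rw [SetLike.mem_coe, LinearMap.mem_ker]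
    · rw [map_sub, hg, hg, hf, one_smul]
      rw [← map_smul, smul_eq_mul, hf, map_mul, mul_smul, zeroModes_u4, sub_self]
    · rw [hg, hf]
      have key : ∀ u : U4, ∀ x : M, (∀ A n, 0 < n → ua A n • x = 0) →
          ∀ A n, 0 < n → ua A n • zeroModes u • x = 0 := by
        intro u
        induction u using U4.induction with
        | hm B => intro x hx; rw [zeroModes_u4]; exact pos_zero_mode hM hx B
        | halg c =>
          intro x hx A n hn
          rw [AlgHom.commutes, algebraMap_smul, smul_comm, hx A n hn, smul_zero]
        | hadd a b ha hb =>
          intro x hx A n hn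
          rw [map_add, add_smul, smul_add, ha x hx A n hn, hb x hx A n hn, add_zero]
        | hmul a b ha hb =>
          intro x hx A n hn
          rw [map_mul, mul_smul]
          exact ha _ (hb x hx) A n hn
      exact key u m hpos A n hn
    · rw [map_sub, hg, hg, hM, one_smul, sub_self]
  refine ⟨(inducedRelations (CyclicModule S)).liftQ g hker, ?_⟩
  have h1 : g (1 ⊗ₜ[ℂ] CyclicModule.mk S 1) = m := by
    rw [hg, one_smul, hf, map_one, one_smul]
  exact h1

theorem isRung_gen {S : Set U4} {s : ℤ} {i j c : ℂ} {p : ℤ}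
    (hI : u4 H4.I - algebraMap ℂ U4 i ∈ S) (hJ : u4 H4.J - algebraMap ℂ U4 (j + s * p) ∈ S)
    (hc : zeroModes (u4 H4.F * u4 H4.E) • gen S + zeroModes (u4 H4.I * u4 H4.J) • gen S =
      c • gen S) :
    IsRung s i j c p (gen S) where
  pos := pos_smul_gen S
  I_smul := by
    have := zeroModes_smul_gen_eq_zero S hI
    rwa [map_sub, sub_smul, zeroModes_u4, AlgHom.commutes, algebraMap_smul, sub_eq_zero] at this
  J_smul := by
    have := zeroModes_smul_gen_eq_zero S hJ
    rwa [map_sub, sub_smul, zeroModes_u4, AlgHom.commutes, algebraMap_smul, sub_eq_zero] at this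
  casimir := by
    simpa only [map_mul, mul_smul, zeroModes_u4] using hc

/-- A simple module that contains a vector with the relations of the generator of a Verma module is
its irreducible quotient. -/
theorem nonempty_irr_equiv {S : Set U4} {s : ℤ} {up down : H4} (ho : IsOriented s up down)
    {i j c : ℂ} {q : ℤ} (hgen : IsRung s i j c q (gen S)) {C : Type} [AddCommGroup C] [Module ℂ C]
    [Module UA C] [IsScalarTower ℂ UA C] [IsSimpleModule UA C] (hC : IsLevelOne C) {m : C}
    (hm : m ≠ 0) (hpos : ∀ A n, 0 < n → ua A n • m = 0) (hS : ∀ x ∈ S, zeroModes x • m = 0) :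
    Nonempty ((Induced (CyclicModule S) ⧸ maxSubmodule (Induced (CyclicModule S))) ≃ₗ[UA] C) := by
  obtain ⟨φ, hφ⟩ := exists_lift S hC hpos hS
  have hsurj : Function.Surjective φ := by
    refine (LinearMap.surjective_or_eq_zero φ).resolve_right fun h => hm ?_
    rw [← hφ, h, LinearMap.zero_apply]
  have hL := isLadder_rungs Induced.isLevelOne ho hgen (span_gen S)
  have hne : maxSubmodule (Induced (CyclicModule S)) ≠ ⊤ := by
    refine hL.maxSubmodule_ne_top (q := q) ?_ ?_
    · rw [rungs_self]
      intro h
      rw [h, map_zero] at hφ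
      exact hm hφ.symm
    · rw [rungs_self]; exact span_gen S
  have hco : IsCoatom (LinearMap.ker φ) := by
    rw [← isSimpleModule_iff_isCoatom]
    exact IsSimpleModule.congr (φ.quotKerEquivOfSurjective hsurj)
  have hle : LinearMap.ker φ ≤ maxSubmodule (Induced (CyclicModule S)) := le_sSup hco.1
  have heq : maxSubmodule (Induced (CyclicModule S)) = LinearMap.ker φ :=
    (hco.le_iff.1 hle).resolve_left hne
  exact ⟨(Submodule.quotEquivOfEq _ _ heq).trans (φ.quotKerEquivOfSurjective hsurj)⟩

end Cyclic

/-! ### Free field realisation -/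

/-- Modes of free fields on a space `V`: a pair `b`, `g` of Weyl fields and a pair `a`, `q` of
Heisenberg fields, such that every vector is annihilated by all but finitely many of the `b n` and
`g (-n)` with `n > 0`, and likewise of the `a n` and `q n`. -/
structure FreeFields (V : Type) [AddCommGroup V] [Module ℂ V] where
  b : ℤ → Module.End ℂ V
  g : ℤ → Module.End ℂ V
  a : ℤ → Module.End ℂ V
  q : ℤ → Module.End ℂ V
  b_b : ∀ m n v, b m (b n v) = b n (b m v)
  g_g : ∀ m n v, g m (g n v) = g n (g m v)
  b_g : ∀ m n v, b m (g n v) = g n (b m v) + (if m = n then (1 : ℂ) else 0) • v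
  a_a : ∀ m n v, a m (a n v) = a n (a m v)
  q_q : ∀ m n v, q m (q n v) = q n (q m v)
  a_q : ∀ m n v, a m (q n v) = q n (a m v) + (if m + n = 0 then (m : ℂ) else 0) • v
  a_b : ∀ m n v, a m (b n v) = b n (a m v)
  a_g : ∀ m n v, a m (g n v) = g n (a m v)
  q_b : ∀ m n v, q m (b n v) = b n (q m v)
  q_g : ∀ m n v, q m (g n v) = g n (q m v)
  smooth : ∀ v, ∃ N : ℕ, ∀ n : ℤ, N ≤ n → b n v = 0 ∧ g (-n) v = 0 ∧ a n v = 0 ∧ q n v = 0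

section LocalSum

variable {V : Type} [AddCommGroup V] [Module ℂ V]

/-- A family of operators is locally finite if only finitely many of them act nontrivially on each
vector. -/
def LocallyFiniteOps (T : ℤ → Module.End ℂ V) : Prop :=
  ∀ v, (Function.support fun l => T l v).Finite

/-- The sum of a locally finite family of operators. -/
def localSum (T : ℤ → Module.End ℂ V) (hT : LocallyFiniteOps T) : Module.End ℂ V where
  toFun v := ∑ᶠ l, T l v
  map_add' v w := by simp only [map_add]; exact finsum_add_distrib (hT v) (hT w)
  map_smul' r v := by simp only [map_smul]; exact (smul_finsum' r (hT v)).symm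

theorem localSum_apply {T : ℤ → Module.End ℂ V} (hT : LocallyFiniteOps T) (v : V) :
    localSum T hT v = ∑ᶠ l, T l v := rfl

theorem localSum_comm {T : ℤ → Module.End ℂ V} (hT : LocallyFiniteOps T) (A : Module.End ℂ V)
    {R : ℤ → V} {v : V} (h : ∀ l, T l (A v) = A (T l v) + R l) :
    localSum T hT (A v) = A (localSum T hT v) + ∑ᶠ l, R l := by
  have hA : (Function.support fun l => A (T l v)).Finite :=
    (hT v).subset fun l hl (h0 : T l v = 0) => hl (by
      change A (T l v) = 0
      rw [h0, map_zero])
  have hR : (Function.support R).Finite := by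
    refine ((hT (A v)).union hA).subset fun l hl => ?_
    by_contra hn
    simp only [Set.mem_union, Function.mem_support, not_or, not_not] at hn
    have := h l
    rw [hn.1, hn.2, zero_add] at this
    exact hl this.symm
  rw [localSum_apply, localSum_apply, map_finsum A (hT v), ← finsum_add_distrib hA hR]
  exact finsum_congr h

omit [Module ℂ V] in
theorem finite_support_of_bounds {f : ℤ → V} (N : ℕ) (h1 : ∀ l, (N : ℤ) ≤ l → f l = 0)
    (h2 : ∀ l, l ≤ -(N : ℤ) → f l = 0) : (Function.support f).Finite := by
  refine (Set.finite_Icc (-(N : ℤ)) N).subset fun l hl => ?_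
  by_contra hn
  rw [Set.mem_Icc, not_and_or] at hn
  rcases hn with hn | hn
  · exact hl (h2 l (by omega))
  · exact hl (h1 l (by omega))

theorem finsum_ite_eq_smul (f : ℤ → V) (m : ℤ) (P : ℤ → Prop) [DecidablePred P] (r : ℂ)
    (hP : ∀ l, P l ↔ l = m) : ∑ᶠ l, (if P l then r else 0) • f l = r • f m := by
  rw [finsum_eq_single _ m fun l hl => by rw [if_neg fun h => hl ((hP l).1 h), zero_smul],
    if_pos ((hP m).2 rfl)]

end LocalSum

namespace FreeFields

variable {V : Type} [AddCommGroup V] [Module ℂ V] (φ : FreeFields V)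

theorem g_b (m n : ℤ) (v : V) :
    φ.g m (φ.b n v) = φ.b n (φ.g m v) + -((if n = m then (1 : ℂ) else 0) • v) := by
  rw [φ.b_g]; abel

theorem q_a (m n : ℤ) (v : V) :
    φ.q m (φ.a n v) = φ.a n (φ.q m v) + (if m + n = 0 then (m : ℂ) else 0) • v := by
  rw [φ.a_q, add_comm n m, add_assoc, ← add_smul]
  split_ifs with h
  · have : (n : ℂ) + m = 0 := by rw [add_comm]; exact_mod_cast h
    rw [this, zero_smul, add_zero]
  · rw [add_zero, zero_smul, add_zero]

theorem locallyFinite_ag (n : ℤ) : LocallyFiniteOps fun l => φ.a (n + l) * φ.g l := by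
  intro v
  obtain ⟨N, hN⟩ := φ.smooth v
  refine finite_support_of_bounds (N + n.natAbs) (fun l hl => ?_) (fun l hl => ?_)
  · rw [Module.End.mul_apply, φ.a_g, (hN (n + l) (by omega)).2.2.1, map_zero]
  · have := (hN (-l) (by omega)).2.1
    rw [neg_neg] at this
    rw [Module.End.mul_apply, this, map_zero]

/-- The normally ordered product of `b m` and `g l`. -/
def normalOrd (l m k : ℤ) : Module.End ℂ V :=
  if 0 ≤ l then φ.g k * φ.b m else φ.b m * φ.g k

theorem locallyFinite_normalOrd (m n k : ℤ) :
    LocallyFiniteOps fun l => φ.normalOrd (l + k) (l + n) (l + m) := by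
  intro v
  obtain ⟨N, hN⟩ := φ.smooth v
  refine finite_support_of_bounds (N + n.natAbs + m.natAbs + k.natAbs + 1) (fun l hl => ?_)
    (fun l hl => ?_)
  · simp only [normalOrd]
    rw [if_pos (by omega), Module.End.mul_apply, (hN (l + n) (by omega)).1, map_zero]
  · have := (hN (-(l + m)) (by omega)).2.1
    rw [neg_neg] at this
    simp only [normalOrd]
    rw [if_neg (by omega), Module.End.mul_apply, this, map_zero]

theorem locallyFinite_number (n : ℤ) :
    LocallyFiniteOps fun l => φ.normalOrd l (l + n) l := by
  simpa only [add_zero] using φ.locallyFinite_normalOrd 0 n 0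

/-- The operator by which `F ⊗ t^n` acts. -/
def opF (n : ℤ) : Module.End ℂ V :=
  localSum _ (φ.locallyFinite_ag n) - (n : ℂ) • φ.g (-n)

/-- The modes of the charge current `- :b g:`. -/
def opN (n : ℤ) : Module.End ℂ V := -localSum _ (φ.locallyFinite_number n)

/-- The operator by which `J ⊗ t^n` acts.  The summand `a n / 2` cancels the central term in the
commutators of the charge current with itself. -/
def opJ (n : ℤ) : Module.End ℂ V := φ.opN n + φ.q n + (1 / 2 : ℂ) • φ.a n

theorem opF_apply (n : ℤ) (v : V) :
    φ.opF n v = localSum _ (φ.locallyFinite_ag n) v - (n : ℂ) • φ.g (-n) v := rfl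

theorem opN_apply (n : ℤ) (v : V) :
    φ.opN n v = -localSum _ (φ.locallyFinite_number n) v := rfl

theorem opJ_apply (n : ℤ) (v : V) :
    φ.opJ n v = φ.opN n v + φ.q n v + (1 / 2 : ℂ) • φ.a n v := rfl

theorem opF_a (n m : ℤ) (v : V) : φ.opF n (φ.a m v) = φ.a m (φ.opF n v) := by
  have h : ∀ l, (φ.a (n + l) * φ.g l) (φ.a m v) = φ.a m ((φ.a (n + l) * φ.g l) v) + 0 := by
    intro l
    rw [Module.End.mul_apply, Module.End.mul_apply, ← φ.a_g, φ.a_a, add_zero]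
  rw [opF_apply, localSum_comm _ _ h, finsum_zero, add_zero, ← φ.a_g, opF_apply, map_sub, map_smul]

theorem opF_g (n m : ℤ) (v : V) : φ.opF n (φ.g m v) = φ.g m (φ.opF n v) := by
  have h : ∀ l, (φ.a (n + l) * φ.g l) (φ.g m v) = φ.g m ((φ.a (n + l) * φ.g l) v) + 0 := by
    intro l
    rw [Module.End.mul_apply, Module.End.mul_apply, φ.g_g, φ.a_g, add_zero]
  rw [opF_apply, localSum_comm _ _ h, finsum_zero, add_zero, φ.g_g, opF_apply, map_sub, map_smul]

theorem opF_b (n m : ℤ) (v : V) :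
    φ.opF n (φ.b m v) =
      φ.b m (φ.opF n v) - (φ.a (m + n) v + (if m + n = 0 then (m : ℂ) else 0) • v) := by
  have h : ∀ l, (φ.a (n + l) * φ.g l) (φ.b m v) = φ.b m ((φ.a (n + l) * φ.g l) v) +
      (if m = l then (1 : ℂ) else 0) • (-φ.a (n + l) v) := by
    intro l
    rw [Module.End.mul_apply, Module.End.mul_apply, φ.g_b, map_add, φ.a_b, map_neg, map_smul,
      smul_neg]
  rw [opF_apply, localSum_comm _ _ h, finsum_ite_eq_smul _ m _ 1 fun l => eq_comm, one_smul,
    φ.g_b, opF_apply, map_sub, map_smul, add_comm n m]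
  by_cases hmn : m + n = 0
  · obtain rfl : m = -n := by omega
    simp only [if_true, neg_add_cancel, one_smul, smul_add, smul_neg, Int.cast_neg, neg_smul]
    abel
  · rw [if_neg (show ¬ m = -n by omega), if_neg hmn]
    simp only [zero_smul, neg_zero, add_zero]
    abel

theorem opF_q (n m : ℤ) (v : V) :
    φ.opF n (φ.q m v) = φ.q m (φ.opF n v) - (m : ℂ) • φ.g (-(m + n)) v := by
  have h : ∀ l, (φ.a (n + l) * φ.g l) (φ.q m v) = φ.q m ((φ.a (n + l) * φ.g l) v) +
      (if n + l + m = 0 then (1 : ℂ) else 0) • (((n + l : ℤ) : ℂ) • φ.g l v) := by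
    intro l
    rw [Module.End.mul_apply, Module.End.mul_apply, ← φ.q_g, φ.a_q, smul_smul]
    split_ifs <;> simp
  rw [opF_apply, localSum_comm _ _ h,
    finsum_ite_eq_smul (fun l => ((n + l : ℤ) : ℂ) • φ.g l v) (-(m + n)) _ 1
      (fun l => by constructor <;> intro h <;> omega), one_smul, ← φ.q_g, opF_apply, map_sub,
    map_smul, show n + -(m + n) = -m by ring, Int.cast_neg, neg_smul]
  abel

theorem opF_opF (n m : ℤ) (v : V) : φ.opF n (φ.opF m v) = φ.opF m (φ.opF n v) := by
  have h : ∀ l, (φ.a (m + l) * φ.g l) (φ.opF n v) =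
      φ.opF n ((φ.a (m + l) * φ.g l) v) + 0 := by
    intro l
    rw [Module.End.mul_apply, Module.End.mul_apply, opF_a, opF_g, add_zero]
  rw [φ.opF_apply m (φ.opF n v), localSum_comm _ _ h, finsum_zero, add_zero, φ.opF_apply m v,
    map_sub, map_smul, opF_g]

theorem normalOrd_eq (l m k : ℤ) (v : V) :
    φ.normalOrd l m k v =
      φ.g k (φ.b m v) + (if l < 0 ∧ m = k then (1 : ℂ) else 0) • v := by
  unfold normalOrd
  by_cases hl : 0 ≤ l
  · rw [if_pos hl, if_neg (by omega), zero_smul, add_zero, Module.End.mul_apply]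
  · rw [if_neg hl, Module.End.mul_apply, φ.b_g]
    simp only [not_le.1 hl, true_and]

theorem opN_a (n m : ℤ) (v : V) : φ.opN n (φ.a m v) = φ.a m (φ.opN n v) := by
  have h : ∀ l, φ.normalOrd l (l + n) l (φ.a m v) = φ.a m (φ.normalOrd l (l + n) l v) + 0 := by
    intro l
    rw [normalOrd_eq, normalOrd_eq, map_add, map_smul, φ.a_g, φ.a_b, add_zero]
  rw [opN_apply, localSum_comm _ _ h, finsum_zero, add_zero, opN_apply, map_neg]

theorem opN_q (n m : ℤ) (v : V) : φ.opN n (φ.q m v) = φ.q m (φ.opN n v) := by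
  have h : ∀ l, φ.normalOrd l (l + n) l (φ.q m v) = φ.q m (φ.normalOrd l (l + n) l v) + 0 := by
    intro l
    rw [normalOrd_eq, normalOrd_eq, map_add, map_smul, φ.q_g, φ.q_b, add_zero]
  rw [opN_apply, localSum_comm _ _ h, finsum_zero, add_zero, opN_apply, map_neg]

theorem opN_b (n m : ℤ) (v : V) :
    φ.opN n (φ.b m v) = φ.b m (φ.opN n v) + φ.b (m + n) v := by
  have h : ∀ l, φ.normalOrd l (l + n) l (φ.b m v) = φ.b m (φ.normalOrd l (l + n) l v) +
      (if m = l then (1 : ℂ) else 0) • (-φ.b (l + n) v) := by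
    intro l
    rw [normalOrd_eq, normalOrd_eq, map_add, map_smul, φ.b_b (l + n), φ.g_b, smul_neg]
    abel
  rw [opN_apply, localSum_comm _ _ h, finsum_ite_eq_smul _ m _ 1 fun l => eq_comm, one_smul,
    opN_apply, map_neg]
  abel

theorem opN_g (n m : ℤ) (v : V) :
    φ.opN n (φ.g m v) = φ.g m (φ.opN n v) - φ.g (m - n) v := by
  have h : ∀ l, φ.normalOrd l (l + n) l (φ.g m v) = φ.g m (φ.normalOrd l (l + n) l v) +
      (if l + n = m then (1 : ℂ) else 0) • φ.g l v := by
    intro l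
    rw [normalOrd_eq, normalOrd_eq, map_add, map_smul, φ.b_g, map_add, map_smul, φ.g_g l m]
    abel
  rw [opN_apply, localSum_comm _ _ h,
    finsum_ite_eq_smul (fun l => φ.g l v) (m - n) _ 1
      (fun l => by constructor <;> intro h <;> omega), one_smul, opN_apply, map_neg]
  abel

theorem opN_opF (n m : ℤ) (v : V) :
    φ.opF m (φ.opN n v) = φ.opN n (φ.opF m v) +
      (localSum _ (φ.locallyFinite_ag (n + m)) v - (m : ℂ) • φ.g (-(n + m)) v) := by
  have h : ∀ l, (φ.a (m + l) * φ.g l) (φ.opN n v) =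
      φ.opN n ((φ.a (m + l) * φ.g l) v) + φ.a (m + l) (φ.g (l - n) v) := by
    intro l
    rw [Module.End.mul_apply, Module.End.mul_apply, opN_a, opN_g, map_sub, sub_add_cancel]
  have hs : ∑ᶠ l, φ.a (m + l) (φ.g (l - n) v) = localSum _ (φ.locallyFinite_ag (n + m)) v := by
    rw [localSum_apply, ← finsum_comp_equiv (Equiv.addRight n)]
    refine finsum_congr fun l => ?_
    rw [Equiv.coe_addRight, Module.End.mul_apply, add_sub_cancel_right,
      show m + (l + n) = n + m + l by ring]
  rw [opF_apply, localSum_comm _ _ h, hs, opF_apply, map_sub, map_smul, opN_g, smul_sub,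
    show -m - n = -(n + m) by ring]
  abel

/-- The number of integers `l` with `l < 0 ≤ l + m`, minus the number of those with
`l + m < 0 ≤ l`, is `m`. -/
theorem finsum_signs (m : ℤ) :
    ∑ᶠ l : ℤ, ((if l < 0 then (1 : ℂ) else 0) - (if l + m < 0 then 1 else 0)) = m := by
  rcases le_total 0 m with hm | hm
  · rw [finsum_eq_sum_of_support_subset (s := Finset.Ico (-m) 0)]
    · rw [Finset.sum_congr rfl (g := fun _ => (1 : ℂ))]
      · rw [Finset.sum_const, Int.card_Ico, zero_sub, neg_neg, nsmul_eq_mul, mul_one,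
          ← Int.cast_natCast, Int.toNat_of_nonneg hm]
      · intro l hl
        rw [Finset.mem_Ico] at hl
        rw [if_pos (by omega), if_neg (by omega), sub_zero]
    · intro l hl
      rw [Finset.coe_Ico, Set.mem_Ico]
      by_contra hn
      apply hl
      by_cases h : l < 0
      · simp only [if_pos h, if_pos (show l + m < 0 by omega), sub_self]
      · simp only [if_neg h, if_neg (show ¬ l + m < 0 by omega), sub_self]
  · rw [finsum_eq_sum_of_support_subset (s := Finset.Ico 0 (-m))]
    · rw [Finset.sum_congr rfl (g := fun _ => (-1 : ℂ))]
      · rw [Finset.sum_const, Int.card_Ico, sub_zero, nsmul_eq_mul, mul_neg, mul_one,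
          ← Int.cast_natCast, Int.toNat_of_nonneg (by omega), Int.cast_neg, neg_neg]
      · intro l hl
        rw [Finset.mem_Ico] at hl
        rw [if_neg (by omega), if_pos (by omega), zero_sub]
    · intro l hl
      rw [Finset.coe_Ico, Set.mem_Ico]
      by_contra hn
      apply hl
      by_cases h : l < 0
      · simp only [if_pos h, if_pos (show l + m < 0 by omega), sub_self]
      · simp only [if_neg h, if_neg (show ¬ l + m < 0 by omega), sub_self]

theorem finite_signs (m : ℤ) : (Function.support fun l : ℤ =>
    (if l < 0 then (1 : ℂ) else 0) - (if l + m < 0 then 1 else 0)).Finite := by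
  refine finite_support_of_bounds (m.natAbs + 1) (fun l hl => ?_) (fun l hl => ?_)
  · rw [if_neg (by omega), if_neg (by omega), sub_self]
  · rw [if_pos (by omega), if_pos (by omega), sub_self]

/-- The central term arises because shifting the summation index moves the boundary between the
two orderings. -/
theorem opN_opN (n m : ℤ) (v : V) :
    φ.opN m (φ.opN n v) =
      φ.opN n (φ.opN m v) - (if m + n = 0 then (m : ℂ) else 0) • v := by
  have h : ∀ l, φ.normalOrd l (l + n) l (φ.opN m v) = φ.opN m (φ.normalOrd l (l + n) l v) +
      (φ.normalOrd (l + -m) (l + n) (l + -m) v - φ.normalOrd l (l + (m + n)) l v +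
       (if m + n = 0 then (1 : ℂ) else 0) •
        ((if l < 0 then (1 : ℂ) else 0) - (if l + -m < 0 then 1 else 0)) • v) := by
    intro l
    simp only [normalOrd_eq, map_add, map_smul, opN_g, opN_b]
    rw [show l + n + m = l + (m + n) by ring, show l + -m = l - m by ring]
    have e1 : (l + n = l - m) ↔ m + n = 0 := by constructor <;> intro h <;> omega
    have e2 : (l + (m + n) = l) ↔ m + n = 0 := by constructor <;> intro h <;> omega
    simp only [e1, e2]
    by_cases hmn : m + n = 0
    · simp only [hmn, and_true, if_true, one_smul, sub_smul]
      abel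
    · simp only [hmn, and_false, if_false, zero_smul, add_zero]
      abel
  have h1 := φ.locallyFinite_normalOrd (-m) n (-m) v
  have h2 := φ.locallyFinite_number (m + n) v
  have h3 : (Function.support fun l : ℤ => (if m + n = 0 then (1 : ℂ) else 0) •
      ((if l < 0 then (1 : ℂ) else 0) - (if l + -m < 0 then 1 else 0)) • v).Finite := by
    refine (finite_signs (-m)).subset fun l hl h0 => hl ?_
    simp only at h0 ⊢
    rw [h0, zero_smul, smul_zero]
  have hs : ∑ᶠ l, φ.normalOrd (l + -m) (l + n) (l + -m) v =
      ∑ᶠ l, φ.normalOrd l (l + (m + n)) l v := by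
    rw [← finsum_comp_equiv (Equiv.addRight m)]
    refine finsum_congr fun l => ?_
    rw [Equiv.coe_addRight, add_neg_cancel_right, add_assoc l m n]
  rw [φ.opN_apply n (φ.opN m v), localSum_comm _ _ h,
    finsum_add_distrib ((h1.union h2).subset fun l hl => by
      by_contra hn
      simp only [Set.mem_union, Function.mem_support, not_or, not_not] at hn
      exact hl (by beta_reduce; rw [hn.1, hn.2, sub_zero])) h3,
    finsum_sub_distrib h1 h2, hs, sub_self, zero_add, ← smul_finsum, ← finsum_smul,
    finsum_signs, φ.opN_apply n v, map_neg]
  split_ifs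
  · rw [one_smul, Int.cast_neg, neg_smul]; abel
  · rw [zero_smul, zero_smul]; abel

theorem opJ_a (n m : ℤ) (v : V) :
    φ.opJ n (φ.a m v) = φ.a m (φ.opJ n v) + (if n + m = 0 then (n : ℂ) else 0) • v := by
  simp only [opJ_apply, map_add, map_smul, opN_a, φ.q_a, φ.a_a n m]
  abel

theorem opJ_b (n m : ℤ) (v : V) :
    φ.opJ n (φ.b m v) = φ.b m (φ.opJ n v) + φ.b (n + m) v := by
  simp only [opJ_apply, map_add, map_smul, opN_b, φ.q_b, φ.a_b, add_comm n m]
  abel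

theorem opJ_opF (n m : ℤ) (v : V) :
    φ.opJ n (φ.opF m v) = φ.opF m (φ.opJ n v) - φ.opF (n + m) v := by
  simp only [opJ_apply, map_add, map_smul, opF_a, opF_q, opN_opF, opF_apply _ (n + m), Int.cast_add,
    add_smul]
  abel

theorem opJ_opJ (n m : ℤ) (v : V) : φ.opJ n (φ.opJ m v) = φ.opJ m (φ.opJ n v) := by
  have h1 := φ.opN_opN m n v
  have h2 := φ.q_a n m v
  have h3 := φ.a_q n m v
  simp only [opJ_apply, map_add, map_smul, opN_a, opN_q, h1, h2, h3, φ.q_q n m, φ.a_a n m,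
    smul_add]
  split_ifs
  · module
  · module

/-- The operator by which `A ⊗ t^n` acts. -/
def op (n : ℤ) : H4 →ₗ[ℂ] Module.End ℂ V where
  toFun A := A 0 • φ.b n + A 1 • φ.opF n + A 2 • φ.a n + A 3 • φ.opJ n
  map_add' A B := by simp only [H4.add_apply]; module
  map_smul' r A := by simp only [H4.smul_apply, RingHom.id_apply]; module

theorem op_apply (n : ℤ) (A : H4) (v : V) :
    φ.op n A v = A 0 • φ.b n v + A 1 • φ.opF n v + A 2 • φ.a n v + A 3 • φ.opJ n v := rfl

theorem op_comm (A B : H4) (m n : ℤ) (v : V) :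
    φ.op m A (φ.op n B v) = φ.op n B (φ.op m A v) + φ.op (m + n) ⁅A, B⁆ v +
      (if m + n = 0 then (m : ℂ) * H4.form A B else 0) • v := by
  have ebb := φ.b_b m n v
  have ebF : φ.b m (φ.opF n v) = φ.opF n (φ.b m v) +
      (φ.a (m + n) v + (if m + n = 0 then (m : ℂ) else 0) • v) := by rw [φ.opF_b]; abel
  have eba := (φ.a_b n m v).symm
  have ebJ : φ.b m (φ.opJ n v) = φ.opJ n (φ.b m v) - φ.b (m + n) v := by
    rw [φ.opJ_b, add_comm n m]; abel
  have eFb := φ.opF_b m n v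
  have eFF := φ.opF_opF m n v
  have eFa := φ.opF_a m n v
  have eFJ : φ.opF m (φ.opJ n v) = φ.opJ n (φ.opF m v) + φ.opF (m + n) v := by
    rw [φ.opJ_opF, add_comm n m]; abel
  have eab := φ.a_b m n v
  have eaF := (φ.opF_a n m v).symm
  have eaa := φ.a_a m n v
  have eaJ : φ.a m (φ.opJ n v) = φ.opJ n (φ.a m v) - (if m + n = 0 then (n : ℂ) else 0) • v := by
    rw [φ.opJ_a, add_comm n m]; abel
  have eJb := φ.opJ_b m n v
  have eJF := φ.opJ_opF m n v
  have eJa := φ.opJ_a m n v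
  have eJJ := φ.opJ_opJ m n v
  rw [add_comm n m] at eFb
  simp only [op_apply, map_add, map_smul, ebb, ebF, eba, ebJ, eFb, eFF, eFa, eFJ, eab, eaF, eaa,
    eaJ, eJb, eJF, eJa, eJJ, H4.lie_apply_zero, H4.lie_apply_one, H4.lie_apply_two,
    H4.lie_apply_three, H4.form_apply]
  by_cases h : m + n = 0
  · obtain rfl : n = -m := by omega
    simp only [add_neg_cancel, if_true, Int.cast_neg]
    module
  · simp only [if_neg h]
    module

/-- The linear map underlying the representation of the affine algebra by free fields. -/
def repLinear : AffineH4 →ₗ[ℂ] Module.End ℂ V :=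
  Finsupp.lsum ℂ φ.op ∘ₗ (LieAlgebra.LoopAlgebra.toFinsupp ℂ ℤ H4).toLinearMap ∘ₗ
    AffineH4.loopPart + AffineH4.centralPart.smulRight 1

theorem repLinear_mode (A : H4) (n : ℤ) : φ.repLinear (AffineH4.mode A n) = φ.op n A := by
  rw [repLinear, LinearMap.add_apply, LinearMap.comp_apply, LinearMap.comp_apply,
    AffineH4.loopPart_mode, LinearMap.smulRight_apply, AffineH4.centralPart_mode, zero_smul,
    add_zero, LinearEquiv.coe_coe, LieAlgebra.LoopAlgebra.toFinsupp_single_tmul,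
    Finsupp.lsum_single]

theorem repLinear_K : φ.repLinear AffineH4.K = 1 := by
  simp [repLinear, AffineH4.loopPart_K, AffineH4.centralPart_K]

attribute [local instance] LieRing.ofAssociativeRing

/-- The representation of the affine algebra by free fields. -/
def rep : AffineH4 →ₗ⁅ℂ⁆ Module.End ℂ V where
  __ := φ.repLinear
  map_lie' {x y} := by
    change φ.repLinear ⁅x, y⁆ = ⁅φ.repLinear x, φ.repLinear y⁆
    induction x using AffineH4.span_induction with
    | hm A m =>
      induction y using AffineH4.span_induction with
      | hm B n =>
        rw [AffineH4.lie_mode_mode, map_add, map_smul, repLinear_mode, repLinear_mode,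
          repLinear_mode, repLinear_K, Ring.lie_def]
        ext v
        rw [LinearMap.sub_apply, Module.End.mul_apply, Module.End.mul_apply, op_comm]
        simp only [LinearMap.add_apply, LinearMap.smul_apply, Module.End.one_apply]
        abel
      | hK =>
        rw [AffineH4.lie_mode_K, map_zero, repLinear_K, Ring.lie_def, mul_one, one_mul, sub_self]
      | hadd x y hx hy => rw [lie_add, map_add, map_add, lie_add, hx, hy]
      | hsmul c x hx => rw [lie_smul, map_smul, map_smul, lie_smul, hx]
    | hK =>
      rw [repLinear_K, Ring.lie_def, mul_one, one_mul, sub_self]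
      induction y using AffineH4.span_induction with
      | hm B n => rw [← lie_skew, AffineH4.lie_mode_K, neg_zero, map_zero]
      | hK => rw [lie_self, map_zero]
      | hadd x y hx hy => rw [lie_add, map_add, hx, hy, add_zero]
      | hsmul c x hx => rw [lie_smul, map_smul, hx, smul_zero]
    | hadd x y hx hy => rw [add_lie, map_add, map_add, add_lie, hx, hy]
    | hsmul c x hx => rw [smul_lie, map_smul, map_smul, smul_lie, hx]

/-- The action of the enveloping algebra by free fields. -/
def repUA : UA →ₐ[ℂ] Module.End ℂ V := UniversalEnvelopingAlgebra.lift ℂ φ.rep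

theorem repUA_ua (A : H4) (n : ℤ) : φ.repUA (ua A n) = φ.op n A := by
  rw [repUA, ua, UniversalEnvelopingAlgebra.lift_ι_apply]
  exact φ.repLinear_mode A n

theorem repUA_uK : φ.repUA uK = 1 := by
  rw [repUA, uK, UniversalEnvelopingAlgebra.lift_ι_apply]
  exact φ.repLinear_K

/-- The space `V` as a module over the affine algebra. -/
@[nolint unusedArguments]
def Fock (_ : FreeFields V) : Type := V

instance : AddCommGroup φ.Fock := inferInstanceAs (AddCommGroup V)
instance : Module ℂ φ.Fock := inferInstanceAs (Module ℂ V)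
instance : Module UA φ.Fock := Module.compHom V φ.repUA.toRingHom

theorem smul_def (u : UA) (v : φ.Fock) : u • v = (φ.repUA u (v : V) : V) := rfl

instance : IsScalarTower ℂ UA φ.Fock where
  smul_assoc r u v := by
    have h : ∀ w : V, φ.repUA (r • u) w = r • φ.repUA u w := fun w => by
      rw [map_smul, LinearMap.smul_apply]
    exact h v

theorem ua_smul_def (A : H4) (n : ℤ) (v : φ.Fock) : ua A n • v = (φ.op n A (v : V) : V) := by
  rw [smul_def, repUA_ua]

theorem isLevelOne_fock : IsLevelOne φ.Fock := by
  intro v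
  rw [smul_def, repUA_uK]
  rfl

/-- A vector that is annihilated by the annihilation operators of nonzero degree. -/
structure IsVacuum (v : V) : Prop where
  b_pos : ∀ n, 0 < n → φ.b n v = 0
  g_neg : ∀ n, n < 0 → φ.g n v = 0
  a_pos : ∀ n, 0 < n → φ.a n v = 0
  q_pos : ∀ n, 0 < n → φ.q n v = 0

namespace IsVacuum

variable {φ} {v : V}

theorem opF_pos (hv : φ.IsVacuum v) (n : ℤ) (hn : 0 < n) : φ.opF n v = 0 := by
  rw [opF_apply, localSum_apply, hv.g_neg _ (by omega), smul_zero, sub_zero]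
  refine finsum_eq_zero_of_forall_eq_zero fun l => ?_
  rw [Module.End.mul_apply]
  rcases lt_or_ge l 0 with hl | hl
  · rw [hv.g_neg l hl, map_zero]
  · rw [φ.a_g, hv.a_pos _ (by omega), map_zero]

theorem opJ_pos (hv : φ.IsVacuum v) (n : ℤ) (hn : 0 < n) : φ.opJ n v = 0 := by
  rw [opJ_apply, opN_apply, localSum_apply, hv.q_pos n hn, hv.a_pos n hn, smul_zero, add_zero,
    add_zero, neg_eq_zero]
  refine finsum_eq_zero_of_forall_eq_zero fun l => ?_
  rw [normalOrd]
  split_ifs with hl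
  · rw [Module.End.mul_apply, hv.b_pos _ (by omega), map_zero]
  · rw [Module.End.mul_apply, hv.g_neg _ (by omega), map_zero]

theorem op_pos (hv : φ.IsVacuum v) (A : H4) (n : ℤ) (hn : 0 < n) : φ.op n A v = 0 := by
  rw [op_apply, hv.b_pos n hn, hv.opF_pos n hn, hv.a_pos n hn, hv.opJ_pos n hn]
  simp only [smul_zero, add_zero]

theorem opF_zero (hv : φ.IsVacuum v) : φ.opF 0 v = φ.a 0 (φ.g 0 v) := by
  rw [opF_apply, localSum_apply, Int.cast_zero, zero_smul, sub_zero, finsum_eq_single _ 0]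
  · rw [Module.End.mul_apply, add_zero]
  · intro l hl
    rw [Module.End.mul_apply, zero_add]
    rcases lt_or_gt_of_ne hl with hl | hl
    · rw [hv.g_neg l hl, map_zero]
    · rw [φ.a_g, hv.a_pos _ hl, map_zero]

theorem opJ_zero (hv : φ.IsVacuum v) :
    φ.opJ 0 v = -φ.g 0 (φ.b 0 v) + φ.q 0 v + (1 / 2 : ℂ) • φ.a 0 v := by
  rw [opJ_apply, opN_apply, localSum_apply, finsum_eq_single _ 0]
  · rw [normalOrd, if_pos le_rfl, Module.End.mul_apply, add_zero]
  · intro l hl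
    rw [normalOrd]
    split_ifs with hl
    · rw [Module.End.mul_apply, hv.b_pos _ (by omega), map_zero]
    · rw [Module.End.mul_apply, hv.g_neg _ (by omega), map_zero]

end IsVacuum

end FreeFields

/-! ### Laurent polynomials -/

section Laurent

variable {ι : Type}

/-- Laurent polynomials in the variables `ι`, given by their coefficients. -/
abbrev Laurent (ι : Type) : Type := (ι →₀ ℤ) →₀ ℂ

namespace Laurent

/-- Multiplication by a variable. -/
def mulVar (t : ι) : Module.End ℂ (Laurent ι) :=
  Finsupp.lmapDomain ℂ ℂ (· + Finsupp.single t 1)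

/-- Partial derivative with respect to a variable. -/
def derVar (t : ι) : Module.End ℂ (Laurent ι) :=
  Finsupp.lsum ℂ fun n : ι →₀ ℤ =>
    (n t : ℂ) • (Finsupp.lsingle (n - Finsupp.single t 1) : ℂ →ₗ[ℂ] Laurent ι)

theorem mulVar_single (t : ι) (n : ι →₀ ℤ) (c : ℂ) :
    mulVar t (Finsupp.single n c) = Finsupp.single (n + Finsupp.single t 1) c := by
  simp [mulVar]

theorem derVar_single (t : ι) (n : ι →₀ ℤ) (c : ℂ) :
    derVar t (Finsupp.single n c) =
      (n t : ℂ) • Finsupp.single (n - Finsupp.single t 1) c := by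
  simp [derVar]

theorem mulVar_mulVar (s t : ι) (v : Laurent ι) :
    mulVar s (mulVar t v) = mulVar t (mulVar s v) := by
  induction v using Finsupp.induction_linear with
  | zero => simp only [map_zero]
  | add v w hv hw => simp only [map_add, hv, hw]
  | single n c => simp only [mulVar_single, add_right_comm]

theorem derVar_mulVar [DecidableEq ι] (s t : ι) (v : Laurent ι) :
    derVar s (mulVar t v) = mulVar t (derVar s v) + (if s = t then (1 : ℂ) else 0) • v := by
  induction v using Finsupp.induction_linear with
  | zero => simp only [map_zero, smul_zero, add_zero]
  | add v w hv hw => simp only [map_add, hv, hw, smul_add]; abel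
  | single n c =>
    simp only [mulVar_single, derVar_single, map_smul]
    split_ifs with h
    · subst h
      rw [add_sub_cancel_right, sub_add_cancel, Finsupp.add_apply, Finsupp.single_eq_same,
        Int.cast_add, Int.cast_one, add_smul]
    · rw [Finsupp.add_apply, Finsupp.single_eq_of_ne h, add_zero, zero_smul, add_zero,
        add_sub_right_comm]

theorem derVar_derVar (s t : ι) (v : Laurent ι) :
    derVar s (derVar t v) = derVar t (derVar s v) := by
  rcases eq_or_ne s t with rfl | h
  · rfl
  induction v using Finsupp.induction_linear with
  | zero => simp only [map_zero]
  | add v w hv hw => simp only [map_add, hv, hw]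
  | single n c =>
    simp only [derVar_single, map_smul, Finsupp.sub_apply, Finsupp.single_eq_of_ne h,
      Finsupp.single_eq_of_ne h.symm, sub_zero]
    rw [smul_comm, sub_right_comm]

theorem mulVar_derVar [DecidableEq ι] (s t : ι) (v : Laurent ι) :
    mulVar s (derVar t v) = derVar t (mulVar s v) + -((if t = s then (1 : ℂ) else 0) • v) := by
  rw [derVar_mulVar]; abel

theorem finite_derVar (v : Laurent ι) : {t | derVar t v ≠ 0}.Finite := by
  induction v using Finsupp.induction_linear with
  | zero => simp
  | add v w hv hw =>
    refine (hv.union hw).subset fun t ht => ?_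
    by_contra hn
    simp only [Set.mem_union, Set.mem_ofPred_eq, not_or, not_not] at hn
    exact ht (by rw [map_add, hn.1, hn.2, add_zero])
  | single n c =>
    refine n.hasFiniteSupport.subset fun t ht h => ht ?_
    rw [derVar_single, h, Int.cast_zero, zero_smul]

end Laurent

end Laurent

/-! ### Free fields on Laurent polynomials -/

open Laurent

/-- The modes of a field `b` of charge one: derivatives from the cutoff `c` on, and variables below
it. -/
def weylB (c : ℤ) (n : ℤ) : Module.End ℂ (Laurent (ℤ ⊕ ℤ)) :=
  if c ≤ n then derVar (Sum.inl n) else mulVar (Sum.inl n)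

/-- The modes of the field conjugate to `weylB`. -/
def weylG (c : ℤ) (n : ℤ) : Module.End ℂ (Laurent (ℤ ⊕ ℤ)) :=
  if c ≤ n then mulVar (Sum.inl n) else -derVar (Sum.inl n)

/-- The modes of a Heisenberg field with zero mode `i`. -/
def heisA (i : ℂ) (n : ℤ) : Module.End ℂ (Laurent (ℤ ⊕ ℤ)) :=
  if n < 0 then mulVar (Sum.inr n) else if n = 0 then i • 1 else (n : ℂ) • derVar (Sum.inr n)

/-- The modes of the Heisenberg field conjugate to `heisA`, with zero mode `k`. -/
def heisQ (k : ℂ) (n : ℤ) : Module.End ℂ (Laurent (ℤ ⊕ ℤ)) :=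
  if n < 0 then mulVar (Sum.inr (-n)) else
    if n = 0 then k • 1 else (n : ℂ) • derVar (Sum.inr (-n))

/-- Free fields on a space of Laurent polynomials.  The zero modes of the Heisenberg fields are `i`
and `k`; the cutoff `c` decides which of the two Weyl fields has a multiplication operator as its
zero mode. -/
def laurentFields (c : ℕ) (i k : ℂ) : FreeFields (Laurent (ℤ ⊕ ℤ)) where
  b := weylB c
  g := weylG c
  a := heisA i
  q := heisQ k
  b_b m n v := by
    unfold weylB
    split_ifs <;> simp [derVar_derVar (Sum.inl m), mulVar_mulVar (Sum.inl m), derVar_mulVar]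
    all_goals (intro h; omega)
  g_g m n v := by
    unfold weylG
    split_ifs <;> simp [derVar_derVar (Sum.inl m), mulVar_mulVar (Sum.inl m), derVar_mulVar]
    all_goals (intro h; omega)
  b_g m n v := by
    unfold weylB weylG
    split_ifs <;> simp [derVar_derVar (Sum.inl m), mulVar_mulVar (Sum.inl m), derVar_mulVar, *]
    all_goals (try omega)
  a_a m n v := by
    unfold heisA
    split_ifs <;> simp [derVar_derVar (Sum.inr m), mulVar_mulVar (Sum.inr m), derVar_mulVar]
    all_goals first | omega | exact smul_comm _ _ _
  q_q m n v := by
    unfold heisQ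
    split_ifs <;> simp [derVar_derVar (Sum.inr (-m)), mulVar_mulVar (Sum.inr (-m)), derVar_mulVar]
    all_goals first | omega | exact smul_comm _ _ _
  a_q m n v := by
    unfold heisA heisQ
    rcases lt_trichotomy m 0 with hm | rfl | hm
    · rw [if_pos hm]
      rcases lt_trichotomy n 0 with hn | rfl | hn
      · rw [if_pos hn, if_neg (by omega), zero_smul, add_zero, mulVar_mulVar]
      · simp [hm.ne]
      · rw [if_neg (by omega), if_neg (by omega), LinearMap.smul_apply, LinearMap.smul_apply,
          map_smul, mulVar_derVar, smul_add, smul_neg, smul_smul]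
        by_cases h : m + n = 0
        · obtain rfl : m = -n := by omega
          simp
        · rw [if_neg (by simp; omega), if_neg h]
          simp
    · simp
    · rw [if_neg (by omega), if_neg (by omega)]
      rcases lt_trichotomy n 0 with hn | rfl | hn
      · rw [if_pos hn, LinearMap.smul_apply, LinearMap.smul_apply, derVar_mulVar, smul_add,
          map_smul, smul_smul]
        by_cases h : m + n = 0
        · obtain rfl : m = -n := by omega
          simp
        · rw [if_neg (by simp; omega), if_neg h]
          simp
      · simpa [hm.ne'] using smul_comm _ _ _
      · rw [if_neg (by omega), if_neg (by omega), if_neg (by omega)]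
        simp only [LinearMap.smul_apply, map_smul, zero_smul, add_zero]
        rw [derVar_derVar, smul_comm]
  a_b m n v := by
    unfold heisA weylB
    split_ifs <;> simp [derVar_derVar (Sum.inr m), mulVar_mulVar (Sum.inr m), derVar_mulVar]
  a_g m n v := by
    unfold heisA weylG
    split_ifs <;> simp [derVar_derVar (Sum.inr m), mulVar_mulVar (Sum.inr m), derVar_mulVar]
  q_b m n v := by
    unfold heisQ weylB
    split_ifs <;> simp [derVar_derVar (Sum.inr (-m)), mulVar_mulVar (Sum.inr (-m)), derVar_mulVar]
  q_g m n v := by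
    unfold heisQ weylG
    split_ifs <;> simp [derVar_derVar (Sum.inr (-m)), mulVar_mulVar (Sum.inr (-m)), derVar_mulVar]
  smooth v := by
    have hv := finite_derVar v
    obtain ⟨N, hN⟩ := (hv.image fun t : ℤ ⊕ ℤ => Sum.elim Int.natAbs Int.natAbs t).bddAbove
    have h0 : ∀ t : ℤ ⊕ ℤ, N < Sum.elim Int.natAbs Int.natAbs t → derVar t v = 0 := by
      intro t ht
      by_contra h
      exact absurd (hN (Set.mem_image_of_mem _ h)) (not_le.2 ht)
    refine ⟨N + c + 1, fun n hn => ⟨?_, ?_, ?_, ?_⟩⟩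
    · rw [weylB, if_pos (by omega), h0 _ (by simp; omega)]
    · rw [weylG, if_neg (by omega), LinearMap.neg_apply, h0 _ (by simp; omega), neg_zero]
    · rw [heisA, if_neg (by omega), if_neg (by omega), LinearMap.smul_apply,
        h0 _ (by simp; omega), smul_zero]
    · rw [heisQ, if_neg (by omega), if_neg (by omega), LinearMap.smul_apply,
        h0 _ (by simp; omega), smul_zero]

theorem laurentFields_b_zero_one (i k : ℂ) : (laurentFields 1 i k).b 0 = mulVar (Sum.inl 0) := rfl
theorem laurentFields_b_zero_zero (i k : ℂ) : (laurentFields 0 i k).b 0 = derVar (Sum.inl 0) := rfl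
theorem laurentFields_g_zero_one (i k : ℂ) : (laurentFields 1 i k).g 0 = -derVar (Sum.inl 0) := rfl
theorem laurentFields_g_zero_zero (i k : ℂ) : (laurentFields 0 i k).g 0 = mulVar (Sum.inl 0) := rfl
theorem laurentFields_a_zero (c : ℕ) (i k : ℂ) : (laurentFields c i k).a 0 = i • 1 := rfl
theorem laurentFields_q_zero (c : ℕ) (i k : ℂ) : (laurentFields c i k).q 0 = k • 1 := rfl

/-- The powers of the variable that belongs to the zero modes of the Weyl fields, with the exponent
shifted by one. -/
def zeroPow (p : ℤ) : Laurent (ℤ ⊕ ℤ) := Finsupp.single (Finsupp.single (Sum.inl 0) (p - 1)) 1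

theorem zeroPow_ne_zero (p : ℤ) : zeroPow p ≠ 0 := by
  rw [zeroPow, Ne, Finsupp.single_eq_zero]
  exact one_ne_zero

theorem mulVar_zeroPow (p : ℤ) : mulVar (Sum.inl 0) (zeroPow p) = zeroPow (p + 1) := by
  rw [zeroPow, mulVar_single, ← Finsupp.single_add, zeroPow, sub_add_cancel, add_sub_cancel_right]

theorem derVar_zeroPow (p : ℤ) :
    derVar (Sum.inl 0) (zeroPow p) = ((p : ℂ) - 1) • zeroPow (p - 1) := by
  rw [zeroPow, derVar_single, ← Finsupp.single_sub, Finsupp.single_eq_same, zeroPow]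
  push_cast
  rfl

theorem derVar_zeroPow_of_ne {t : ℤ ⊕ ℤ} (ht : t ≠ Sum.inl 0) (p : ℤ) :
    derVar t (zeroPow p) = 0 := by
  rw [zeroPow, derVar_single, Finsupp.single_eq_of_ne ht, Int.cast_zero, zero_smul]

theorem isVacuum_zeroPow {c : ℕ} (hc : c ≤ 1) (i k : ℂ) (p : ℤ) :
    (laurentFields c i k).IsVacuum (zeroPow p) where
  b_pos n hn := by
    change weylB c n _ = 0
    rw [weylB, if_pos (by omega), derVar_zeroPow_of_ne (by simp; omega)]
  g_neg n hn := by
    change weylG c n _ = 0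
    rw [weylG, if_neg (by omega), LinearMap.neg_apply, derVar_zeroPow_of_ne (by simp; omega),
      neg_zero]
  a_pos n hn := by
    change heisA i n _ = 0
    rw [heisA, if_neg (by omega), if_neg (by omega), LinearMap.smul_apply,
      derVar_zeroPow_of_ne (by simp), smul_zero]
  q_pos n hn := by
    change heisQ k n _ = 0
    rw [heisQ, if_neg (by omega), if_neg (by omega), LinearMap.smul_apply,
      derVar_zeroPow_of_ne (by simp), smul_zero]

namespace FreeFields

variable {V : Type} [AddCommGroup V] [Module ℂ V] (φ : FreeFields V)

theorem op_E (n : ℤ) : φ.op n H4.E = φ.b n := by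
  ext v
  rw [op_apply, show H4.E 0 = 1 from rfl, show H4.E 1 = 0 from rfl,
    show H4.E 2 = 0 from rfl, show H4.E 3 = 0 from rfl]
  simp

theorem op_F (n : ℤ) : φ.op n H4.F = φ.opF n := by
  ext v
  rw [op_apply, show H4.F 0 = 0 from rfl, show H4.F 1 = 1 from rfl,
    show H4.F 2 = 0 from rfl, show H4.F 3 = 0 from rfl]
  simp

theorem op_I (n : ℤ) : φ.op n H4.I = φ.a n := by
  ext v
  rw [op_apply, show H4.I 0 = 0 from rfl, show H4.I 1 = 0 from rfl,
    show H4.I 2 = 1 from rfl, show H4.I 3 = 0 from rfl]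
  simp

theorem op_J (n : ℤ) : φ.op n H4.J = φ.opJ n := by
  ext v
  rw [op_apply, show H4.J 0 = 0 from rfl, show H4.J 1 = 0 from rfl,
    show H4.J 2 = 0 from rfl, show H4.J 3 = 1 from rfl]
  simp

theorem IsVacuum.isRung {φ : FreeFields V} {v : V} (hv : φ.IsVacuum v) {s p : ℤ} {i j c : ℂ}
    (hI : φ.op 0 H4.I v = i • v) (hJ : φ.op 0 H4.J v = (j + s * p) • v)
    (hc : φ.op 0 H4.F (φ.op 0 H4.E v) + φ.op 0 H4.I (φ.op 0 H4.J v) = c • v) :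
    IsRung (M := φ.Fock) s i j c p v where
  pos A n hn := (φ.ua_smul_def A n v).trans (hv.op_pos A n hn)
  I_smul := (φ.ua_smul_def _ 0 v).trans hI
  J_smul := (φ.ua_smul_def _ 0 v).trans hJ
  casimir := by
    change φ.repUA (ua H4.F 0) (φ.repUA (ua H4.E 0) v) +
      φ.repUA (ua H4.I 0) (φ.repUA (ua H4.J 0) v) = c • v
    rw [repUA_ua, repUA_ua, repUA_ua, repUA_ua, hc]

end FreeFields

/-- A free field module with an infinite ladder of ground vectors on which `up` acts without
kernel. -/
theorem exists_rungs {s : ℤ} {up down : H4} (ho : IsOriented s up down) {i : ℂ} (hi : i ≠ 0)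
    (h : ℂ) :
    ∃ (c : ℕ) (k : ℂ) (x : ℤ → (laurentFields c i k).Fock), ∀ p, x p ≠ 0 ∧
      IsRung s i (h / i + (1 - s) / 2) h p (x p) ∧
        ∃ r : ℂ, r ≠ 0 ∧ ua up 0 • x p = r • x (p + 1) := by
  have hI : ∀ c k p, (laurentFields c i k).op 0 H4.I (zeroPow p) = i • zeroPow p := by
    intro c k p
    rw [FreeFields.op_I, laurentFields_a_zero]; rfl
  rcases ho with ⟨rfl, rfl, rfl⟩ | ⟨rfl, rfl, rfl⟩
  · refine ⟨1, h / i - i / 2, zeroPow, fun p => ?_⟩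
    have hv := isVacuum_zeroPow (c := 1) le_rfl i (h / i - i / 2)
    set φ := laurentFields 1 i (h / i - i / 2) with hφ
    have hE : ∀ p, φ.op 0 H4.E (zeroPow p) = zeroPow (p + 1) := by
      intro p
      rw [FreeFields.op_E, laurentFields_b_zero_one, mulVar_zeroPow]
    have hJ : ∀ p : ℤ, φ.op 0 H4.J (zeroPow p) = (h / i + p) • zeroPow p := by
      intro p
      rw [FreeFields.op_J, (hv p).opJ_zero, laurentFields_g_zero_one, laurentFields_b_zero_one,
        laurentFields_a_zero, laurentFields_q_zero, mulVar_zeroPow, LinearMap.neg_apply,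
        derVar_zeroPow, add_sub_cancel_right]
      simp only [LinearMap.smul_apply, Module.End.one_apply]
      push_cast
      module
    have hF : ∀ p : ℤ, φ.op 0 H4.F (zeroPow p) = (-i * (p - 1)) • zeroPow (p - 1) := by
      intro p
      rw [FreeFields.op_F, (hv p).opF_zero, laurentFields_g_zero_one, laurentFields_a_zero,
        LinearMap.neg_apply, derVar_zeroPow]
      simp only [LinearMap.smul_apply, Module.End.one_apply]
      module
    refine ⟨zeroPow_ne_zero p, (hv p).isRung (hI _ _ p) ?_ ?_, 1, one_ne_zero, ?_⟩
    · rw [hJ]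
      push_cast
      congr 1
      ring
    · rw [hE, hF, hJ, map_smul, hI, smul_smul, add_sub_cancel_right, ← add_smul]
      congr 1
      push_cast
      field_simp
      ring
    · exact (φ.ua_smul_def _ 0 _).trans ((hE p).trans (one_smul ℂ _).symm)
  · refine ⟨0, h / i - i / 2, zeroPow, fun p => ?_⟩
    have hv := isVacuum_zeroPow (c := 0) zero_le_one i (h / i - i / 2)
    set φ := laurentFields 0 i (h / i - i / 2) with hφ
    have hE : ∀ p : ℤ, φ.op 0 H4.E (zeroPow p) = ((p : ℂ) - 1) • zeroPow (p - 1) := by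
      intro p
      rw [FreeFields.op_E, laurentFields_b_zero_zero, derVar_zeroPow]
    have hJ : ∀ p : ℤ, φ.op 0 H4.J (zeroPow p) = (h / i + 1 - p) • zeroPow p := by
      intro p
      rw [FreeFields.op_J, (hv p).opJ_zero, laurentFields_g_zero_zero, laurentFields_b_zero_zero,
        laurentFields_a_zero, laurentFields_q_zero, derVar_zeroPow, map_smul, mulVar_zeroPow,
        sub_add_cancel]
      simp only [LinearMap.smul_apply, Module.End.one_apply]
      module
    have hF : ∀ p : ℤ, φ.op 0 H4.F (zeroPow p) = i • zeroPow (p + 1) := by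
      intro p
      rw [FreeFields.op_F, (hv p).opF_zero, laurentFields_g_zero_zero, laurentFields_a_zero,
        mulVar_zeroPow]
      rfl
    refine ⟨zeroPow_ne_zero p, (hv p).isRung (hI _ _ p) ?_ ?_, i, hi, ?_⟩
    · rw [hJ]
      push_cast
      congr 1
      ring
    · rw [hE, map_smul, hF, hJ, map_smul, hI, smul_smul, smul_smul, sub_add_cancel, ← add_smul]
      congr 1
      field_simp
      ring
    · exact (φ.ua_smul_def _ 0 _).trans (hF p)

/-! ### The relaxed modules -/

/-- The generator of the relaxed module as a rung of index `p`. -/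
theorem isRung_gen_dense {s p : ℤ} {i j h : ℂ} :
    IsRung s i (j - s * p) h p (gen {u4 H4.I - algebraMap ℂ U4 i, u4 H4.J - algebraMap ℂ U4 j,
      casimir - algebraMap ℂ U4 h}) := by
  refine isRung_gen (by simp) (by simp) ?_
  have := zeroModes_smul_gen_eq_zero (x := casimir - algebraMap ℂ U4 h)
    {u4 H4.I - algebraMap ℂ U4 i, u4 H4.J - algebraMap ℂ U4 j, casimir - algebraMap ℂ U4 h}
    (by simp)
  rwa [map_sub, sub_smul, AlgHom.commutes, algebraMap_smul, sub_eq_zero, casimir, map_add,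
    add_smul] at this

/-- With this normalisation of the index, `down_0 up_0` vanishes on the rung of index zero only. -/
theorem rungValue_eq (s : ℤ) {i : ℂ} (hi : i ≠ 0) (h : ℂ) (p : ℤ) :
    rungValue s i (h / i + (1 - s) / 2) h p = -s * i * p := by
  rw [rungValue]
  field_simp
  ring

theorem IsOriented.ne_zero {s : ℤ} {up down : H4} (ho : IsOriented s up down) : (s : ℂ) ≠ 0 := by
  rcases ho with ⟨rfl, -, -⟩ | ⟨rfl, -, -⟩ <;> norm_num

/-- The ground states that generate `RelaxedQuo i j h` form a reduced ladder. Its indices are chosen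
so that `down_0` annihilates the rung of index one; the generator then has index `-n`. -/
theorem exists_isReducedLadder {s : ℤ} {up down : H4} (ho : IsOriented s up down) {i : ℂ}
    (hi : i ≠ 0) (h : ℂ) (n : ℕ) {j : ℂ} (hj : j = h / i + (1 - s) / 2 - s * n) :
    ∃ w : ℤ → RelaxedQuo i j h, IsReducedLadder s up down i (h / i + (1 - s) / 2) h w := by
  set S : Set U4 :=
    {u4 H4.I - algebraMap ℂ U4 i, u4 H4.J - algebraMap ℂ U4 j, casimir - algebraMap ℂ U4 h} with hS
  have hM : IsLevelOne (Induced (CyclicModule S)) := Induced.isLevelOne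
  have hv : IsRung s i (h / i + (1 - s) / 2) h (-n) (gen S) := by
    have := isRung_gen_dense (s := s) (p := -n) (i := i) (j := j) (h := h)
    rwa [show j - s * ((-n : ℤ) : ℂ) = h / i + (1 - s) / 2 by rw [hj]; push_cast; ring] at this
  have hval : ∀ p : ℤ, p ≠ 0 → rungValue s i (h / i + (1 - s) / 2) h p ≠ 0 := fun p hp => by
    rw [rungValue_eq s hi]
    exact mul_ne_zero (mul_ne_zero (neg_ne_zero.2 ho.ne_zero) hi) (Int.cast_ne_zero.2 hp)
  have hw := isLadder_rungs hM ho hv (span_gen S)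
  refine ⟨_, hw.isReducedLadder_quotient ho (fun p => ?_) (fun p => ?_) (fun p hp => ?_) ?_
    (N := groundFree i j h) ?_⟩
  · -- From the index `-n` on, the rungs are mapped to nonzero multiples of vectors of a free field
    -- module; below it, `up_0` maps each rung to a nonzero multiple of the next one.
    obtain ⟨c, k, x, hx⟩ := exists_rungs ho hi h
    obtain ⟨f, hf⟩ := exists_lift S (FreeFields.isLevelOne_fock _) (hx (-n)).2.1.pos (by
      have hr := (hx (-n)).2.1
      rintro _ (rfl | rfl | rfl)
      · rw [map_sub, sub_smul, zeroModes_u4, AlgHom.commutes, algebraMap_smul, hr.I_smul, sub_self]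
      · rw [map_sub, sub_smul, zeroModes_u4, AlgHom.commutes, algebraMap_smul, hr.J_smul, hj]
        push_cast
        rw [mul_neg, ← sub_eq_add_neg, sub_self]
      · rw [map_sub, sub_smul, AlgHom.commutes, algebraMap_smul, casimir, map_add, map_mul, map_mul,
          add_smul, mul_smul, mul_smul]
        simp only [zeroModes_u4]
        rw [hr.casimir, sub_self])
    have hup : ∀ p : ℤ, -n ≤ p → ∃ r : ℂ, r ≠ 0 ∧ f (rungs up down (-n) (gen S) p) = r • x p := by
      intro p hp
      induction p, hp using Int.leInduction with
      | base => exact ⟨1, one_ne_zero, by rw [rungs_self, hf, one_smul]⟩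
      | succ p hp ih =>
        obtain ⟨r, hr, he⟩ := ih
        obtain ⟨-, -, r', hr', he'⟩ := hx p
        refine ⟨r * r', mul_ne_zero hr hr', ?_⟩
        rw [rungs_up hp, map_smul, he, smul_comm, he', smul_smul]
    rcases le_or_gt (-n : ℤ) p with hp | hp
    · obtain ⟨r, hr, he⟩ := hup p hp
      intro h0
      rw [h0, map_zero] at he
      exact smul_ne_zero hr (hx p).1 he.symm
    · replace hp := hp.le
      induction p, hp using Int.leInductionDown with
      | base =>
        intro h0
        rw [rungs_self] at h0
        exact (hx (-n)).1 (by rw [← hf, h0, map_zero])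
      | pred p hp ih =>
        intro h0
        have h1 := up_smul_rungs hM ho hv (p - 1)
        rw [h0, smul_zero, if_neg (by omega), sub_add_cancel] at h1
        exact smul_ne_zero (hval _ (by omega)) ih h1.symm
  · rw [up_smul_rungs hM ho hv]
    refine ⟨_, ?_, rfl⟩
    split_ifs with hp
    · exact one_ne_zero
    · exact hval p (by omega)
  · rw [down_smul_rungs hM ho hv]
    refine ⟨_, ?_, rfl⟩
    split_ifs
    · exact hval p hp
    · exact one_ne_zero
  · have := down_smul_rungs hM ho hv 0
    rw [zero_add, if_pos (by omega), rungValue_eq s hi] at this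
    rw [this]
    simp
  · rw [groundFree]
    simp only [IsGroundState, algebraMap_smul]
    rfl

/-! ### Verma modules -/

section Verma

variable {C : Type} [AddCommGroup C] [Module ℂ C] [Module UA C] [IsScalarTower ℂ UA C]
  [IsSimpleModule UA C] {i j : ℂ} {m : C}

theorem nonempty_irrPlus_equiv (hC : IsLevelOne C) (hm : m ≠ 0)
    (hpos : ∀ A n, 0 < n → ua A n • m = 0) (hE : ua H4.E 0 • m = 0) (hI : ua H4.I 0 • m = i • m)
    (hJ : ua H4.J 0 • m = j • m) : Nonempty (IrrPlus i j ≃ₗ[UA] C) := by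
  refine nonempty_irr_equiv (s := 1) (q := 0) (i := i) (j := j) (c := i * j)
    (Or.inl ⟨rfl, rfl, rfl⟩) (isRung_gen (by simp) (by simp) ?_) hC hm hpos ?_
  · have hE := zeroModes_smul_gen_eq_zero (x := u4 H4.E)
      {u4 H4.E, u4 H4.I - algebraMap ℂ U4 i, u4 H4.J - algebraMap ℂ U4 j} (by simp)
    have hI := zeroModes_smul_gen_eq_zero (x := u4 H4.I - algebraMap ℂ U4 i)
      {u4 H4.E, u4 H4.I - algebraMap ℂ U4 i, u4 H4.J - algebraMap ℂ U4 j} (by simp)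
    have hJ := zeroModes_smul_gen_eq_zero (x := u4 H4.J - algebraMap ℂ U4 j)
      {u4 H4.E, u4 H4.I - algebraMap ℂ U4 i, u4 H4.J - algebraMap ℂ U4 j} (by simp)
    rw [map_sub, sub_smul, AlgHom.commutes, algebraMap_smul, sub_eq_zero] at hI hJ
    rw [map_mul, mul_smul, hE, smul_zero, zero_add, map_mul, mul_smul, hJ, smul_comm, hI, smul_smul,
      mul_comm]
  · rintro _ (rfl | rfl | rfl)
    · rw [zeroModes_u4, hE]
    · rw [map_sub, sub_smul, zeroModes_u4, AlgHom.commutes, algebraMap_smul, hI, sub_self]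
    · rw [map_sub, sub_smul, zeroModes_u4, AlgHom.commutes, algebraMap_smul, hJ, sub_self]

theorem nonempty_irrMinus_equiv (hC : IsLevelOne C) (hm : m ≠ 0)
    (hpos : ∀ A n, 0 < n → ua A n • m = 0) (hF : ua H4.F 0 • m = 0) (hI : ua H4.I 0 • m = i • m)
    (hJ : ua H4.J 0 • m = j • m) : Nonempty (IrrMinus i j ≃ₗ[UA] C) := by
  refine nonempty_irr_equiv (s := 1) (q := 0) (i := i) (j := j) (c := i * j - i)
    (Or.inl ⟨rfl, rfl, rfl⟩) (isRung_gen (by simp) (by simp) ?_) hC hm hpos ?_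
  · have hF := zeroModes_smul_gen_eq_zero (x := u4 H4.F)
      {u4 H4.F, u4 H4.I - algebraMap ℂ U4 i, u4 H4.J - algebraMap ℂ U4 j} (by simp)
    have hI := zeroModes_smul_gen_eq_zero (x := u4 H4.I - algebraMap ℂ U4 i)
      {u4 H4.F, u4 H4.I - algebraMap ℂ U4 i, u4 H4.J - algebraMap ℂ U4 j} (by simp)
    have hJ := zeroModes_smul_gen_eq_zero (x := u4 H4.J - algebraMap ℂ U4 j)
      {u4 H4.F, u4 H4.I - algebraMap ℂ U4 i, u4 H4.J - algebraMap ℂ U4 j} (by simp)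
    rw [map_sub, sub_smul, AlgHom.commutes, algebraMap_smul, sub_eq_zero] at hI hJ
    have hneg : u4 (-H4.I) = -u4 H4.I := map_neg (UniversalEnvelopingAlgebra.ι ℂ) H4.I
    rw [u4_mul, H4.lie_F_E, hneg, map_add, map_mul, add_smul, mul_smul, hF, smul_zero, zero_add,
      map_neg, neg_smul, hI, map_mul, mul_smul, hJ, smul_comm, hI, smul_smul, sub_smul, mul_comm j]
    abel
  · rintro _ (rfl | rfl | rfl)
    · rw [zeroModes_u4, hF]
    · rw [map_sub, sub_smul, zeroModes_u4, AlgHom.commutes, algebraMap_smul, hI, sub_self]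
    · rw [map_sub, sub_smul, zeroModes_u4, AlgHom.commutes, algebraMap_smul, hJ, sub_self]

end Verma

/-! ### Composition series -/

namespace IsReducedLadder

variable {M : Type} [AddCommGroup M] [Module ℂ M] [Module UA M] [IsScalarTower ℂ UA M]
  {s : ℤ} {i j c : ℂ} {w : ℤ → M} {up down : H4}

theorem length_eq_two (hw : IsReducedLadder s up down i j c w) (hi : i ≠ 0) :
    Module.length UA M = 2 := by
  have := hw.isSimpleModule_span
  have := hw.isSimpleModule_quotient hi
  rw [Module.length_eq_add_of_exact (Submodule.span UA {w 1}).subtype (Submodule.span UA {w 1}).mkQ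
    (Submodule.injective_subtype _) (Submodule.mkQ_surjective _)
    (LinearMap.exact_subtype_mkQ _), Module.length_eq_one, Module.length_eq_one]
  rfl

/-- A section of the quotient map would have `w 1` in its image, which it cannot as the quotient map
annihilates `w 1`. -/
theorem exists_isNonsplitShortExact (hw : IsReducedLadder s up down i j c w) {P Q : Type}
    [AddCommGroup P] [Module UA P] [AddCommGroup Q] [Module UA Q]
    (e : P ≃ₗ[UA] Submodule.span UA {w 1}) (e' : Q ≃ₗ[UA] M ⧸ Submodule.span UA {w 1}) :
    ∃ (f : P →ₗ[UA] M) (g : M →ₗ[UA] Q), IsNonsplitShortExact f g := by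
  set A := Submodule.span UA {w 1} with hA
  refine ⟨A.subtype ∘ₗ e.toLinearMap, e'.symm.toLinearMap ∘ₗ A.mkQ, ?_, ?_, ?_, ?_⟩
  · exact A.injective_subtype.comp e.injective
  · intro y
    rw [LinearMap.comp_apply, LinearEquiv.coe_coe, LinearEquiv.map_eq_zero_iff, Submodule.mkQ_apply,
      Submodule.Quotient.mk_eq_zero]
    exact ⟨fun hy => ⟨e.symm ⟨y, hy⟩, by simp⟩, fun ⟨x, hx⟩ => hx ▸ (e x).2⟩
  · exact e'.symm.surjective.comp A.mkQ_surjective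
  · rintro ⟨t, ht⟩
    have ht' : ∀ y, e'.symm (A.mkQ (t y)) = y := fun y => LinearMap.congr_fun ht y
    have h0 : w 0 ∉ A := hw.w_notMem_span le_rfl
    have hne : LinearMap.range t ≠ ⊥ := by
      intro hb
      rw [LinearMap.range_eq_bot] at hb
      have := ht' (e'.symm (A.mkQ (w 0)))
      rw [hb, LinearMap.zero_apply, map_zero, map_zero, eq_comm, LinearEquiv.map_eq_zero_iff,
        Submodule.mkQ_apply, Submodule.Quotient.mk_eq_zero] at this
      exact h0 this
    obtain ⟨y, hy⟩ := hw.w_one_mem hne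
    have h1 : A.mkQ (w 1) = 0 :=
      (Submodule.Quotient.mk_eq_zero _).2 (Submodule.mem_span_singleton_self _)
    have := ht' y
    rw [hy, h1, map_zero] at this
    rw [← this, map_zero] at hy
    exact hw.ne_zero 1 hy.symm

omit [IsScalarTower ℂ UA M] in
theorem isLevelOne_span (hw : IsReducedLadder s up down i j c w) :
    IsLevelOne (Submodule.span UA {w 1}) := fun v => Subtype.ext (hw.isLevelOne v)

theorem isLadder_quotient (hw : IsReducedLadder s up down i j c w) :
    IsLadder s i j c (fun p => (Submodule.span UA {w 1}).mkQ (w p)) :=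
  hw.toIsLadder.map (Submodule.mkQ_surjective _)

theorem quotient_zero_ne (hw : IsReducedLadder s up down i j c w) :
    (Submodule.span UA {w 1}).mkQ (w 0) ≠ 0 := by
  rw [Submodule.mkQ_apply, Ne, Submodule.Quotient.mk_eq_zero]
  exact hw.w_notMem_span le_rfl

theorem up_smul_quotient (hw : IsReducedLadder s up down i j c w) :
    ua up 0 • (Submodule.span UA {w 1}).mkQ (w 0) = 0 := by
  obtain ⟨a, -, ha⟩ := hw.up_smul 0
  rw [← map_smul, ha, Submodule.mkQ_apply, Submodule.Quotient.mk_eq_zero, zero_add]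
  exact ((Submodule.span UA {w 1}).restrictScalars ℂ).smul_mem a
    (Submodule.mem_span_singleton_self _)

end IsReducedLadder

/-- The index grows along `E`, so that `w 1` is a lowest-weight vector and the image of `w 0` modulo
`w 1` is a highest-weight vector. -/
theorem relaxedQuoMinus_structure {i : ℂ} (hi : i ≠ 0) (h : ℂ) (n : ℕ) :
    IsSimpleModule UA (IrrPlus i (h / i)) ∧ IsSimpleModule UA (IrrMinus i (h / i + 1)) ∧
      (∃ (f : IrrMinus i (h / i + 1) →ₗ[UA] RelaxedQuoMinus i h n)
        (g : RelaxedQuoMinus i h n →ₗ[UA] IrrPlus i (h / i)), IsNonsplitShortExact f g) ∧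
      IsIndecomposable (RelaxedQuoMinus i h n) ∧
      Module.length UA (RelaxedQuoMinus i h n) = 2 := by
  obtain ⟨w, hw⟩ := exists_isReducedLadder (Or.inl ⟨rfl, rfl, rfl⟩) hi h n (j := h / i - n)
    (by push_cast; ring)
  have hA := hw.isSimpleModule_span
  have hC := hw.isSimpleModule_quotient hi
  have hq := hw.isLadder_quotient
  obtain ⟨e⟩ := nonempty_irrMinus_equiv (i := i) (j := h / i + 1) hw.isLevelOne_span
    (m := ⟨w 1, Submodule.mem_span_singleton_self _⟩)
    (fun h0 => hw.ne_zero 1 (congrArg Subtype.val h0))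
    (fun A n hn => Subtype.ext (hw.pos A n 1 hn)) (Subtype.ext hw.down_smul_one)
    (Subtype.ext (hw.I_smul 1)) (Subtype.ext ((hw.J_smul 1).trans (by
      push_cast
      congr 1
      ring)))
  obtain ⟨e'⟩ := nonempty_irrPlus_equiv (i := i) (j := h / i) hq.isLevelOne hw.quotient_zero_ne
    (fun A n hn => hq.pos A n 0 hn) hw.up_smul_quotient (hq.I_smul 0) ((hq.J_smul 0).trans (by
      push_cast
      congr 1
      ring))
  exact ⟨IsSimpleModule.congr e', IsSimpleModule.congr e, hw.exists_isNonsplitShortExact e e',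
    hw.isIndecomposable, hw.length_eq_two hi⟩

/-- The index grows along `F`, so that `w 1` is a highest-weight vector and the image of `w 0` modulo
`w 1` is a lowest-weight vector. -/
theorem relaxedQuoPlus_structure {i : ℂ} (hi : i ≠ 0) (h : ℂ) (n : ℕ) :
    (∃ (f : IrrPlus i (h / i) →ₗ[UA] RelaxedQuoPlus i h n)
        (g : RelaxedQuoPlus i h n →ₗ[UA] IrrMinus i (h / i + 1)), IsNonsplitShortExact f g) ∧
      IsIndecomposable (RelaxedQuoPlus i h n) ∧
      Module.length UA (RelaxedQuoPlus i h n) = 2 := by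
  obtain ⟨w, hw⟩ := exists_isReducedLadder (Or.inr ⟨rfl, rfl, rfl⟩) hi h n (j := h / i + 1 + n)
    (by push_cast; ring)
  have hA := hw.isSimpleModule_span
  have hC := hw.isSimpleModule_quotient hi
  have hq := hw.isLadder_quotient
  obtain ⟨e⟩ := nonempty_irrPlus_equiv (i := i) (j := h / i) hw.isLevelOne_span
    (m := ⟨w 1, Submodule.mem_span_singleton_self _⟩)
    (fun h0 => hw.ne_zero 1 (congrArg Subtype.val h0))
    (fun A n hn => Subtype.ext (hw.pos A n 1 hn)) (Subtype.ext hw.down_smul_one)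
    (Subtype.ext (hw.I_smul 1)) (Subtype.ext ((hw.J_smul 1).trans (by
      push_cast
      congr 1
      ring)))
  obtain ⟨e'⟩ := nonempty_irrMinus_equiv (i := i) (j := h / i + 1) hq.isLevelOne
    hw.quotient_zero_ne (fun A n hn => hq.pos A n 0 hn) hw.up_smul_quotient (hq.I_smul 0)
    ((hq.J_smul 0).trans (by
      push_cast
      congr 1
      ring))
  exact ⟨hw.exists_isNonsplitShortExact e e', hw.isIndecomposable, hw.length_eq_two hi⟩

end NappiWitten

end

theorem mainTheorem4 (i h : ℂ) (hi : i ≠ 0) :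
    IsSimpleModule NappiWitten.UA (NappiWitten.IrrPlus i (h / i)) ∧
    IsSimpleModule NappiWitten.UA (NappiWitten.IrrMinus i (h / i + 1)) ∧
    (∀ n : ℕ,
      (∃ (f : NappiWitten.IrrPlus i (h / i) →ₗ[NappiWitten.UA] NappiWitten.RelaxedQuoPlus i h n)
          (g : NappiWitten.RelaxedQuoPlus i h n →ₗ[NappiWitten.UA]
            NappiWitten.IrrMinus i (h / i + 1)),
        NappiWitten.IsNonsplitShortExact f g) ∧
      NappiWitten.IsIndecomposable (NappiWitten.RelaxedQuoPlus i h n) ∧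
      Module.length NappiWitten.UA (NappiWitten.RelaxedQuoPlus i h n) = 2) ∧
    (∀ n : ℕ,
      (∃ (f : NappiWitten.IrrMinus i (h / i + 1) →ₗ[NappiWitten.UA]
            NappiWitten.RelaxedQuoMinus i h n)
          (g : NappiWitten.RelaxedQuoMinus i h n →ₗ[NappiWitten.UA] NappiWitten.IrrPlus i (h / i)),
        NappiWitten.IsNonsplitShortExact f g) ∧
      NappiWitten.IsIndecomposable (NappiWitten.RelaxedQuoMinus i h n) ∧
      Module.length NappiWitten.UA (NappiWitten.RelaxedQuoMinus i h n) = 2) := by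
  obtain ⟨hP, hM, -⟩ := NappiWitten.relaxedQuoMinus_structure hi h 0
  exact ⟨hP, hM, NappiWitten.relaxedQuoPlus_structure hi h,
    fun n => (NappiWitten.relaxedQuoMinus_structure hi h n).2.2⟩
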